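/- **Setting.** Modules are complex. Let $\mathfrak n_+\subset\mathfrak{gl}_n$ be the strictly upper triangular and $\mathfrak h$ the diagonal matrices, $\rho_n=\frac{n-1}2e_1+\frac{n-3}2e_2+\dots+\frac{1-n}2e_n$. Let $\mathcal O(\mathfrak{gl}_n)$ be the category of finitely generated $\mathfrak h$-diagonalizable, locally $U(\mathfrak n_+)$-nilpotent $U(\mathfrak{gl}_n)$-modules. For $0\le i\le n$ let $J_i$ be the annihilator, in the center of $U(\mathfrak{gl}_n)$, of the Verma module with highest weight $e_1+\dots+e_i-\rho_n$, and let $\mathcal O_{i,n-i}\subset\mathcal O(\mathfrak{gl}_n)$ be the full subcategory of modules annihilated by some power of $J_i$ ("generalized central character $\theta_i$"); for other $i\in\mathbb Z$ let $\mathcal O_{i,n-i}$ consist of the zero module. Let $\mathrm{proj}_{\theta_i}$ take a module to its largest submodule with generalized central character $\theta_i$ (to $0$ if $i<0$ or $i>n$). Let $L_n=\mathbb C^n$ be the standard representation, $L_n^*$ its dual, $F_V=V\otimes(-)$, and for $M\in\mathcal O_{i,n-i}$, $a\ge 0$ put $$\mathcal E_{i,n}M=\mathrm{proj}_{\theta_{i+1}}(L_n\otimes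 M),\quad \mathcal F_{i,n}M=\mathrm{proj}_{\theta_{i-1}}(L_n^*\otimes M),$$ $$\mathcal E^{(a)}_{i,n}M=\mathrm{proj}_{\theta_{i+a}}(\Lambda^aL_n\otimes M),\quad \mathcal F^{(a)}_{i,n}M=\mathrm{proj}_{\theta_{i-a}}(\Lambda^aL_n^*\otimes M).$$ Fix $n,m\ge1$. Let $\mathfrak p\subset\mathfrak{gl}_{n+m}$ be the subalgebra of block upper triangular matrices with diagonal blocks $\mathfrak{gl}_n,\mathfrak{gl}_m$, and let $Y$ be the one-dimensional $\mathfrak{gl}_n\oplus\mathfrak{gl}_m$-module with weight $-\frac m2(e_1+\dots+e_n)$ for $\mathfrak{gl}_n$ and $\frac n2(e_1+\dots+e_m)$ for $\mathfrak{gl}_m$. Put $$\mathcal C(M,N)=U(\mathfrak{gl}_{n+m})\otimes_{U(\mathfrak p)}(Y\otimes M\otimes N),$$ where the nilpotent radical of $\mathfrak p$ acts on $Y\otimes M\otimes N$ by zero. For $v\in M,\ w\in N$ write $[v,w]=1\otimes(y\otimes v\otimes w)\in\mathcal C(M,N)$, where $y$ is a fixed basis vector of $Y$. Let $\iota:L_n\to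 L_{n+m}$ be the inclusion as the first $n$ coordinates and $\pi:L_{n+m}\to L_m$ the projection to the last $m$ coordinates. **Theorem.** Let $i,j\in\mathbb Z$; all functors of two variables below are considered on $\mathcal O_{i,n-i}\times\mathcal O_{j,m-j}$, and such a functor is called exact if it is exact in each variable. 0. $\mathcal C$ maps $\mathcal O_{i,n-i}\times\mathcal O_{j,m-j}$ to $\mathcal O_{i+j,n+m-i-j}$; for all $r\ge 0$ and $l\in\mathbb Z$, $\mathcal E_{l,r},\mathcal F_{l,r},\mathcal E^{(a)}_{l,r},\mathcal F^{(a)}_{l,r}$ map $\mathcal O_{l,r-l}$ to $\mathcal O_{l',r-l'}$ with $l'=l+1,\ l-1,\ l+a,\ l-a$ respectively. 1. There is a short exact sequence of functors $$0\to \mathcal C\circ(F_{L_n}\times \mathrm{Id})\xrightarrow{\alpha} F_{L_{n+m}}\circ\mathcal C\xrightarrow{\beta}\mathcal C\circ(\mathrm{Id}\times F_{L_m})\to0,$$ $\alpha[u\otimes v,w]=\iota(u)\otimes[v,w]$, $\beta(u\otimes[v,w])=[v,\pi(u)\otimes w]$, and it contains as a direct summand, by means of the natural embeddings of $\mathcal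 E_{i,n},\mathcal E_{i+j,n+m},\mathcal E_{j,m}$ into $F_{L_n},F_{L_{n+m}},F_{L_m}$, a short exact sequence of functors $$0\to \mathcal C\circ(\mathcal E_{i,n}\times \mathrm{Id})\to \mathcal E_{i+j,n+m}\circ\mathcal C\to\mathcal C\circ(\mathrm{Id}\times \mathcal E_{j,m})\to0.$$ 2. Similarly there is a short exact sequence of functors $$0\to \mathcal C\circ(\mathrm{Id}\times F_{L_m^*})\xrightarrow{\alpha} F_{L_{n+m}^*}\circ\mathcal C\xrightarrow{\beta}\mathcal C\circ(F_{L_n^*}\times \mathrm{Id})\to0,$$ $\alpha[v,\xi\otimes w]=(\xi\circ\pi)\otimes[v,w]$, $\beta(\eta\otimes[v,w])=[(\eta\circ\iota)\otimes v,w]$, and it contains as a direct summand, by means of the natural embeddings of the functors $\mathcal F$, a short exact sequence of functors $$0\to \mathcal C\circ(\mathrm{Id}\times\mathcal F_{j,m})\to \mathcal F_{i+j,n+m}\circ\mathcal C\to\mathcal C\circ(\mathcal F_{i,n}\times \mathrm{Id})\to0.$$ 3. For every $a\ge0$ the functor $\mathcal E^{(a)}_{i+j,n+m}\circ\mathcal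 C$ is exact and has a filtration by exact functors $\mathcal E^{(a)}_{i+j,n+m}\circ\mathcal C=\mathcal G_{a+1}\supset\mathcal G_a\supset\dots\supset\mathcal G_0=0$ with short exact sequences of functors, for $0\le k\le a$, $$0\to\mathcal G_k\to\mathcal G_{k+1}\to\mathcal C\circ(\mathcal E^{(a-k)}_{i,n}\times\mathcal E^{(k)}_{j,m})\to0.$$ 4. For every $a\ge0$ the functor $\mathcal F^{(a)}_{i+j,n+m}\circ\mathcal C$ is exact and has a filtration by exact functors $\mathcal F^{(a)}_{i+j,n+m}\circ\mathcal C=\mathcal G_{a+1}\supset\mathcal G_a\supset\dots\supset\mathcal G_0=0$ with short exact sequences of functors, for $0\le k\le a$, $$0\to\mathcal G_k\to\mathcal G_{k+1}\to\mathcal C\circ(\mathcal F^{(k)}_{i,n}\times\mathcal F^{(a-k)}_{j,m})\to0.$$ -/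

import Mathlib

open CategoryTheory
open scoped TensorProduct

attribute [local instance 100] LieRing.ofAssociativeRing

universe u

noncomputable section

/-! ### The category of modules over a complex Lie algebra -/

/-- A (bundled) module over the complex Lie algebra `L`, equivalently a `U(L)`-module. -/
structure LieMod (L : Type) [LieRing L] [LieAlgebra ℂ L] where
  carrier : Type u
  [addCommGroup : AddCommGroup carrier]
  [module : Module ℂ carrier]
  [lieRingModule : LieRingModule L carrier]
  [lieModule : LieModule ℂ L carrier]

namespace LieMod

variable {L : Type} [LieRing L] [LieAlgebra ℂ L]

instance : CoeSort (LieMod.{u} L) (Type u) := ⟨LieMod.carrier⟩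

attribute [instance] LieMod.addCommGroup LieMod.module LieMod.lieRingModule LieMod.lieModule

/-- Morphisms are the `L`-equivariant linear maps. -/
@[ext]
structure Hom (M N : LieMod.{u} L) where
  hom : M →ₗ⁅ℂ,L⁆ N

instance : Category (LieMod.{u} L) where
  Hom M N := Hom M N
  id M := ⟨LieModuleHom.id⟩
  comp f g := ⟨g.hom.comp f.hom⟩

/-- The underlying equivariant linear map of a morphism. -/
abbrev toLin {M N : LieMod.{u} L} (f : M ⟶ N) : M →ₗ⁅ℂ,L⁆ N := Hom.hom f

@[ext]
theorem hom_ext {M N : LieMod.{u} L} {f g : M ⟶ N} (h : ∀ x, toLin f x = toLin g x) : f = g :=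
  Hom.ext (LieModuleHom.ext h)

@[simp] theorem toLin_id (M : LieMod.{u} L) (x : M) : toLin (𝟙 M) x = x := rfl

@[simp] theorem toLin_comp {M N P : LieMod.{u} L} (f : M ⟶ N) (g : N ⟶ P) (x : M) :
    toLin (f ≫ g) x = toLin g (toLin f x) := rfl

/-- The action of the universal enveloping algebra `U(L)` on an `L`-module. -/
def act (M : LieMod.{u} L) : UniversalEnvelopingAlgebra ℂ L →ₐ[ℂ] Module.End ℂ M :=
  UniversalEnvelopingAlgebra.lift ℂ (LieModule.toEnd ℂ L M)

theorem act_ι (M : LieMod.{u} L) (x : L) (m : M) :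
    act M (UniversalEnvelopingAlgebra.ι ℂ x) m = ⁅x, m⁆ := by
  simp only [act, UniversalEnvelopingAlgebra.lift_ι_apply]
  rfl

theorem toLin_act {M N : LieMod.{u} L} (f : M ⟶ N) (w : UniversalEnvelopingAlgebra ℂ L) (m : M) :
    toLin f (act M w m) = act N w (toLin f m) := by
  obtain ⟨t, rfl⟩ : ∃ t, UniversalEnvelopingAlgebra.mkAlgHom ℂ L t = w :=
    RingCon.mk'_surjective (c := UniversalEnvelopingAlgebra.ringCon ℂ L) w
  induction t using TensorAlgebra.induction generalizing m with
  | algebraMap r => simp [Algebra.algebraMap_eq_smul_one]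
  | ι x =>
    have := act_ι M x m
    have h2 := act_ι N x (toLin f m)
    rw [UniversalEnvelopingAlgebra.ι_apply] at this h2
    rw [this, h2, LieModuleHom.map_lie]
  | mul a b ha hb => rw [map_mul, map_mul, map_mul, Module.End.mul_apply, Module.End.mul_apply, ha, hb]
  | add a b ha hb => simp only [map_add, LinearMap.add_apply, ha, hb]

/-- The functor of tensoring with a fixed `L`-module `V`; `L` acts on `V ⊗ M` by the Leibniz rule. -/
def tensorLeft (V : LieMod.{0} L) : LieMod.{u} L ⥤ LieMod.{u} L where
  obj M := ⟨V ⊗[ℂ] M⟩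
  map {M N} f := ⟨TensorProduct.LieModule.map (LieModuleHom.id : V →ₗ⁅ℂ,L⁆ V) (toLin f)⟩
  map_id M := by
    ext x
    induction x using TensorProduct.induction_on with
    | zero => simp
    | tmul v m => rfl
    | add a b ha hb => rw [map_add, map_add, ha, hb]
  map_comp f g := by
    ext x
    induction x using TensorProduct.induction_on with
    | zero => simp
    | tmul v m => rfl
    | add a b ha hb => rw [map_add, map_add, ha, hb]

/-- The tensor product of two `L`-modules as a bifunctor. -/
def tensor : LieMod.{u} L × LieMod.{u} L ⥤ LieMod.{u} L where
  obj X := ⟨X.1 ⊗[ℂ] X.2⟩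
  map {X Y} f := ⟨TensorProduct.LieModule.map (toLin f.1) (toLin f.2)⟩
  map_id M := by
    ext x
    induction x using TensorProduct.induction_on with
    | zero => simp
    | tmul v m => rfl
    | add a b ha hb => rw [map_add, map_add, ha, hb]
  map_comp f g := by
    ext x
    induction x using TensorProduct.induction_on with
    | zero => simp
    | tmul v m => rfl
    | add a b ha hb => rw [map_add, map_add, ha, hb]

/-- Pulling back modules along a homomorphism of Lie algebras. -/
def res {L' : Type} [LieRing L'] [LieAlgebra ℂ L'] (φ : L' →ₗ⁅ℂ⁆ L) :
    LieMod.{u} L ⥤ LieMod.{u} L' where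
  obj M :=
    letI := LieRingModule.compLieHom M φ
    haveI := LieModule.compLieHom M φ
    ⟨M⟩
  map {M N} f :=
    letI : LieRingModule L' M := LieRingModule.compLieHom M φ
    letI : LieRingModule L' N := LieRingModule.compLieHom N φ
    ⟨({ ((toLin f : M →ₗ⁅ℂ,L⁆ N) : M →ₗ[ℂ] N) with
        map_lie' := fun {x m} => (toLin f).map_lie (φ x) m } : M →ₗ⁅ℂ,L'⁆ N)⟩

/-- The one-dimensional module `ℂ` on which `x` acts by the scalar `χ x`. -/
def ofCharacter (χ : L →ₗ[ℂ] ℂ) (hχ : ∀ x y : L, χ ⁅x, y⁆ = 0) : LieMod.{0} L :=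
  letI : LieRingModule L ℂ :=
    { bracket x c := χ x * c
      add_lie x y c := by simp only [map_add, add_mul]
      lie_add x c d := mul_add (χ x) c d
      leibniz_lie x y c := by
        change χ x * (χ y * c) = χ ⁅x, y⁆ * c + χ y * (χ x * c)
        rw [hχ]; ring }
  haveI : LieModule ℂ L ℂ :=
    { smul_lie t x c := by 
        change χ (t • x) * c = t • (χ x * c)
        rw [map_smul, smul_eq_mul, smul_eq_mul, mul_assoc]
      lie_smul t x c := by 
        change χ x * (t • c) = t • (χ x * c)
        rw [smul_eq_mul, smul_eq_mul]; ring }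
  ⟨ℂ⟩

/-! ### Induction -/

variable (p : LieSubalgebra ℂ L)

/-- The homomorphism `U(p) → U(L)` induced by the inclusion of a Lie subalgebra `p ⊆ L`. -/
def envIncl : UniversalEnvelopingAlgebra ℂ p →ₐ[ℂ] UniversalEnvelopingAlgebra ℂ L :=
  UniversalEnvelopingAlgebra.lift ℂ ((UniversalEnvelopingAlgebra.ι ℂ).comp p.incl)

/-- The relations `(w ⊗ 1) n = 1 ⊗ w n` (`w ∈ U(p)`), and their left `U(L)`-multiples, by which
`U(L) ⊗[ℂ] N` is divided to form `U(L) ⊗[U(p)] N`. -/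
def indRel (N : LieMod.{u} p) :
    Submodule (UniversalEnvelopingAlgebra ℂ L) (UniversalEnvelopingAlgebra ℂ L ⊗[ℂ] N) :=
  Submodule.span _
    {t | ∃ (a : UniversalEnvelopingAlgebra ℂ L) (w : UniversalEnvelopingAlgebra ℂ p) (n : N),
      t = (a * envIncl p w) ⊗ₜ[ℂ] n - a ⊗ₜ[ℂ] act N w n}

/-- `U(L) ⊗[U(p)] N`. -/
abbrev IndCarrier (N : LieMod.{u} p) : Type u :=
  (UniversalEnvelopingAlgebra ℂ L ⊗[ℂ] N) ⧸ indRel p N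

/-- `U(L) ⊗[U(p)] N`, with `L ⊆ U(L)` acting by left multiplication. -/
def indObj (N : LieMod.{u} p) : LieMod.{u} L :=
  letI : LieRingModule L (IndCarrier p N) :=
    { bracket x q := UniversalEnvelopingAlgebra.ι ℂ x • q
      add_lie x y q := by simp only [map_add, add_smul]
      lie_add x q r := smul_add _ _ _
      leibniz_lie x y q := by
        simp only [LieHom.map_lie, LieRing.of_associative_ring_bracket, sub_smul, mul_smul]
        abel }
  haveI : LieModule ℂ L (IndCarrier p N) :=
    { smul_lie t x q := by
        change UniversalEnvelopingAlgebra.ι ℂ (t • x) • q = t • UniversalEnvelopingAlgebra.ι ℂ x • q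
        rw [map_smul, smul_assoc]
      lie_smul t x q := by
        change UniversalEnvelopingAlgebra.ι ℂ x • t • q = t • UniversalEnvelopingAlgebra.ι ℂ x • q
        rw [← algebraMap_smul (UniversalEnvelopingAlgebra ℂ L) t q,
          ← algebraMap_smul (UniversalEnvelopingAlgebra ℂ L) t, ← mul_smul, ← mul_smul,
          Algebra.commutes] }
  ⟨IndCarrier p N⟩

/-- The element `a ⊗ n` of the induced module. -/
def indMk (N : LieMod.{u} p) (a : UniversalEnvelopingAlgebra ℂ L) (n : N) : indObj p N :=
  (Submodule.Quotient.mk (a ⊗ₜ[ℂ] n) : IndCarrier p N)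

variable {p} in
theorem ind_ext {N : LieMod.{u} p} {M : LieMod.{u} L} {f g : indObj p N ⟶ M}
    (h : ∀ a n, toLin f (indMk p N a n) = toLin g (indMk p N a n)) : f = g := by
  ext x
  obtain ⟨t, rfl⟩ := Submodule.Quotient.mk_surjective (indRel p N) x
  induction t using TensorProduct.induction_on with
  | zero => exact (map_zero (toLin f)).trans (map_zero (toLin g)).symm
  | tmul a n => exact h a n
  | add a b ha hb =>
    exact (map_add (toLin f) _ _).trans ((congrArg₂ (· + ·) ha hb).trans
      (map_add (toLin g) _ _).symm)

/-- The `U(L)`-linear map `a ⊗ n ↦ a ⊗ f n` between induced modules. -/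
def indMapAux {N N' : LieMod.{u} p} (f : N ⟶ N') :
    IndCarrier p N →ₗ[UniversalEnvelopingAlgebra ℂ L] IndCarrier p N' :=
  Submodule.mapQ _ _ (TensorProduct.AlgebraTensorModule.map LinearMap.id
      ((toLin f : N →ₗ⁅ℂ,p⁆ N') : N →ₗ[ℂ] N')) <| by
    rw [indRel, Submodule.span_le]
    rintro _ ⟨a, w, n, rfl⟩
    refine Submodule.subset_span ⟨a, w, toLin f n, ?_⟩
    rw [map_sub]
    simp only [TensorProduct.AlgebraTensorModule.map_tmul, LinearMap.id_apply,
      LieModuleHom.coe_toLinearMap, toLin_act]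

/-- The induction functor `N ↦ U(L) ⊗[U(p)] N`. -/
def ind : LieMod.{u} p ⥤ LieMod.{u} L where
  obj N := indObj p N
  map f := ⟨{ toFun := indMapAux p f
              map_add' := (indMapAux p f).map_add
              map_smul' := fun c q => ((indMapAux p f).restrictScalars ℂ).map_smul c q
              map_lie' := fun {x q} =>
                (indMapAux p f).map_smul (UniversalEnvelopingAlgebra.ι ℂ x) q }⟩
  map_id _ := ind_ext fun _ _ => rfl
  map_comp _ _ := ind_ext fun _ _ => rfl

end LieMod

/-! ### Exterior powers of a module -/

namespace LieMod

variable {L : Type} [LieRing L] [LieAlgebra ℂ L]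

section Exterior

variable {V : Type} [AddCommGroup V] [Module ℂ V]

/-- Auxiliary algebra homomorphism `v ↦ v + ε f(v)` into dual numbers over the exterior algebra. -/
def extDerivAux (f : Module.End ℂ V) :
    ExteriorAlgebra ℂ V →ₐ[ℂ] TrivSqZeroExt (ExteriorAlgebra ℂ V) (ExteriorAlgebra ℂ V) :=
  ExteriorAlgebra.lift ℂ ⟨
      (TrivSqZeroExt.inlAlgHom ℂ _ _).toLinearMap ∘ₗ ExteriorAlgebra.ι ℂ +
        (TrivSqZeroExt.inrHom _ _).restrictScalars ℂ ∘ₗ ExteriorAlgebra.ι ℂ ∘ₗ f, fun v => by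
    ext <;> simp⟩

theorem fst_extDerivAux (f : Module.End ℂ V) (x : ExteriorAlgebra ℂ V) :
    (extDerivAux f x).fst = x := by
  have : (TrivSqZeroExt.fstHom ℂ _ _).comp (extDerivAux f) = AlgHom.id ℂ _ := by
    ext v
    simp [extDerivAux]
  exact DFunLike.congr_fun this x

/-- The derivation of the exterior algebra that extends the endomorphism `f` of `V`, so that
`v₁ ∧ ⋯ ∧ vₖ ↦ ∑ᵢ v₁ ∧ ⋯ ∧ f vᵢ ∧ ⋯ ∧ vₖ`. -/
def extDeriv (f : Module.End ℂ V) : Module.End ℂ (ExteriorAlgebra ℂ V) where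
  toFun x := (extDerivAux f x).snd
  map_add' x y := by simp
  map_smul' c x := by simp

theorem extDeriv_ι (f : Module.End ℂ V) (v : V) :
    extDeriv f (ExteriorAlgebra.ι ℂ v) = ExteriorAlgebra.ι ℂ (f v) := by
  simp [extDeriv, extDerivAux]

theorem extDeriv_mul (f : Module.End ℂ V) (x y : ExteriorAlgebra ℂ V) :
    extDeriv f (x * y) = extDeriv f x * y + x * extDeriv f y := by
  simp [extDeriv, fst_extDerivAux, add_comm]

theorem extDeriv_algebraMap (f : Module.End ℂ V) (r : ℂ) :
    extDeriv f (algebraMap ℂ _ r) = 0 := by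
  simp [extDeriv, AlgHom.commutes, TrivSqZeroExt.algebraMap_eq_inl']

theorem extDeriv_unique (f : Module.End ℂ V) (D : Module.End ℂ (ExteriorAlgebra ℂ V))
    (h0 : ∀ r, D (algebraMap ℂ _ r) = 0)
    (h1 : ∀ v, D (ExteriorAlgebra.ι ℂ v) = ExteriorAlgebra.ι ℂ (f v))
    (h2 : ∀ x y, D (x * y) = D x * y + x * D y) : D = extDeriv f := by
  refine LinearMap.ext fun x => ?_
  induction x using ExteriorAlgebra.induction with
  | algebraMap r => rw [h0, extDeriv_algebraMap]
  | ι v => rw [h1, extDeriv_ι]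
  | mul a b ha hb => rw [h2, extDeriv_mul, ha, hb]
  | add a b ha hb => rw [map_add, map_add, ha, hb]

/-- `f ↦ extDeriv f` is a homomorphism of Lie algebras. -/
def extDerivHom : Module.End ℂ V →ₗ⁅ℂ⁆ Module.End ℂ (ExteriorAlgebra ℂ V) where
  toFun := extDeriv
  map_add' f g := (extDeriv_unique _ _ (fun r => by simp [extDeriv_algebraMap])
    (fun v => by simp [extDeriv_ι])
    (fun x y => by simp only [LinearMap.add_apply, extDeriv_mul]; noncomm_ring)).symm
  map_smul' c f := (extDeriv_unique _ _ (fun r => by simp [extDeriv_algebraMap])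
    (fun v => by simp [extDeriv_ι])
    (fun x y => by simp [extDeriv_mul])).symm
  map_lie' {f g} := (extDeriv_unique _ _
    (fun r => by simp [LieRing.of_associative_ring_bracket, extDeriv_algebraMap])
    (fun v => by simp [LieRing.of_associative_ring_bracket, extDeriv_ι])
    (fun x y => by
      simp only [LieRing.of_associative_ring_bracket, LinearMap.sub_apply, Module.End.mul_apply,
        extDeriv_mul, map_add]
      noncomm_ring)).symm

theorem extDeriv_mem (f : Module.End ℂ V) (k : ℕ) {x : ExteriorAlgebra ℂ V}
    (hx : x ∈ ⋀[ℂ]^k V) : extDeriv f x ∈ ⋀[ℂ]^k V := by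
  induction hx using Submodule.pow_induction_on_left' with
  | algebraMap r => rw [extDeriv_algebraMap]; exact zero_mem _
  | add x y i hx hy ihx ihy => rw [map_add]; exact add_mem ihx ihy
  | mem_mul m hm i x hx ih =>
    obtain ⟨v, rfl⟩ := hm
    rw [extDeriv_mul, extDeriv_ι]
    change _ ∈ LinearMap.range (ExteriorAlgebra.ι ℂ) ^ (i + 1)
    rw [pow_succ']
    exact add_mem (Submodule.mul_mem_mul ⟨_, rfl⟩ hx) (Submodule.mul_mem_mul ⟨_, rfl⟩ ih)

end Exterior

/-- The `k`-th exterior power `Λᵏ V` of an `L`-module `V`, on which `L` acts by the Leibniz rule. -/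
def extPow (k : ℕ) (V : LieMod.{0} L) : LieMod.{0} L :=
  letI : LieRingModule L (⋀[ℂ]^k V) :=
    { bracket x w := ⟨extDerivHom (LieModule.toEnd ℂ L V x) w, extDeriv_mem _ k w.2⟩
      add_lie x y w := Subtype.ext <| by simp
      lie_add x w w' := Subtype.ext <| by simp
      leibniz_lie x y w := Subtype.ext <| by
        change extDerivHom (LieModule.toEnd ℂ L V x) (extDerivHom (LieModule.toEnd ℂ L V y) w.1) =
          extDerivHom (LieModule.toEnd ℂ L V ⁅x, y⁆) w.1 +
          extDerivHom (LieModule.toEnd ℂ L V y) (extDerivHom (LieModule.toEnd ℂ L V x) w.1)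
        rw [LieHom.map_lie, LieHom.map_lie, LieRing.of_associative_ring_bracket]
        simp }
  haveI : LieModule ℂ L (⋀[ℂ]^k V) :=
    { smul_lie t x w := Subtype.ext <| by
        change extDerivHom (LieModule.toEnd ℂ L V (t • x)) w.1 =
          t • extDerivHom (LieModule.toEnd ℂ L V x) w.1
        simp
      lie_smul t x w := Subtype.ext <| by
        change extDerivHom (LieModule.toEnd ℂ L V x) (t • w.1) =
          t • extDerivHom (LieModule.toEnd ℂ L V x) w.1
        simp }
  ⟨⋀[ℂ]^k V⟩

/-- The dual `V*` of an `L`-module, with the action `(x f)(v) = - f (x v)`. -/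
def dual (V : LieMod.{0} L) : LieMod.{0} L := ⟨Module.Dual ℂ V⟩

/-! ### Exactness -/

/-- `0 → M₁ → M₂ → M₃ → 0` is a short exact sequence of modules. -/
def IsShortExact {M₁ M₂ M₃ : LieMod.{u} L} (f : M₁ ⟶ M₂) (g : M₂ ⟶ M₃) : Prop :=
  Function.Injective (toLin f) ∧ Function.Exact (toLin f) (toLin g) ∧
    Function.Surjective (toLin g)

/-- `0 → A → B → D → 0` is a short exact sequence of module-valued functors. -/
def IsShortExactFunctors {C : Type*} [Category C] {A B D : C ⥤ LieMod.{u} L}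
    (α : A ⟶ B) (β : B ⟶ D) : Prop :=
  ∀ X, IsShortExact (α.app X) (β.app X)

/-- The short exact sequence of functors `A' → B' → D'` is a direct summand of `A → B → D` by means
of the given embeddings `s₁, s₂, s₃`: these form a morphism of sequences which has a left inverse
`r₁, r₂, r₃`. -/
def IsDirectSummand {C : Type*} [Category C] {A' B' D' A B D : C ⥤ LieMod.{u} L}
    (α' : A' ⟶ B') (β' : B' ⟶ D') (α : A ⟶ B) (β : B ⟶ D)
    (s₁ : A' ⟶ A) (s₂ : B' ⟶ B) (s₃ : D' ⟶ D) : Prop :=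
  (α' ≫ s₂ = s₁ ≫ α ∧ β' ≫ s₃ = s₂ ≫ β) ∧
  ∃ (r₁ : A ⟶ A') (r₂ : B ⟶ B') (r₃ : D ⟶ D'),
    (α ≫ r₂ = r₁ ≫ α' ∧ β ≫ r₃ = r₂ ≫ β') ∧
    s₁ ≫ r₁ = 𝟙 A' ∧ s₂ ≫ r₂ = 𝟙 B' ∧ s₃ ≫ r₃ = 𝟙 D'

end LieMod

/-! ### The Lie algebra `gl n` and its category `O` -/

namespace GLn

open LieMod

/-- The Lie algebra of complex `n × n` matrices. -/
abbrev gl (n : ℕ) : Type := Matrix (Fin n) (Fin n) ℂ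

/-- The enveloping algebra `U(gl n)`. -/
abbrev Env (n : ℕ) : Type := UniversalEnvelopingAlgebra ℂ (gl n)

/-- Membership in the subalgebra `𝔫₊` of strictly upper triangular matrices. -/
def IsStrictUpper {n : ℕ} (x : gl n) : Prop := ∀ a b, b ≤ a → x a b = 0

/-- The space of vectors of weight `μ₁ e₁ + ⋯ + μₙ eₙ` for the Cartan subalgebra of diagonal
matrices. -/
def weightSpace {n : ℕ} (M : LieMod.{u} (gl n)) (μ : Fin n → ℂ) : Submodule ℂ M where
  carrier := {v | ∀ d : Fin n → ℂ, ⁅(Matrix.diagonal d : gl n), v⁆ = (∑ k, d k * μ k) • v}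
  add_mem' hv hw d := by rw [lie_add, hv d, hw d, smul_add]
  zero_mem' d := by rw [lie_zero, smul_zero]
  smul_mem' c v hv d := by rw [lie_smul, hv d, smul_comm]

/-- The category `O(gl n)`: finitely generated modules which are diagonalizable over the diagonal
matrices and locally `U(𝔫₊)`-nilpotent. -/
def catO (n : ℕ) : ObjectProperty (LieMod.{u} (gl n)) := fun M =>
  (∃ s : Finset M, LieSubmodule.lieSpan ℂ (gl n) (s : Set M) = ⊤) ∧
  (⨆ μ, weightSpace M μ) = ⊤ ∧
  ∀ v : M, ∃ N : ℕ, ∀ l : List (gl n), (∀ x ∈ l, IsStrictUpper x) → l.length = N →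
    l.foldr (fun x w => ⁅x, w⁆) v = 0

/-- The half-sum of the positive roots, `((n-1)/2, (n-3)/2, …, (1-n)/2)`. -/
def rho (n : ℕ) : Fin n → ℂ := fun k => ((n : ℂ) - 1) / 2 - (k : ℕ)

/-- The left ideal of `U(gl n)` generated by `𝔫₊` and the elements `h - (μ - ρ)(h)`, `h` diagonal.
The quotient by it is the Verma module with highest weight `μ - ρ`. -/
def vermaIdeal (n : ℕ) (μ : Fin n → ℂ) : Submodule (Env n) (Env n) :=
  Submodule.span (Env n)
    ({t | ∃ x : gl n, IsStrictUpper x ∧ t = UniversalEnvelopingAlgebra.ι ℂ x} ∪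
     {t | ∃ d : Fin n → ℂ, t = UniversalEnvelopingAlgebra.ι ℂ (Matrix.diagonal d : gl n) -
        algebraMap ℂ (Env n) (∑ k, d k * (μ k - rho n k))})

/-- The Verma module with highest weight `μ - ρ`. -/
abbrev Verma (n : ℕ) (μ : Fin n → ℂ) : Type := Env n ⧸ vermaIdeal n μ

/-- The ideal of the center of `U(gl n)` formed by the elements that annihilate the Verma module of
highest weight `μ - ρ`. -/
def centralIdeal (n : ℕ) (μ : Fin n → ℂ) : Ideal (Subalgebra.center ℂ (Env n)) :=
  (Module.annihilator (Env n) (Verma n μ)).comap (Subalgebra.center ℂ (Env n)).val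

/-- The weight `e₁ + ⋯ + eᵢ` of `gl n`. -/
def fundWeight (n : ℕ) (i : ℤ) : Fin n → ℂ := fun k => if ((k : ℕ) : ℤ) < i then 1 else 0

/-- `M` has the generalized central character of the weight `e₁ + ⋯ + eᵢ` if `0 ≤ i ≤ n`: it is
annihilated by some power of the corresponding ideal of the center. For the other `i ∈ ℤ` the
condition is `M = 0`. -/
def HasGenChar (n : ℕ) (i : ℤ) (M : LieMod.{u} (gl n)) : Prop :=
  (∀ v : M, v = 0) ∨
  (0 ≤ i ∧ i ≤ n ∧ ∃ N : ℕ, ∀ z ∈ centralIdeal n (fundWeight n i) ^ N, ∀ v : M,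
    act M (z : Env n) v = 0)

/-- The block `O_{i,n-i}` of the category `O(gl n)`; it is zero unless `0 ≤ i ≤ n`. -/
def block (n : ℕ) (i : ℤ) : ObjectProperty (LieMod.{u} (gl n)) := fun M =>
  catO n M ∧ HasGenChar n i M

/-- The module given by a submodule. -/
def ofSub {n : ℕ} {M : LieMod.{u} (gl n)} (N : LieSubmodule ℂ (gl n) M) : LieMod.{u} (gl n) := ⟨N⟩

/-- A quotient of a module with a generalized central character has the same character. -/
theorem HasGenChar.of_surjective {n : ℕ} {i : ℤ} {M N : LieMod.{u} (gl n)} (f : M ⟶ N)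
    (hf : Function.Surjective (toLin f)) (h : HasGenChar n i M) : HasGenChar n i N := by
  rcases h with h | ⟨h0, h1, k, h⟩
  · refine Or.inl fun v => ?_
    obtain ⟨w, rfl⟩ := hf v
    rw [h w, map_zero]
  · refine Or.inr ⟨h0, h1, k, fun z hz v => ?_⟩
    obtain ⟨w, rfl⟩ := hf v
    rw [← toLin_act, h z hz, map_zero]

/-- The largest submodule of `M` with the generalized central character of `e₁ + ⋯ + eᵢ`. -/
def projSub (n : ℕ) (i : ℤ) (M : LieMod.{u} (gl n)) : LieSubmodule ℂ (gl n) M :=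
  sSup {N | HasGenChar n i (ofSub N)}

theorem map_projSub {n : ℕ} {i : ℤ} {M N : LieMod.{u} (gl n)} (f : M ⟶ N) :
    (projSub n i M).map (toLin f) ≤ projSub n i N := by
  rw [LieSubmodule.map_le_iff_le_comap, projSub]
  refine sSup_le fun P hP => ?_
  rw [← LieSubmodule.map_le_iff_le_comap]
  refine le_sSup ?_
  let g : ofSub P ⟶ ofSub (P.map (toLin f)) :=
    ⟨{ toFun := fun v => ⟨toLin f v.1, (LieSubmodule.mem_map _).2 ⟨v.1, v.2, rfl⟩⟩
       map_add' := fun v w => Subtype.ext (map_add (toLin f) v.1 w.1)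
       map_smul' := fun c v => Subtype.ext (map_smul (toLin f) c v.1)
       map_lie' := fun {x v} => Subtype.ext (LieModuleHom.map_lie (toLin f) x v.1) }⟩
  refine HasGenChar.of_surjective g ?_ hP
  rintro ⟨_, hv⟩
  obtain ⟨w, hw, rfl⟩ := (LieSubmodule.mem_map _).1 hv
  exact ⟨⟨w, hw⟩, rfl⟩

/-- The functor that takes a module to its largest submodule with the generalized central character
of `e₁ + ⋯ + eᵢ`. -/
def proj (n : ℕ) (i : ℤ) : LieMod.{u} (gl n) ⥤ LieMod.{u} (gl n) where
  obj M := ofSub (projSub n i M)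
  map f :=
    ⟨{ toFun := fun v => ⟨toLin f v.1,
          map_projSub f ((LieSubmodule.mem_map _).2 ⟨v.1, v.2, rfl⟩)⟩
       map_add' := fun v w => Subtype.ext (map_add (toLin f) v.1 w.1)
       map_smul' := fun c v => Subtype.ext (map_smul (toLin f) c v.1)
       map_lie' := fun {x v} => Subtype.ext (LieModuleHom.map_lie (toLin f) x v.1) }⟩

/-- The inclusion of the largest submodule with the given generalized central character. -/
def projIncl (n : ℕ) (i : ℤ) : proj.{u} n i ⟶ 𝟭 (LieMod.{u} (gl n)) where
  app M := ⟨(projSub n i M).incl⟩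

/-! ### The functors `E` and `F` -/

/-- The `n`-dimensional fundamental representation `Lₙ` of `gl n`. -/
def std (n : ℕ) : LieMod.{0} (gl n) := ⟨Fin n → ℂ⟩

/-- `E_{i,n}`: tensor with `Lₙ` and project to the generalized character with index `i + 1`. -/
def E (n : ℕ) (i : ℤ) : LieMod.{u} (gl n) ⥤ LieMod.{u} (gl n) :=
  tensorLeft (std n) ⋙ proj n (i + 1)

/-- `F_{i,n}`: tensor with `Lₙ*` and project to the generalized character with index `i - 1`. -/
def F (n : ℕ) (i : ℤ) : LieMod.{u} (gl n) ⥤ LieMod.{u} (gl n) :=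
  tensorLeft (dual (std n)) ⋙ proj n (i - 1)

/-- The divided power `E^{(a)}_{i,n}`: tensor with `Λᵃ Lₙ` and project to the index `i + a`. -/
def Ediv (a n : ℕ) (i : ℤ) : LieMod.{u} (gl n) ⥤ LieMod.{u} (gl n) :=
  tensorLeft (extPow a (std n)) ⋙ proj n (i + a)

/-- The divided power `F^{(a)}_{i,n}`: tensor with `Λᵃ Lₙ*` and project to the index `i - a`. -/
def Fdiv (a n : ℕ) (i : ℤ) : LieMod.{u} (gl n) ⥤ LieMod.{u} (gl n) :=
  tensorLeft (extPow a (dual (std n))) ⋙ proj n (i - a)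

/-- The embedding of `E_{i,n}` into the functor of tensoring with `Lₙ`. -/
def inclE (n : ℕ) (i : ℤ) : E.{u} n i ⟶ tensorLeft.{u} (std n) :=
  Functor.whiskerLeft (tensorLeft (std n)) (projIncl n (i + 1))

/-- The embedding of `F_{i,n}` into the functor of tensoring with `Lₙ*`. -/
def inclF (n : ℕ) (i : ℤ) : F.{u} n i ⟶ tensorLeft.{u} (dual (std n)) :=
  Functor.whiskerLeft (tensorLeft (dual (std n))) (projIncl n (i - 1))

/-! ### The bifunctor `C` -/

section Parabolic

variable (n m : ℕ)

/-- The parabolic subalgebra of block upper triangular matrices in `gl (n + m)`. -/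
def parabolic : LieSubalgebra ℂ (gl (n + m)) where
  carrier := {x | ∀ (b : Fin m) (a : Fin n), x (Fin.natAdd n b) (Fin.castAdd m a) = 0}
  add_mem' hx hy b a := by rw [Matrix.add_apply, hx, hy, add_zero]
  zero_mem' _ _ := rfl
  smul_mem' c x hx b a := by rw [Matrix.smul_apply, hx, smul_zero]
  lie_mem' {x y} hx hy b a := by
    rw [LieRing.of_associative_ring_bracket, Matrix.sub_apply, Matrix.mul_apply, Matrix.mul_apply,
      Fin.sum_univ_add, Fin.sum_univ_add]
    simp only [hx b, hy b, fun c => hx c a, fun c => hy c a]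
    simp

/-- The projection of the parabolic subalgebra to its diagonal block `gl n`. -/
def blockFst : parabolic n m →ₗ⁅ℂ⁆ gl n where
  toFun x := x.1.submatrix (Fin.castAdd m) (Fin.castAdd m)
  map_add' _ _ := rfl
  map_smul' _ _ := rfl
  map_lie' {x y} := by
    ext a b
    have hx := x.2
    have hy := y.2
    simp only [parabolic] at hx hy
    simp only [LieSubalgebra.coe_bracket, LieRing.of_associative_ring_bracket, Matrix.sub_apply,
      Matrix.mul_apply, Matrix.submatrix_apply, Fin.sum_univ_add]
    have h1 : ∀ c, x.1 (Fin.natAdd n c) (Fin.castAdd m b) = 0 := fun c => x.2 c b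
    have h2 : ∀ c, y.1 (Fin.natAdd n c) (Fin.castAdd m b) = 0 := fun c => y.2 c b
    simp [h1, h2]

/-- The projection of the parabolic subalgebra to its diagonal block `gl m`. -/
def blockSnd : parabolic n m →ₗ⁅ℂ⁆ gl m where
  toFun x := x.1.submatrix (Fin.natAdd n) (Fin.natAdd n)
  map_add' _ _ := rfl
  map_smul' _ _ := rfl
  map_lie' {x y} := by
    ext a b
    simp only [LieSubalgebra.coe_bracket, LieRing.of_associative_ring_bracket, Matrix.sub_apply,
      Matrix.mul_apply, Matrix.submatrix_apply, Fin.sum_univ_add]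
    have h1 : ∀ c, x.1 (Fin.natAdd n a) (Fin.castAdd m c) = 0 := fun c => x.2 a c
    have h2 : ∀ c, y.1 (Fin.natAdd n a) (Fin.castAdd m c) = 0 := fun c => y.2 a c
    simp [h1, h2]

/-- The one-dimensional module with weight `-(m/2) (e₁ + ⋯ + eₙ)` over `gl n` and
`(n/2) (e₁ + ⋯ + eₘ)` over `gl m`. -/
def shift : LieMod.{0} (parabolic n m) :=
  ofCharacter
    ((-(m : ℂ) / 2) • Matrix.traceLinearMap (Fin n) ℂ ℂ ∘ₗ (blockFst n m : _ →ₗ[ℂ] gl n) +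
      ((n : ℂ) / 2) • Matrix.traceLinearMap (Fin m) ℂ ℂ ∘ₗ (blockSnd n m : _ →ₗ[ℂ] gl m))
    (fun x y => by
      have h1 : (blockFst n m ⁅x, y⁆).trace = 0 := by
        rw [LieHom.map_lie, LieRing.of_associative_ring_bracket, Matrix.trace_sub,
          Matrix.trace_mul_comm, sub_self]
      have h2 : (blockSnd n m ⁅x, y⁆).trace = 0 := by
        rw [LieHom.map_lie, LieRing.of_associative_ring_bracket, Matrix.trace_sub,
          Matrix.trace_mul_comm, sub_self]
      rw [LinearMap.add_apply, LinearMap.smul_apply, LinearMap.smul_apply]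
      change _ • (blockFst n m ⁅x, y⁆).trace + _ • (blockSnd n m ⁅x, y⁆).trace = 0
      rw [h1, h2, smul_zero, smul_zero, add_zero])

/-- `(M, N) ↦ Y ⊗ (M ⊗ N)` as a module over the parabolic subalgebra, the nilpotent radical acting
by zero. -/
def C₀ : LieMod.{u} (gl n) × LieMod.{u} (gl m) ⥤ LieMod.{u} (parabolic n m) :=
  (res (blockFst n m)).prod (res (blockSnd n m)) ⋙ tensor ⋙ tensorLeft (shift n m)

/-- The parabolic induction bifunctor. -/
def C : LieMod.{u} (gl n) × LieMod.{u} (gl m) ⥤ LieMod.{u} (gl (n + m)) :=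
  C₀ n m ⋙ ind (parabolic n m)

/-- The element `1 ⊗ (1 ⊗ (v ⊗ w))` of `C (M, N)`, where `v ∈ M` and `w ∈ N`. -/
def mkC {M : LieMod.{u} (gl n)} {N : LieMod.{u} (gl m)} (v : M) (w : N) : (C n m).obj (M, N) :=
  indMk (parabolic n m) ((C₀ n m).obj (M, N)) 1 (((1 : ℂ) : shift n m) ⊗ₜ[ℂ] (v ⊗ₜ[ℂ] w))

/-- The inclusion `Lₙ → Lₙ₊ₘ` onto the span of the first `n` basis vectors. -/
def inclL : (Fin n → ℂ) →ₗ[ℂ] (Fin (n + m) → ℂ) where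
  toFun v := Fin.append v 0
  map_add' v w := by
    ext k
    refine Fin.addCases (fun a => ?_) (fun b => ?_) k <;> simp
  map_smul' c v := by
    ext k
    refine Fin.addCases (fun a => ?_) (fun b => ?_) k <;> simp

/-- The projection `Lₙ₊ₘ → Lₘ` onto the last `m` coordinates. -/
def projL : (Fin (n + m) → ℂ) →ₗ[ℂ] (Fin m → ℂ) := LinearMap.funLeft ℂ ℂ (Fin.natAdd n)

/-! ### Functors on a product of blocks -/

/-- The product category `O_{i,n-i} × O_{j,m-j}`. -/
abbrev Blocks (i j : ℤ) : Type (u + 1) :=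
  (block.{u} n i).FullSubcategory × (block.{u} m j).FullSubcategory

variable (i j : ℤ)

/-- The inclusion of `O_{i,n-i} × O_{j,m-j}` into all pairs of modules. -/
def blocksIncl : Blocks.{u} n m i j ⥤ LieMod.{u} (gl n) × LieMod.{u} (gl m) :=
  (block n i).ι.prod (block m j).ι

variable {n m i j}

/-- `C ∘ (S × T)` on `O_{i,n-i} × O_{j,m-j}`. -/
def beforeC (S : LieMod.{u} (gl n) ⥤ LieMod.{u} (gl n)) (T : LieMod.{u} (gl m) ⥤ LieMod.{u} (gl m)) :
    Blocks.{u} n m i j ⥤ LieMod.{u} (gl (n + m)) :=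
  blocksIncl n m i j ⋙ S.prod T ⋙ C n m

/-- `R ∘ C` on `O_{i,n-i} × O_{j,m-j}`. -/
def afterC (R : LieMod.{u} (gl (n + m)) ⥤ LieMod.{u} (gl (n + m))) :
    Blocks.{u} n m i j ⥤ LieMod.{u} (gl (n + m)) :=
  blocksIncl n m i j ⋙ C n m ⋙ R

/-- The natural transformation `C ∘ (S × T) → C ∘ (S' × T')` induced by `S → S'` and `T → T'`. -/
def beforeCMap {S S' : LieMod.{u} (gl n) ⥤ LieMod.{u} (gl n)}
    {T T' : LieMod.{u} (gl m) ⥤ LieMod.{u} (gl m)} (σ : S ⟶ S') (τ : T ⟶ T') :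
    (beforeC S T : Blocks.{u} n m i j ⥤ _) ⟶ beforeC S' T' :=
  Functor.whiskerLeft (blocksIncl n m i j) (Functor.whiskerRight (NatTrans.prod σ τ) (C n m))

/-- The natural transformation `R ∘ C → R' ∘ C` induced by `R → R'`. -/
def afterCMap {R R' : LieMod.{u} (gl (n + m)) ⥤ LieMod.{u} (gl (n + m))} (σ : R ⟶ R') :
    (afterC R : Blocks.{u} n m i j ⥤ _) ⟶ afterC R' :=
  Functor.whiskerLeft (blocksIncl n m i j) (Functor.whiskerLeft (C n m) σ)

/-- A functor on `O_{i,n-i} × O_{j,m-j}` is exact if it is exact in each of the two variables. -/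
def IsExactBifunctor (G : Blocks.{u} n m i j ⥤ LieMod.{u} (gl (n + m))) : Prop :=
  (∀ (N : (block.{u} m j).FullSubcategory) (M₁ M₂ M₃ : (block.{u} n i).FullSubcategory)
    (f : M₁ ⟶ M₂) (g : M₂ ⟶ M₃), IsShortExact f.hom g.hom →
    IsShortExact (G.map (Prod.mkHom f (𝟙 N))) (G.map (Prod.mkHom g (𝟙 N)))) ∧
  (∀ (M : (block.{u} n i).FullSubcategory) (N₁ N₂ N₃ : (block.{u} m j).FullSubcategory)
    (f : N₁ ⟶ N₂) (g : N₂ ⟶ N₃), IsShortExact f.hom g.hom →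
    IsShortExact (G.map (Prod.mkHom (𝟙 M) f)) (G.map (Prod.mkHom (𝟙 M) g)))

/-- `B` has a filtration `B = G_{a+1} ⊇ G_a ⊇ ⋯ ⊇ G_0 = 0` by exact functors such that there are
short exact sequences `0 → G_k → G_{k+1} → Q_k → 0` of functors for `k = 0, …, a`. -/
def HasExactFiltration (a : ℕ) (B : Blocks.{u} n m i j ⥤ LieMod.{u} (gl (n + m)))
    (Q : Fin (a + 1) → (Blocks.{u} n m i j ⥤ LieMod.{u} (gl (n + m)))) : Prop :=
  ∃ G : Fin (a + 2) → (Blocks.{u} n m i j ⥤ LieMod.{u} (gl (n + m))),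
    (∀ k, IsExactBifunctor (G k)) ∧
    (∀ X, ∀ v : (G 0).obj X, v = 0) ∧
    Nonempty (G (Fin.last (a + 1)) ≅ B) ∧
    ∀ k : Fin (a + 1), ∃ (inc : G k.castSucc ⟶ G k.succ) (quo : G k.succ ⟶ Q k),
      IsShortExactFunctors inc quo

end Parabolic

end GLn

end

/-! Everything comes from one short exact sequence of modules over the parabolic subalgebra `p`,
namely 0 → L_n → L_{n+m} → L_m → 0, where the outer terms are pulled back from the diagonal blocks
(`std_exact`). The tensor identity V ⊗ Ind X ≅ Ind (V|_p ⊗ X) (`tensorInd`) turns tensoring C(M, N)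
with a gl_{n+m}-module V into inducing W ⊗ Y ⊗ M ⊗ N with W = V|_p. This construction, `twist`, is
exact in W, M and N, and a W pulled back from a diagonal block can be absorbed into M or N. So the
sequence above yields the one for L, its dual (with sub and quotient exchanged) yields the one for
L*, and the filtration of Λ^a of an extension with quotients Λ^{a-k} ⊗ Λ^k
(`exists_extPow_filtration`) yields the filtrations for the divided powers. Exactness of induction
rests on an explicit model: `p` has an abelian complement, and Ind X is realised on polynomials in
that complement, tensored with X, by differential operators of order at most two.

It remains to pass to blocks. A block component is a retract, and morphisms respect it automatically
(`IsComp.natural`), so the components of a short exact sequence form a short exact sequence which is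
a direct summand. The essential point is `IsComp.C`: C sends the components with indices c and c' to
the component with index c + c', and everything else to its complement. To see this, filter modules
of category O by highest weight modules (`InO.filt`). Because Y compensates the difference between
ρ_{n+m} and (ρ_n, ρ_m), layers with highest weights μ - ρ and ν - ρ combine to a layer with highest
weight (μ, ν) - ρ (`Filt.C`). Zero-one vectors with sums c and c' concatenate to one with sum c +
c'. Conversely, if the concatenation is a zero-one vector, so are both parts, and their sums are
known since all weights of the modules in question are integral of a fixed degree.

Two facts on central characters make this work. The character of the weight μ - ρ determines μ up to
permutation (`weight_eq_of_centralIdeal_le`), which is read off from the eigenvalues of the central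
elements tr E^p. And all permutations of a zero-one vector have the same character
(`IsZeroOne.centralIdeal_eq`), because for adjacent entries 1, 0 a simple root vector produces a
second nonzero singular vector in a suitable induced module. -/

noncomputable section

/-! ### Induction from a subalgebra with an abelian complement -/

namespace LieMod

variable {L : Type} [LieRing L] [LieAlgebra ℂ L]

/-- A basis `Y` of an abelian subalgebra of `L` complementary to `p`, such that two brackets
with it send `p` out of `p`. -/
structure AbelianComplement (p : LieSubalgebra ℂ L) (I : Type) [Fintype I] [DecidableEq I] where
  Y : I → L
  coord : L →ₗ[ℂ] (I → ℂ)
  par : L →ₗ[ℂ] p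
  comm : ∀ i j, ⁅Y i, Y j⁆ = 0
  decomp : ∀ x, x = ∑ i, coord x i • Y i + (par x : L)
  coord_Y : ∀ i, coord (Y i) = Pi.single i 1
  par_Y : ∀ i, par (Y i) = 0
  coord_par : ∀ x : p, coord x = 0
  par_par : ∀ x : p, par x = x
  step : ∀ (x : p) i j, par ⁅(par ⁅(x : L), Y i⁆ : L), Y j⁆ = 0

namespace AbelianComplement

variable {p : LieSubalgebra ℂ L} {I : Type} [Fintype I] [DecidableEq I]
  (c : AbelianComplement p I)

include c in
theorem lie_Y_eq (x : L) (k : I) : ⁅x, c.Y k⁆ = ⁅(c.par x : L), c.Y k⁆ := by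
  conv_lhs => rw [c.decomp x]
  simp [sum_lie, c.comm]

/-- The linear polynomial given by the component of `x` in the complement. -/
def lin : L →ₗ[ℂ] MvPolynomial I ℂ where
  toFun x := ∑ i, c.coord x i • MvPolynomial.X i
  map_add' x y := by simp [add_smul, Finset.sum_add_distrib]
  map_smul' t x := by simp [Finset.smul_sum, mul_smul]

theorem lin_Y (i : I) : c.lin (c.Y i) = MvPolynomial.X i := by
  simp [lin, c.coord_Y, Pi.single_apply]

theorem lin_par (x : p) : c.lin x = 0 := by
  simp [lin, c.coord_par]

/-- The component of the action which differentiates and multiplies polynomials. -/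
def diffOp (x : L) : Module.End ℂ (MvPolynomial I ℂ) :=
  LinearMap.mulLeft ℂ (c.lin x) +
  ∑ i, LinearMap.mulLeft ℂ (c.lin ⁅(c.par x : L), c.Y i⁆) ∘ₗ
    (MvPolynomial.pderiv i).toLinearMap +
  -- The coefficients are those of Taylor's formula x f(Y) = ∑_r (1/r!) ∑ (∂_{i₁}⋯∂_{i_r} f) [⋯[x,
  -- Y_{i₁}], ⋯, Y_{i_r}] for commuting Y. By `step` double brackets lie in the abelian complement,
  -- so there is no term of order three.
  (1 / 2 : ℂ) • ∑ i, ∑ j, LinearMap.mulLeft ℂ (c.lin ⁅(c.par ⁅(c.par x : L), c.Y i⁆ : L), c.Y j⁆) ∘ₗ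
    (MvPolynomial.pderiv i).toLinearMap ∘ₗ (MvPolynomial.pderiv j).toLinearMap

theorem diffOp_apply (x : L) (f : MvPolynomial I ℂ) : c.diffOp x f =
    c.lin x * f + ∑ i, c.lin ⁅(c.par x : L), c.Y i⁆ * MvPolynomial.pderiv i f +
    (1 / 2 : ℂ) • ∑ i, ∑ j, c.lin ⁅(c.par ⁅(c.par x : L), c.Y i⁆ : L), c.Y j⁆ *
      MvPolynomial.pderiv i (MvPolynomial.pderiv j f) := by
  simp [diffOp]

theorem diffOp_add (x y : L) : c.diffOp (x + y) = c.diffOp x + c.diffOp y := by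
  refine LinearMap.ext fun f => ?_
  simp only [diffOp_apply, LinearMap.add_apply, map_add, add_mul, AddMemClass.coe_add, add_lie,
    Finset.sum_add_distrib, smul_add]
  abel

theorem diffOp_smul (t : ℂ) (x : L) : c.diffOp (t • x) = t • c.diffOp x := by
  refine LinearMap.ext fun f => ?_
  simp only [diffOp_apply, LinearMap.smul_apply, map_smul, smul_mul_assoc, SetLike.val_smul,
    smul_lie, ← Finset.smul_sum, smul_add, smul_comm t (1 / 2 : ℂ)]

/-- By the Jacobi identity, bracketing with Y_k and with Y_j commute, since [Y_k, Y_j] = 0. -/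
theorem second_symm (x : L) (k j : I) :
    c.lin ⁅(c.par ⁅(c.par x : L), c.Y k⁆ : L), c.Y j⁆ =
      c.lin ⁅(c.par ⁅(c.par x : L), c.Y j⁆ : L), c.Y k⁆ := by
  rw [← lie_Y_eq, ← lie_Y_eq, ← lie_Y_eq, ← lie_Y_eq]
  have h := leibniz_lie x (c.Y k) (c.Y j)
  rw [c.comm, lie_zero, ← lie_skew (c.Y k), ← sub_eq_add_neg] at h
  rw [sub_eq_zero.1 h.symm]

/-- This is the relation x Y_k = Y_k x + [x, Y_k] on polynomials. The Leibniz rule extracts two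
first-order terms from the second-order part; they coincide by `second_symm`, which uses up the
factor 1/2. -/
theorem diffOp_X_mul (x : L) (k : I) (f : MvPolynomial I ℂ) :
    c.diffOp x (MvPolynomial.X k * f) =
      MvPolynomial.X k * c.diffOp x f + c.diffOp ⁅x, c.Y k⁆ f := by
  have hs : ∀ j, c.par ⁅(c.par ⁅(c.par x : L), c.Y k⁆ : L), c.Y j⁆ = 0 := fun j => c.step _ k j
  have e1 : ∀ i (g : MvPolynomial I ℂ), MvPolynomial.pderiv i (MvPolynomial.X k * g) =
      MvPolynomial.X k * MvPolynomial.pderiv i g + (if i = k then g else 0) := by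
    intro i g
    rw [Derivation.leibniz, MvPolynomial.pderiv_X]
    by_cases h : i = k
    · subst h; simp
    · simp [h, Ne.symm h]
  have e2 : ∀ i j (g : MvPolynomial I ℂ), MvPolynomial.pderiv i (if j = k then g else 0) =
      if j = k then MvPolynomial.pderiv i g else 0 := fun i j g => by
    split_ifs <;> simp
  rw [c.lie_Y_eq x k]
  simp only [diffOp_apply, e1, e2, map_add, hs, ZeroMemClass.coe_zero, zero_lie, map_zero, zero_mul,
    Finset.sum_const_zero, smul_zero, add_zero, mul_add, Finset.sum_add_distrib, mul_ite, mul_zero,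
    Finset.sum_ite_eq', Finset.mem_univ, if_true, smul_add]
  simp only [Finset.sum_ite_eq', Finset.mem_univ, if_true, fun i => c.second_symm x i k,
    Finset.mul_sum, mul_smul_comm, mul_left_comm (MvPolynomial.X k), Finset.sum_const_zero,
    Finset.sum_ite_irrel]
  module

theorem mem_of_span (S : Submodule ℂ L) (hY : ∀ i, c.Y i ∈ S) (hp : ∀ x : p, (x : L) ∈ S) (x : L) :
    x ∈ S := by
  rw [c.decomp x]
  exact add_mem (sum_mem fun i _ => S.smul_mem _ (hY i)) (hp _)

/-! ### The polynomial model of an induced module -/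

section Model

variable (X : LieMod.{u} p)

/-- Multiplication by a variable. -/
def mulX (k : I) : Module.End ℂ (MvPolynomial I ℂ ⊗[ℂ] X) :=
  (LinearMap.mulLeft ℂ (MvPolynomial.X k)).rTensor X

omit [Fintype I] [DecidableEq I] in
theorem mulX_tmul (k : I) (f : MvPolynomial I ℂ) (ξ : X) :
    mulX X k (f ⊗ₜ ξ) = (MvPolynomial.X k * f) ⊗ₜ ξ := rfl

/-- The action of `L` on `MvPolynomial I ℂ ⊗ X`. -/
def op : L →ₗ[ℂ] Module.End ℂ (MvPolynomial I ℂ ⊗[ℂ] X) where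
  toFun x := (c.diffOp x).rTensor X + (LieModule.toEnd ℂ p X (c.par x)).lTensor _ +
    ∑ i, TensorProduct.map (MvPolynomial.pderiv i).toLinearMap
      (LieModule.toEnd ℂ p X (c.par ⁅(c.par x : L), c.Y i⁆))
  map_add' x y := by
    simp only [c.diffOp_add, map_add, LinearMap.rTensor_add, LinearMap.lTensor_add,
      AddMemClass.coe_add, add_lie, TensorProduct.map_add_right, Finset.sum_add_distrib]
    abel
  map_smul' t x := by
    simp only [c.diffOp_smul, map_smul, LinearMap.rTensor_smul, LinearMap.lTensor_smul,
      SetLike.val_smul, smul_lie, TensorProduct.map_smul_right, ← Finset.smul_sum, smul_add,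
      RingHom.id_apply]

theorem op_tmul (x : L) (f : MvPolynomial I ℂ) (ξ : X) : c.op X x (f ⊗ₜ ξ) =
    c.diffOp x f ⊗ₜ ξ + f ⊗ₜ ⁅c.par x, ξ⁆ +
      ∑ i, MvPolynomial.pderiv i f ⊗ₜ[ℂ] ⁅c.par ⁅(c.par x : L), c.Y i⁆, ξ⁆ := by
  simp [op]

/-- The induction principle of the model: identities are verified on 1 ⊗ ξ and propagated along
multiplication by the variables. -/
theorem poly_top {I : Type} {X : Type u} [AddCommGroup X] [Module ℂ X]
    (S : Submodule ℂ (MvPolynomial I ℂ ⊗[ℂ] X)) (h1 : ∀ ξ, (1 : MvPolynomial I ℂ) ⊗ₜ ξ ∈ S)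
    (hX : ∀ k (t : MvPolynomial I ℂ ⊗[ℂ] X), t ∈ S →
      (LinearMap.mulLeft ℂ (MvPolynomial.X k)).rTensor X t ∈ S) (t : MvPolynomial I ℂ ⊗[ℂ] X) :
    t ∈ S := by
  induction t using TensorProduct.induction_on with
  | zero => exact zero_mem _
  | add a b ha hb => exact add_mem ha hb
  | tmul f ξ =>
    induction f using MvPolynomial.induction_on with
    | C a =>
      rw [MvPolynomial.C_eq_smul_one, ← TensorProduct.smul_tmul']
      exact S.smul_mem _ (h1 ξ)
    | add f g hf hg => rw [TensorProduct.add_tmul]; exact add_mem hf hg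
    | mul_X f k hf => rw [mul_comm]; exact hX k _ hf

/-- The commutation relation with Y_k for the full action. Together with `op_Y` and `op_par` it
determines all operators `op`, so the explicit formulas are not needed afterwards. -/
theorem op_mulX (x : L) (k : I) (t : MvPolynomial I ℂ ⊗[ℂ] X) :
    c.op X x (mulX X k t) = mulX X k (c.op X x t) + c.op X ⁅x, c.Y k⁆ t := by
  induction t using TensorProduct.induction_on with
  | zero => simp
  | add a b ha hb => rw [map_add, map_add, ha, hb, map_add, map_add, map_add]; abel
  | tmul f ξ =>
    have hs : ∀ j, c.par ⁅(c.par ⁅(c.par x : L), c.Y k⁆ : L), c.Y j⁆ = 0 := fun j => c.step _ k j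
    have e1 : ∀ i, MvPolynomial.pderiv i (MvPolynomial.X k * f) =
        MvPolynomial.X k * MvPolynomial.pderiv i f + (if i = k then f else 0) := by
      intro i
      rw [Derivation.leibniz, MvPolynomial.pderiv_X]
      by_cases h : i = k
      · subst h; simp
      · simp [h, Ne.symm h]
    simp only [mulX_tmul, op_tmul, c.diffOp_X_mul, e1, TensorProduct.add_tmul, map_add, map_sum,
      Finset.sum_add_distrib]
    have e2 : ∀ i (η : X), (if i = k then f else 0) ⊗ₜ[ℂ] η = if i = k then f ⊗ₜ η else 0 :=
      fun i η => by split_ifs <;> simp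
    rw [c.lie_Y_eq x k]
    simp only [e2, hs, Finset.sum_ite_eq', Finset.mem_univ, if_true, zero_lie,
      TensorProduct.tmul_zero, Finset.sum_const_zero, add_zero]
    abel

theorem op_Y (k : I) : c.op X (c.Y k) = mulX X k := by
  refine LinearMap.ext fun t => ?_
  induction t using TensorProduct.induction_on with
  | zero => simp
  | add a b ha hb => rw [map_add, map_add, ha, hb]
  | tmul f ξ => simp [op_tmul, diffOp_apply, c.par_Y, c.lin_Y, mulX_tmul]

theorem op_par (x : p) (ξ : X) :
    c.op X x ((1 : MvPolynomial I ℂ) ⊗ₜ ξ) = (1 : MvPolynomial I ℂ) ⊗ₜ ⁅x, ξ⁆ := by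
  simp [op_tmul, diffOp_apply, c.par_par, c.lin_par]

/-- No differential operators are multiplied out. The vectors on which the relation holds for all x,
y contain 1 ⊗ X, where `p` acts as on X, and are stable under the variables by `op_mulX` and the
Jacobi identity. -/
theorem op_lie (x y : L) (t : MvPolynomial I ℂ ⊗[ℂ] X) :
    c.op X ⁅x, y⁆ t = c.op X x (c.op X y t) - c.op X y (c.op X x t) := by
  have hY : ∀ x k t, c.op X ⁅x, c.Y k⁆ t = c.op X x (c.op X (c.Y k) t) -
      c.op X (c.Y k) (c.op X x t) := fun x k t => by rw [op_Y, op_mulX]; abel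

  -- For fixed t the relation is bilinear and antisymmetric in x, y, and it always holds when y is
  -- some Y_k; hence pairs from `p` suffice.
  have red : ∀ t, (∀ x y : p, c.op X ⁅(x : L), (y : L)⁆ t = c.op X x (c.op X y t) -
      c.op X y (c.op X x t)) → ∀ x y : L, c.op X ⁅x, y⁆ t = c.op X x (c.op X y t) -
      c.op X y (c.op X x t) := by
    intro t ht x y
    have key : ∀ x y : L, y ∈ LinearMap.ker (((c.op X).flip t) ∘ₗ (LieModule.toEnd ℂ L L x : L →ₗ[ℂ] L) -
        (c.op X x) ∘ₗ (c.op X).flip t + (c.op X).flip (c.op X x t)) ↔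
        c.op X ⁅x, y⁆ t = c.op X x (c.op X y t) - c.op X y (c.op X x t) := by
      intro x y
      simp only [LinearMap.mem_ker, LinearMap.add_apply, LinearMap.sub_apply, LinearMap.comp_apply,
        LinearMap.flip_apply, LieModule.toEnd_apply_apply]
      rw [← sub_eq_zero (a := c.op X ⁅x, y⁆ t), sub_sub_eq_add_sub, ← sub_add_eq_add_sub]
    have h1 : ∀ x : p, ∀ y : L, c.op X ⁅(x : L), y⁆ t = c.op X x (c.op X y t) -
        c.op X y (c.op X x t) := fun x y => (key x y).1 <|
      c.mem_of_span _ (fun i => (key x _).2 (hY _ _ _)) (fun y => (key x _).2 (ht x y)) y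
    have h2 : ∀ x y : L, c.op X ⁅x, y⁆ t = c.op X x (c.op X y t) -
        c.op X y (c.op X x t) := fun x y => (key x y).1 <|
      c.mem_of_span _ (fun i => (key x _).2 (hY _ _ _)) (fun y => (key x _).2 (by
        rw [← lie_skew, map_neg, LinearMap.neg_apply, h1]; abel)) y
    exact h2 x y
  let S : Submodule ℂ (MvPolynomial I ℂ ⊗[ℂ] X) :=
    { carrier := {t | ∀ x y : L, c.op X ⁅x, y⁆ t = c.op X x (c.op X y t) - c.op X y (c.op X x t)}
      add_mem' := fun ha hb x y => by simp only [map_add, ha x y, hb x y]; abel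
      zero_mem' := fun x y => by simp
      smul_mem' := fun r t ht x y => by simp only [map_smul, ht x y, smul_sub] }
  refine poly_top S (fun ξ => red _ fun x y => ?_) (fun k t ht x y => ?_) t x y
  · rw [← LieSubalgebra.coe_bracket, op_par, op_par, op_par, op_par, op_par, lie_lie,
      TensorProduct.tmul_sub]
  · change c.op X ⁅x, y⁆ (mulX X k t) = c.op X x (c.op X y (mulX X k t)) -
      c.op X y (c.op X x (mulX X k t))
    -- The relation at t is used for the pairs x, [y, Y_k] and y, [x, Y_k]; this is why the
    -- induction runs over all x, y at once.
    have h : c.op X ⁅⁅x, y⁆, c.Y k⁆ t = (c.op X x (c.op X ⁅y, c.Y k⁆ t) -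
        c.op X ⁅y, c.Y k⁆ (c.op X x t)) - (c.op X y (c.op X ⁅x, c.Y k⁆ t) -
        c.op X ⁅x, c.Y k⁆ (c.op X y t)) := by
      rw [lie_lie x y (c.Y k), map_sub, LinearMap.sub_apply, ht x ⁅y, c.Y k⁆, ht y ⁅x, c.Y k⁆]
    rw [op_mulX, op_mulX, op_mulX, map_add, map_add, op_mulX, op_mulX, h, ht x y, map_sub]
    generalize c.op X x (c.op X ⁅y, c.Y k⁆ t) = a1, c.op X ⁅y, c.Y k⁆ (c.op X x t) = a2,
      c.op X y (c.op X ⁅x, c.Y k⁆ t) = a3, c.op X ⁅x, c.Y k⁆ (c.op X y t) = a4,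
      mulX X k (c.op X x (c.op X y t)) = a5, mulX X k (c.op X y (c.op X x t)) = a6
    abel

/-- `MvPolynomial I ℂ ⊗ X` as a module over `L`. -/
def model : LieMod.{u} L :=
  letI : LieRingModule L (MvPolynomial I ℂ ⊗[ℂ] X) :=
    { bracket x t := c.op X x t
      add_lie x y t := by simp
      lie_add x s t := map_add _ s t
      leibniz_lie x y t := by
        change c.op X x (c.op X y t) = c.op X ⁅x, y⁆ t + c.op X y (c.op X x t)
        rw [op_lie]; abel }
  haveI : LieModule ℂ L (MvPolynomial I ℂ ⊗[ℂ] X) :=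
    { smul_lie r x t := by
        change c.op X (r • x) t = r • c.op X x t
        simp
      lie_smul r x t := map_smul _ r t }
  ⟨MvPolynomial I ℂ ⊗[ℂ] X⟩

end Model

end AbelianComplement

/-! ### Frobenius reciprocity -/

section Frobenius

variable {p : LieSubalgebra ℂ L} {N : LieMod.{u} p} {M : LieMod.{u} L}

/-- A `p`-equivariant map is a morphism to the restriction of M, hence commutes with U(p). On that
restriction U(p) acts through `envIncl`, as both actions extend the same Lie homomorphism. -/
theorem map_act_of_equivariant (φ : N →ₗ[ℂ] M) (h : ∀ (x : p) n, φ ⁅x, n⁆ = ⁅(x : L), φ n⁆)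
    (w : UniversalEnvelopingAlgebra ℂ p) (n : N) : φ (act N w n) = act M (envIncl p w) (φ n) := by
  have e : act ((res p.incl).obj M) = (act M).comp (envIncl p) := by
    apply UniversalEnvelopingAlgebra.hom_ext
    refine LieHom.ext fun x => LinearMap.ext fun m => ?_
    change act ((res p.incl).obj M) (UniversalEnvelopingAlgebra.ι ℂ x) m =
      act M (envIncl p (UniversalEnvelopingAlgebra.ι ℂ x)) m
    rw [act_ι, envIncl, UniversalEnvelopingAlgebra.lift_ι_apply, LieHom.comp_apply]
    exact (act_ι M (x : L) m).symm
  let f : N ⟶ (res p.incl).obj M := ⟨{ φ with map_lie' := fun {x n} => h x n }⟩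
  have := toLin_act f w n
  rw [e] at this
  exact this

/-- The bilinear map `(a, n) ↦ a φ(n)`. -/
def indLiftAux (φ : N →ₗ[ℂ] M) : UniversalEnvelopingAlgebra ℂ L ⊗[ℂ] N →ₗ[ℂ] M :=
  TensorProduct.lift ((LinearMap.lcomp ℂ M φ) ∘ₗ (act M).toLinearMap)

theorem indLiftAux_tmul (φ : N →ₗ[ℂ] M) (a : UniversalEnvelopingAlgebra ℂ L) (n : N) :
    indLiftAux φ (a ⊗ₜ n) = act M a (φ n) := rfl

theorem indLiftAux_smul (φ : N →ₗ[ℂ] M) (a : UniversalEnvelopingAlgebra ℂ L)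
    (t : UniversalEnvelopingAlgebra ℂ L ⊗[ℂ] N) :
    indLiftAux φ (a • t) = act M a (indLiftAux φ t) := by
  induction t using TensorProduct.induction_on with
  | zero => simp
  | add x y hx hy => rw [smul_add, map_add, map_add, map_add, hx, hy]
  | tmul b n =>
    rw [TensorProduct.smul_tmul', indLiftAux_tmul, indLiftAux_tmul, smul_eq_mul, map_mul,
      Module.End.mul_apply]

theorem indLiftAux_eq_zero (φ : N →ₗ[ℂ] M) (h : ∀ (x : p) n, φ ⁅x, n⁆ = ⁅(x : L), φ n⁆)
    {t : UniversalEnvelopingAlgebra ℂ L ⊗[ℂ] N} (ht : t ∈ indRel p N) : indLiftAux φ t = 0 := by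
  induction ht using Submodule.span_induction with
  | mem t ht =>
    obtain ⟨a, w, n, rfl⟩ := ht
    rw [map_sub, indLiftAux_tmul, indLiftAux_tmul, map_mul, Module.End.mul_apply,
      map_act_of_equivariant φ h, sub_self]
  | zero => exact map_zero _
  | add x y _ _ hx hy => rw [map_add, hx, hy, add_zero]
  | smul a x _ hx => rw [indLiftAux_smul, hx, map_zero]

/-- Frobenius reciprocity: the extension of a `p`-equivariant map to the induced module. -/
def indLift (φ : N →ₗ[ℂ] M) (h : ∀ (x : p) n, φ ⁅x, n⁆ = ⁅(x : L), φ n⁆) : indObj p N ⟶ M :=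
  let F : IndCarrier p N →+ M := QuotientAddGroup.lift (indRel p N).toAddSubgroup
    (indLiftAux φ).toAddMonoidHom (fun _ ht => indLiftAux_eq_zero φ h ht)
  ⟨{ toFun := F
     map_add' := F.map_add
     map_smul' := fun r q => by
       obtain ⟨t, rfl⟩ := Submodule.Quotient.mk_surjective (indRel p N) q
       exact (indLiftAux φ).map_smul r t
     map_lie' := fun {x q} => by
       obtain ⟨t, rfl⟩ := Submodule.Quotient.mk_surjective (indRel p N) q
       exact (indLiftAux_smul φ (UniversalEnvelopingAlgebra.ι ℂ x) t).trans (act_ι M x _) }⟩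

theorem indLift_mk (φ : N →ₗ[ℂ] M) (h : ∀ (x : p) n, φ ⁅x, n⁆ = ⁅(x : L), φ n⁆)
    (a : UniversalEnvelopingAlgebra ℂ L) (n : N) :
    toLin (indLift φ h) (indMk p N a n) = act M a (φ n) := rfl

theorem indLift_one (φ : N →ₗ[ℂ] M) (h : ∀ (x : p) n, φ ⁅x, n⁆ = ⁅(x : L), φ n⁆) (n : N) :
    toLin (indLift φ h) (indMk p N 1 n) = φ n := by
  rw [indLift_mk, map_one, Module.End.one_apply]

theorem act_indMk (a b : UniversalEnvelopingAlgebra ℂ L) (n : N) :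
    act (indObj p N) a (indMk p N b n) = indMk p N (a * b) n := by
  have : ∀ q : IndCarrier p N, act (indObj p N) a q = a • q := by
    obtain ⟨t, rfl⟩ : ∃ t, UniversalEnvelopingAlgebra.mkAlgHom ℂ L t = a :=
      RingCon.mk'_surjective (c := UniversalEnvelopingAlgebra.ringCon ℂ L) a
    induction t using TensorAlgebra.induction with
    | algebraMap r =>
      intro q
      rw [AlgHom.commutes, AlgHom.commutes, algebraMap_smul]
      rfl
    | ι x =>
      intro q
      have := act_ι (indObj p N) x q
      rw [UniversalEnvelopingAlgebra.ι_apply] at this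
      rw [this]; rfl
    | mul a b ha hb =>
      intro q
      rw [map_mul, map_mul, mul_smul, ← hb]
      exact ha _
    | add a b ha hb =>
      intro q
      rw [map_add, map_add, add_smul, ← hb, ← ha]
      rfl
  exact this _

theorem indMk_eq (a : UniversalEnvelopingAlgebra ℂ L) (n : N) :
    indMk p N a n = act (indObj p N) a (indMk p N 1 n) := by
  rw [act_indMk, mul_one]

theorem ind_hom_ext {f g : indObj p N ⟶ M}
    (h : ∀ n, toLin f (indMk p N 1 n) = toLin g (indMk p N 1 n)) : f = g :=
  ind_ext fun a n => by rw [indMk_eq, toLin_act, toLin_act, h]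

theorem indMk_add (a : UniversalEnvelopingAlgebra ℂ L) (n n' : N) :
    indMk p N a (n + n') = indMk p N a n + indMk p N a n' := by
  change Submodule.Quotient.mk _ = _
  rw [TensorProduct.tmul_add]
  rfl

theorem indMk_smul (a : UniversalEnvelopingAlgebra ℂ L) (r : ℂ) (n : N) :
    indMk p N a (r • n) = r • indMk p N a n := by
  change Submodule.Quotient.mk _ = _
  rw [TensorProduct.tmul_smul]
  rfl

/-- `n ↦ 1 ⊗ n`. -/
def indIn (N : LieMod.{u} p) : N →ₗ[ℂ] indObj p N where
  toFun n := indMk p N 1 n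
  map_add' := indMk_add 1
  map_smul' r n := indMk_smul 1 r n

theorem lie_indMk (x : p) (n : N) : ⁅(x : L), indMk p N 1 n⁆ = indMk p N 1 ⁅x, n⁆ := by
  rw [← act_ι (indObj p N), act_indMk, mul_one]
  have h : envIncl p (UniversalEnvelopingAlgebra.ι ℂ x) = UniversalEnvelopingAlgebra.ι ℂ (x : L) := by
    rw [envIncl, UniversalEnvelopingAlgebra.lift_ι_apply]; rfl
  refine (Submodule.Quotient.eq _).2 (Submodule.subset_span
    ⟨1, UniversalEnvelopingAlgebra.ι ℂ x, n, ?_⟩)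
  rw [h, one_mul, act_ι]

/-- A submodule of an induced module which contains the generators is everything. -/
theorem ind_top (S : LieSubmodule ℂ L (indObj p N)) (h : ∀ n, indMk p N 1 n ∈ S)
    (x : indObj p N) : x ∈ S := by
  have hact : ∀ (a : UniversalEnvelopingAlgebra ℂ L) (s : indObj p N), s ∈ S →
      act (indObj p N) a s ∈ S := by
    intro a s hs
    exact (toLin_act (M := ⟨S⟩) (N := indObj p N) ⟨S.incl⟩ a ⟨s, hs⟩) ▸
      (act (⟨S⟩ : LieMod.{u} L) a ⟨s, hs⟩).2
  obtain ⟨t, rfl⟩ := Submodule.Quotient.mk_surjective (indRel p N) x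
  induction t using TensorProduct.induction_on with
  | zero => exact zero_mem S
  | tmul a n =>
    have := hact a _ (h n)
    rwa [act_indMk, mul_one] at this
  | add a b ha hb => exact add_mem (S := LieSubmodule ℂ L (indObj p N)) ha hb

end Frobenius

/-- Exactness only concerns underlying maps, so bijections compatible with zero in the last term
suffice. This carries exactness from tensor products with the polynomial ring over to induced
modules. -/
theorem IsShortExact.of_equiv {M₁ M₂ M₃ : LieMod.{u} L} {f : M₁ ⟶ M₂} {g : M₂ ⟶ M₃}
    {N₁ N₂ N₃ : Type*} [Zero N₃] {f' : N₁ → N₂} {g' : N₂ → N₃}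
    (e₁ : N₁ ≃ M₁) (e₂ : N₂ ≃ M₂) (e₃ : N₃ ≃ M₃) (e₃0 : e₃ 0 = 0)
    (hf : ∀ x, toLin f (e₁ x) = e₂ (f' x)) (hg : ∀ x, toLin g (e₂ x) = e₃ (g' x))
    (h1 : Function.Injective f') (h2 : Function.Exact f' g') (h3 : Function.Surjective g') :
    IsShortExact f g := by
  refine ⟨fun a b hab => ?_, fun b => ?_, fun d => ?_⟩
  · obtain ⟨a, rfl⟩ := e₁.surjective a
    obtain ⟨b, rfl⟩ := e₁.surjective b
    rw [hf, hf] at hab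
    rw [h1 (e₂.injective hab)]
  · obtain ⟨b, rfl⟩ := e₂.surjective b
    rw [hg, ← e₃0, e₃.injective.eq_iff, h2]
    constructor
    · rintro ⟨a, rfl⟩
      exact ⟨e₁ a, hf a⟩
    · rintro ⟨a, ha⟩
      obtain ⟨a, rfl⟩ := e₁.surjective a
      exact ⟨a, e₂.injective ((hf a).symm.trans ha)⟩
  · obtain ⟨d, rfl⟩ := e₃.surjective d
    obtain ⟨b, rfl⟩ := h3 d
    exact ⟨e₂ b, hg b⟩

/-! ### Identification of the induced module with the model -/

namespace AbelianComplement

variable {p : LieSubalgebra ℂ L} {I : Type} [Fintype I] [DecidableEq I]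
  (c : AbelianComplement p I)

/-- Evaluation of polynomials requires a commutative target; the subalgebra of U(L) generated by the
Y_i is one because their brackets vanish. -/
instance adjoin_Y_comm : IsMulCommutative
    (Algebra.adjoin ℂ (Set.range fun i => UniversalEnvelopingAlgebra.ι ℂ (c.Y i))) :=
  Algebra.isMulCommutative_adjoin ℂ (by
    rintro _ ⟨i, rfl⟩ _ ⟨j, rfl⟩
    rw [← sub_eq_zero, ← LieRing.of_associative_ring_bracket, ← LieHom.map_lie, c.comm, map_zero])

open scoped IsMulCommutative in
/-- The embedding of the commutative algebra generated by the complement into `U(L)`. -/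
def polyHom : MvPolynomial I ℂ →ₐ[ℂ] UniversalEnvelopingAlgebra ℂ L :=
  (Subalgebra.val _).comp (MvPolynomial.aeval fun i =>
    (⟨UniversalEnvelopingAlgebra.ι ℂ (c.Y i), Algebra.subset_adjoin ⟨i, rfl⟩⟩ :
      Algebra.adjoin ℂ (Set.range fun i => UniversalEnvelopingAlgebra.ι ℂ (c.Y i))))

open scoped IsMulCommutative in
theorem polyHom_X (i : I) : c.polyHom (MvPolynomial.X i) = UniversalEnvelopingAlgebra.ι ℂ (c.Y i) := by
  rw [polyHom, AlgHom.comp_apply, MvPolynomial.aeval_X]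
  rfl

variable (X : LieMod.{u} p)

/-- The linear map `f ⊗ ξ ↦ f · (1 ⊗ ξ)` from the model to the induced module. -/
def toIndAux : MvPolynomial I ℂ ⊗[ℂ] X →ₗ[ℂ] indObj p X :=
  TensorProduct.lift ((LinearMap.lcomp ℂ _ (indIn X)) ∘ₗ (act (indObj p X)).toLinearMap ∘ₗ
    c.polyHom.toLinearMap)

theorem toIndAux_tmul (f : MvPolynomial I ℂ) (ξ : X) :
    c.toIndAux X (f ⊗ₜ ξ) = act (indObj p X) (c.polyHom f) (indMk p X 1 ξ) := rfl

theorem toIndAux_mulX (k : I) (t : MvPolynomial I ℂ ⊗[ℂ] X) :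
    c.toIndAux X (mulX X k t) = ⁅c.Y k, c.toIndAux X t⁆ := by
  induction t using TensorProduct.induction_on with
  | zero => simp
  | add a b ha hb => rw [map_add, map_add, map_add, ha, hb, lie_add]
  | tmul f ξ =>
    rw [mulX_tmul, toIndAux_tmul, toIndAux_tmul, map_mul, map_mul, polyHom_X, Module.End.mul_apply,
      act_ι]

/-- On 1 ⊗ ξ equivariance is checked separately for the Y_i and for `p`, which together span L. It
passes from t to X_k t because both sides satisfy the same commutation relation with Y_k. -/
theorem toIndAux_op (x : L) (t : MvPolynomial I ℂ ⊗[ℂ] X) :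
    c.toIndAux X (c.op X x t) = ⁅x, c.toIndAux X t⁆ := by
  let T (t : MvPolynomial I ℂ ⊗[ℂ] X) : Submodule ℂ L :=
    { carrier := {x | c.toIndAux X (c.op X x t) = ⁅x, c.toIndAux X t⁆}
      add_mem' := fun {a b} (ha : _ = _) (hb : _ = _) => by
        change _ = _
        rw [map_add, LinearMap.add_apply, map_add, ha, hb, add_lie]
      zero_mem' := by change _ = _; simp
      smul_mem' := fun r a (ha : _ = _) => by
        change _ = _
        rw [map_smul, LinearMap.smul_apply, map_smul, ha, smul_lie] }
  let S : Submodule ℂ (MvPolynomial I ℂ ⊗[ℂ] X) :=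
    { carrier := {t | ∀ x, c.toIndAux X (c.op X x t) = ⁅x, c.toIndAux X t⁆}
      add_mem' := fun ha hb x => by simp only [map_add, ha x, hb x, lie_add]
      zero_mem' := fun x => by simp
      smul_mem' := fun r t ht x => by simp only [map_smul, ht x, lie_smul] }
  refine poly_top S (fun ξ x => ?_) (fun k t ht x => ?_) t x
  · refine c.mem_of_span (T _) (fun i => ?_) (fun x => ?_) x
    · change c.toIndAux X _ = _
      rw [op_Y, toIndAux_mulX]
    · change c.toIndAux X _ = _
      rw [op_par, toIndAux_tmul, toIndAux_tmul, map_one, map_one, Module.End.one_apply,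
        Module.End.one_apply, lie_indMk]
  · change c.toIndAux X (c.op X x (mulX X k t)) = ⁅x, c.toIndAux X (mulX X k t)⁆
    rw [op_mulX, map_add, toIndAux_mulX, toIndAux_mulX, ht, ht, lie_lie]
    abel

/-- The map from the induced module to the model. -/
def ofInd : indObj p X ⟶ c.model X :=
  indLift (M := c.model X) (TensorProduct.mk ℂ (MvPolynomial I ℂ) X 1) fun x ξ =>
    (c.op_par X x ξ).symm

/-- This is the part of the Poincaré–Birkhoff–Witt theorem that is needed: monomials in the Y_i
applied to the vectors 1 ⊗ ξ satisfy no unexpected relations, since the model separates them. -/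
theorem ofInd_toIndAux (t : MvPolynomial I ℂ ⊗[ℂ] X) : toLin (c.ofInd X) (c.toIndAux X t) = t := by
  let S : Submodule ℂ (MvPolynomial I ℂ ⊗[ℂ] X) :=
    { carrier := {t | toLin (c.ofInd X) (c.toIndAux X t) = t}
      add_mem' := fun {a b} (ha : _ = _) (hb : _ = _) => by
        change toLin (c.ofInd X) (c.toIndAux X (a + b)) = a + b
        rw [map_add, map_add, ha, hb]; rfl
      zero_mem' := by change toLin (c.ofInd X) (c.toIndAux X 0) = 0; rw [map_zero, map_zero]
      smul_mem' := fun r a (ha : _ = _) => by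
        change toLin (c.ofInd X) (c.toIndAux X (r • a)) = r • a
        rw [map_smul, map_smul, ha]; rfl }
  refine poly_top S (fun ξ => ?_) (fun k t ht => ?_) t
  · have h1 : c.toIndAux X ((1 : MvPolynomial I ℂ) ⊗ₜ ξ) = indMk p X 1 ξ := by
      rw [toIndAux_tmul, map_one, map_one, Module.End.one_apply]
    exact (congrArg (toLin (c.ofInd X)) h1).trans (indLift_one _ _ _)
  · have h1 : ⁅c.Y k, toLin (c.ofInd X) (c.toIndAux X t)⁆ = c.op X (c.Y k) t :=
      congrArg (fun s : c.model X => ⁅c.Y k, s⁆) ht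
    rw [op_Y] at h1
    exact (congrArg (toLin (c.ofInd X)) (c.toIndAux_mulX X k t)).trans
      (((toLin (c.ofInd X)).map_lie _ _).trans h1)

/-- The composite is an endomorphism of the induced module that fixes its generators 1 ⊗ ξ. -/
theorem toIndAux_ofInd (q : indObj p X) : c.toIndAux X (toLin (c.ofInd X) q) = q := by
  let Φ : c.model X ⟶ indObj p X :=
    ⟨{ c.toIndAux X with map_lie' := fun {x t} => c.toIndAux_op X x t }⟩
  have : c.ofInd X ≫ Φ = 𝟙 _ := ind_hom_ext fun ξ => by
    have h := indLift_one (M := c.model X) (TensorProduct.mk ℂ (MvPolynomial I ℂ) X 1)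
      (fun x ξ => (c.op_par X x ξ).symm) ξ
    change c.toIndAux X (toLin (c.ofInd X) (indMk p X 1 ξ)) = indMk p X 1 ξ
    rw [ofInd, h]
    change c.toIndAux X (1 ⊗ₜ ξ) = _
    rw [toIndAux_tmul, map_one, map_one, Module.End.one_apply]
  exact congrArg (fun f => toLin f q) this

/-- The underlying space of the induced module. -/
def indEquiv : (MvPolynomial I ℂ ⊗[ℂ] X) ≃ₗ[ℂ] indObj p X :=
  { c.toIndAux X with
    invFun := toLin (c.ofInd X)
    left_inv := c.ofInd_toIndAux X
    right_inv := c.toIndAux_ofInd X }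

theorem ind_map_toIndAux {X X' : LieMod.{u} p} (f : X ⟶ X') (t : MvPolynomial I ℂ ⊗[ℂ] X) :
    toLin ((ind p).map f) (c.toIndAux X t) =
      c.toIndAux X' ((toLin f : X →ₗ[ℂ] X').lTensor (MvPolynomial I ℂ) t) := by
  induction t using TensorProduct.induction_on with
  | zero =>
    rw [map_zero, map_zero]
    exact (map_zero (toLin ((ind p).map f))).trans (map_zero _).symm
  | add a b ha hb =>
    rw [map_add, map_add, map_add, ← ha, ← hb]
    exact map_add (toLin ((ind p).map f)) _ _
  | tmul g ξ => exact toLin_act ((ind p).map f) (c.polyHom g) (indMk p X 1 ξ)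

include c in
/-- Induction is exact. -/
theorem ind_exact {A B D : LieMod.{u} p} {f : A ⟶ B} {g : B ⟶ D} (h : IsShortExact f g) :
    IsShortExact ((ind p).map f) ((ind p).map g) := by
  obtain ⟨h1, h2, h3⟩ := h
  exact IsShortExact.of_equiv (c.indEquiv A).toEquiv (c.indEquiv B).toEquiv (c.indEquiv D).toEquiv
    (map_zero (c.indEquiv D)) (c.ind_map_toIndAux f) (c.ind_map_toIndAux g)
    (Module.Flat.lTensor_preserves_injective_linearMap (M := MvPolynomial I ℂ)
      (toLin f : A →ₗ[ℂ] B) h1)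
    (lTensor_exact (MvPolynomial I ℂ) (f := (toLin f : A →ₗ[ℂ] B))
      (g := (toLin g : B →ₗ[ℂ] D)) h2 h3)
    (LinearMap.lTensor_surjective (MvPolynomial I ℂ) (g := (toLin g : B →ₗ[ℂ] D)) h3)

end AbelianComplement

end LieMod
end

noncomputable section

/-! ### The tensor identity -/

namespace LieMod

variable {L : Type} [LieRing L] [LieAlgebra ℂ L] {p : LieSubalgebra ℂ L}

theorem lie_tmul {V : LieMod.{0} L} {M : LieMod.{u} L} (x : L) (v : V) (m : M) :
    ⁅x, (v ⊗ₜ m : (tensorLeft V).obj M)⁆ = ((⁅x, v⁆ ⊗ₜ m + v ⊗ₜ ⁅x, m⁆ : V ⊗[ℂ] M) : (tensorLeft V).obj M) :=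
  TensorProduct.LieModule.lie_tmul_right x v m

/-- With A and B the actions of one Lie algebra element, this reduces equivariance of a map on a
tensor product to pure tensors. -/
theorem map_of_tmul {V M P : Type*} [AddCommGroup V] [Module ℂ V] [AddCommGroup M] [Module ℂ M]
    [AddCommGroup P] [Module ℂ P] (A : V ⊗[ℂ] M →ₗ[ℂ] V ⊗[ℂ] M) (B : P →ₗ[ℂ] P)
    (F : V ⊗[ℂ] M →ₗ[ℂ] P) (h : ∀ v m, F (A (v ⊗ₜ m)) = B (F (v ⊗ₜ m))) (t : V ⊗[ℂ] M) :
    F (A t) = B (F t) :=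
  congrArg (fun f : V ⊗[ℂ] M →ₗ[ℂ] P => f t)
    (TensorProduct.ext' (g := F ∘ₗ A) (h := B ∘ₗ F) h)

/-- The restriction of an `L`-module to a subalgebra. -/
abbrev resSub (p : LieSubalgebra ℂ L) (V : LieMod.{0} L) : LieMod.{0} p := (res p.incl).obj V

/-- The map `U(L) ⊗[U(p)] (V ⊗ X) → V ⊗ (U(L) ⊗[U(p)] X)` sending `1 ⊗ (v ⊗ ξ)` to
`v ⊗ (1 ⊗ ξ)`. -/
def tensorIndHom (V : LieMod.{0} L) (X : LieMod.{u} p) :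
    indObj p ((tensorLeft (resSub p V)).obj X) ⟶ (tensorLeft V).obj (indObj p X) :=
  indLift (N := (tensorLeft (resSub p V)).obj X) (M := (tensorLeft V).obj (indObj p X))
    ((indIn X).lTensor V) fun x t =>
      map_of_tmul (LieModule.toEnd ℂ p ((tensorLeft (resSub p V)).obj X) x)
        (LieModule.toEnd ℂ L ((tensorLeft V).obj (indObj p X)) x) _ (fun v ξ => by
        refine (congrArg ((indIn X).lTensor V)
          (lie_tmul (V := resSub p V) (M := X) x v ξ)).trans ?_
        refine Eq.trans ?_ (lie_tmul (V := V) (M := indObj p X) (x : L) v (indMk p X 1 ξ)).symm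
        rw [lie_indMk]
        exact map_add ((indIn X).lTensor V) _ _) t

theorem tensorIndHom_mk (V : LieMod.{0} L) (X : LieMod.{u} p) (v : V) (ξ : X) :
    toLin (tensorIndHom V X) (indMk p ((tensorLeft (resSub p V)).obj X) 1
      (v ⊗ₜ[ℂ] ξ : V ⊗[ℂ] X)) = (v ⊗ₜ indMk p X 1 ξ : V ⊗[ℂ] indObj p X) :=
  indLift_one _ _ _

/-- The module of linear maps. -/
def homMod (V : LieMod.{0} L) (M : LieMod.{u} L) : LieMod.{u} L := ⟨V →ₗ[ℂ] M⟩

/-- The adjoint form of the inverse of `tensorIndHom`. -/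
def tensorIndAux (V : LieMod.{0} L) (X : LieMod.{u} p) :
    indObj p X ⟶ homMod V (indObj p ((tensorLeft (resSub p V)).obj X)) :=
  indLift (M := homMod V (indObj p ((tensorLeft (resSub p V)).obj X)))
    (((indIn ((tensorLeft (resSub p V)).obj X)).compRight ℂ ∘ₗ (TensorProduct.mk ℂ V X).flip :
      X →ₗ[ℂ] V →ₗ[ℂ] indObj p ((tensorLeft (resSub p V)).obj X))) fun x ξ => by
      refine LinearMap.ext fun v => ?_
      change indMk p ((tensorLeft (resSub p V)).obj X) 1 (v ⊗ₜ[ℂ] ⁅x, ξ⁆ : V ⊗[ℂ] X) =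
        ⁅(x : L), indMk p ((tensorLeft (resSub p V)).obj X) 1 (v ⊗ₜ[ℂ] ξ : V ⊗[ℂ] X)⁆ -
        indMk p ((tensorLeft (resSub p V)).obj X) 1 (⁅(x : L), v⁆ ⊗ₜ[ℂ] ξ : V ⊗[ℂ] X)
      refine eq_sub_of_add_eq' ?_
      refine (indMk_add (N := (tensorLeft (resSub p V)).obj X) 1 _ _).symm.trans ?_
      refine Eq.trans ?_ (lie_indMk (N := (tensorLeft (resSub p V)).obj X) x _).symm
      rfl

/-- The inverse of `tensorIndHom`. -/
def tensorIndInv (V : LieMod.{0} L) (X : LieMod.{u} p) :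
    (tensorLeft V).obj (indObj p X) ⟶ indObj p ((tensorLeft (resSub p V)).obj X) :=
  let T : indObj p X →ₗ[ℂ] V →ₗ[ℂ] indObj p ((tensorLeft (resSub p V)).obj X) :=
    (toLin (tensorIndAux V X)).toLinearMap
  let F : V ⊗[ℂ] indObj p X →ₗ[ℂ] indObj p ((tensorLeft (resSub p V)).obj X) :=
    TensorProduct.lift T.flip
  ⟨{ F with
      map_lie' := fun {x t} => by
        refine map_of_tmul (LieModule.toEnd ℂ L ((tensorLeft V).obj (indObj p X)) x)
          (LieModule.toEnd ℂ L (indObj p ((tensorLeft (resSub p V)).obj X)) x) F (fun v q => ?_) t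
        refine (congrArg F (lie_tmul (V := V) (M := indObj p X) x v q)).trans ?_
        refine (map_add F _ _).trans ?_
        have h : T ⁅x, q⁆ v = ⁅x, T q v⁆ - T q ⁅x, v⁆ :=
          LinearMap.congr_fun ((toLin (tensorIndAux V X)).map_lie x q :) v
        change T q ⁅x, v⁆ + T ⁅x, q⁆ v = ⁅x, T q v⁆
        rw [h]; abel }⟩

theorem tensorIndInv_mk (V : LieMod.{0} L) (X : LieMod.{u} p) (v : V) (ξ : X) :
    toLin (tensorIndInv V X) (v ⊗ₜ indMk p X 1 ξ : V ⊗[ℂ] indObj p X) =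
      indMk p ((tensorLeft (resSub p V)).obj X) 1 (v ⊗ₜ[ℂ] ξ : V ⊗[ℂ] X) :=
  LinearMap.congr_fun (show (toLin (tensorIndAux V X) (indMk p X 1 ξ) :
      V →ₗ[ℂ] indObj p ((tensorLeft (resSub p V)).obj X)) = _ from
    indLift_one (M := homMod V (indObj p ((tensorLeft (resSub p V)).obj X))) _ _ ξ) v

/-- Two homomorphisms from `V ⊗ (U(L) ⊗[U(p)] X)` agree if they agree on the elements
`v ⊗ (1 ⊗ ξ)`. -/
theorem tensor_ind_hom_ext {V : LieMod.{0} L} {X : LieMod.{u} p} {M : LieMod.{u} L}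
    {f g : (tensorLeft V).obj (indObj p X) ⟶ M}
    (h : ∀ (v : V) (ξ : X), toLin f (v ⊗ₜ indMk p X 1 ξ : V ⊗[ℂ] indObj p X) =
      toLin g (v ⊗ₜ indMk p X 1 ξ : V ⊗[ℂ] indObj p X)) : f = g := by
  -- The q on which f and g agree for every v form a submodule because v ⊗ xq = x(v ⊗ q) - xv ⊗ q;
  -- quantifying over all v is essential for this.
  let S : LieSubmodule ℂ L (indObj p X) :=
    { carrier := {q | ∀ v : V, toLin f (v ⊗ₜ q : V ⊗[ℂ] indObj p X) =
        toLin g (v ⊗ₜ q : V ⊗[ℂ] indObj p X)}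
      add_mem' := fun {a b} ha hb v => by
        rw [TensorProduct.tmul_add]
        exact ((toLin f).map_add _ _).trans ((congrArg₂ (· + ·) (ha v) (hb v)).trans
          ((toLin g).map_add _ _).symm)
      zero_mem' := fun v => by
        rw [TensorProduct.tmul_zero]
        exact (map_zero (toLin f)).trans (map_zero (toLin g)).symm
      smul_mem' := fun r a ha v => by
        rw [TensorProduct.tmul_smul]
        exact ((toLin f).map_smul r _).trans ((congrArg (r • ·) (ha v)).trans
          ((toLin g).map_smul r _).symm)
      lie_mem := fun {x q} hq v => by
        have e : (v ⊗ₜ ⁅x, q⁆ : V ⊗[ℂ] indObj p X) =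
            ⁅x, (v ⊗ₜ q : V ⊗[ℂ] indObj p X)⁆ - ⁅x, v⁆ ⊗ₜ q := by
          rw [TensorProduct.LieModule.lie_tmul_right]; abel
        rw [e]
        refine ((toLin f).map_sub _ _).trans (Eq.trans ?_ ((toLin g).map_sub _ _).symm)
        exact congrArg₂ (· - ·) (((toLin f).map_lie _ _).trans ((congrArg (fun t => ⁅x, t⁆)
          (hq v)).trans ((toLin g).map_lie _ _).symm)) (hq _) }
  ext t
  induction t using TensorProduct.induction_on with
  | zero => exact (map_zero (toLin f)).trans (map_zero (toLin g)).symm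
  | tmul v q => exact ind_top S (fun n v => h v n) q v
  | add a b ha hb =>
    exact ((toLin f).map_add _ _).trans ((congrArg₂ (· + ·) ha hb).trans
          ((toLin g).map_add _ _).symm)

/-- Two homomorphisms from `U(L) ⊗[U(p)] (V ⊗ X)` agree if they agree on the elements
`1 ⊗ (v ⊗ ξ)`. -/
theorem ind_tensor_hom_ext {V : LieMod.{0} p} {X : LieMod.{u} p} {M : LieMod.{u} L}
    {f g : indObj p ((tensorLeft V).obj X) ⟶ M}
    (h : ∀ (v : V) (ξ : X), toLin f (indMk p ((tensorLeft V).obj X) 1 (v ⊗ₜ[ℂ] ξ : V ⊗[ℂ] X)) =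
      toLin g (indMk p ((tensorLeft V).obj X) 1 (v ⊗ₜ[ℂ] ξ : V ⊗[ℂ] X))) : f = g := by
  refine ind_hom_ext fun t => ?_
  let F := (toLin f : indObj p ((tensorLeft V).obj X) →ₗ[ℂ] M) ∘ₗ indIn ((tensorLeft V).obj X)
  let G := (toLin g : indObj p ((tensorLeft V).obj X) →ₗ[ℂ] M) ∘ₗ indIn ((tensorLeft V).obj X)
  change F t = G t
  exact congrArg (fun f : V ⊗[ℂ] X →ₗ[ℂ] M => f t) (TensorProduct.ext' (g := F) (h := G) h)

/-- The tensor identity for induced modules. -/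
def tensorInd (V : LieMod.{0} L) :
    (tensorLeft.{u} (resSub p V) ⋙ ind p : LieMod.{u} p ⥤ LieMod.{u} L) ≅
      ind p ⋙ tensorLeft.{u} V :=
  NatIso.ofComponents (fun X =>
    { hom := tensorIndHom V X
      inv := tensorIndInv V X
      hom_inv_id := ind_tensor_hom_ext fun v ξ =>
        (congrArg (toLin (tensorIndInv V X)) (tensorIndHom_mk V X v ξ)).trans
          (tensorIndInv_mk V X v ξ)
      inv_hom_id := tensor_ind_hom_ext fun v ξ =>
        (congrArg (toLin (tensorIndHom V X)) (tensorIndInv_mk V X v ξ)).trans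
          (tensorIndHom_mk V X v ξ) })
    fun {X Y} f => ind_tensor_hom_ext fun v ξ =>
      (tensorIndHom_mk V Y v (toLin f ξ)).trans (congrArg (toLin ((tensorLeft V).map ((ind p).map f)))
        (tensorIndHom_mk V X v ξ)).symm

end LieMod
end

noncomputable section

/-! ### The parabolic induction bifunctor -/

namespace LieMod

variable {L : Type} [LieRing L] [LieAlgebra ℂ L]

theorem tensorLeft_exact (V : LieMod.{0} L) {A B D : LieMod.{u} L} {f : A ⟶ B} {g : B ⟶ D}
    (h : IsShortExact f g) : IsShortExact ((tensorLeft V).map f) ((tensorLeft V).map g) :=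
  ⟨Module.Flat.lTensor_preserves_injective_linearMap (M := V) (toLin f : A →ₗ[ℂ] B) h.1,
    lTensor_exact V (f := (toLin f : A →ₗ[ℂ] B)) (g := (toLin g : B →ₗ[ℂ] D)) h.2.1 h.2.2,
    LinearMap.lTensor_surjective V (g := (toLin g : B →ₗ[ℂ] D)) h.2.2⟩

theorem tensor_exact_right (V : LieMod.{u} L) {A B D : LieMod.{u} L} {f : A ⟶ B} {g : B ⟶ D}
    (h : IsShortExact f g) : IsShortExact (tensor.map (Prod.mkHom (𝟙 V) f))
      (tensor.map (Prod.mkHom (𝟙 V) g)) :=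
  ⟨Module.Flat.lTensor_preserves_injective_linearMap (M := V) (toLin f : A →ₗ[ℂ] B) h.1,
    lTensor_exact V (f := (toLin f : A →ₗ[ℂ] B)) (g := (toLin g : B →ₗ[ℂ] D)) h.2.1 h.2.2,
    LinearMap.lTensor_surjective V (g := (toLin g : B →ₗ[ℂ] D)) h.2.2⟩

theorem tensor_exact_left (V : LieMod.{u} L) {A B D : LieMod.{u} L} {f : A ⟶ B} {g : B ⟶ D}
    (h : IsShortExact f g) : IsShortExact (tensor.map (Prod.mkHom f (𝟙 V)))
      (tensor.map (Prod.mkHom g (𝟙 V))) :=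
  ⟨Module.Flat.rTensor_preserves_injective_linearMap (M := V) (toLin f : A →ₗ[ℂ] B) h.1,
    rTensor_exact V (f := (toLin f : A →ₗ[ℂ] B)) (g := (toLin g : B →ₗ[ℂ] D)) h.2.1 h.2.2,
    LinearMap.rTensor_surjective V (g := (toLin g : B →ₗ[ℂ] D)) h.2.2⟩

end LieMod

namespace GLn

open LieMod

section Complement

variable (n m : ℕ)

theorem lie_single_apply {r : ℕ} (x : gl r) (i j k l : Fin r) :
    ⁅x, (Matrix.single i j 1 : gl r)⁆ k l =
      (if l = j then x k i else 0) - (if k = i then x j l else 0) := by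
  rw [LieRing.of_associative_ring_bracket, Matrix.sub_apply]
  congr 1
  · split_ifs with h
    · subst h; rw [Matrix.mul_single_apply_same, mul_one]
    · rw [Matrix.mul_single_apply_of_ne _ _ _ _ _ h]
  · split_ifs with h
    · subst h; rw [Matrix.single_mul_apply_same, one_mul]
    · rw [Matrix.single_mul_apply_of_ne _ _ _ _ _ h]

theorem castAdd_ne_natAdd {n m : ℕ} (a : Fin n) (b : Fin m) :
    Fin.castAdd m a ≠ Fin.natAdd n b := by
  simp [Fin.ext_iff]; omega

/-- For a lower left matrix unit e, the product x e lives in one of the first n columns and e x in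
one of the last m rows, so both miss the upper right block. -/
theorem lie_single_upper (x : gl (n + m)) (i : Fin m × Fin n) (a : Fin n) (b : Fin m) :
    ⁅x, (Matrix.single (Fin.natAdd n i.1) (Fin.castAdd m i.2) 1 : gl (n + m))⁆
      (Fin.castAdd m a) (Fin.natAdd n b) = 0 := by
  rw [lie_single_apply, if_neg (castAdd_ne_natAdd _ _).symm, if_neg (castAdd_ne_natAdd _ _),
    sub_zero]

/-- A matrix without upper right block keeps the lower left block stable under bracketing. With
`lie_single_upper` this yields the condition `step`. -/
theorem lie_single_of_diag (x : gl (n + m)) (i : Fin m × Fin n)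
    (h : ∀ a b, x (Fin.castAdd m a) (Fin.natAdd n b) = 0) (r s : Fin (n + m))
    (hrs : (∃ a, r = Fin.castAdd m a) ∨ ∃ b, s = Fin.natAdd n b) :
    ⁅x, (Matrix.single (Fin.natAdd n i.1) (Fin.castAdd m i.2) 1 : gl (n + m))⁆ r s = 0 := by
  rw [lie_single_apply]
  rcases hrs with ⟨a, rfl⟩ | ⟨b, rfl⟩
  · rw [if_neg (castAdd_ne_natAdd _ _), h, ite_self, sub_zero]
  · rw [if_neg (castAdd_ne_natAdd _ _).symm, h, ite_self, sub_zero]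

/-- The projection to the parabolic subalgebra along the strictly lower block triangular
matrices. -/
def parabolicProj : gl (n + m) →ₗ[ℂ] parabolic n m :=
  { toFun x := ⟨x - ∑ i : Fin m × Fin n, x (Fin.natAdd n i.1) (Fin.castAdd m i.2) •
      (Matrix.single (Fin.natAdd n i.1) (Fin.castAdd m i.2) 1 : gl (n + m)), fun b a => by
        rw [Matrix.sub_apply, Matrix.sum_apply, Finset.sum_eq_single (b, a)]
        · simp
        · rintro ⟨b', a'⟩ - h
          rw [Matrix.smul_apply, Matrix.single_apply_of_ne, smul_zero]
          rintro ⟨h1, h2⟩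
          exact h (Prod.ext (Fin.natAdd_injective _ _ h1) (Fin.castAdd_injective _ _ h2))
        · simp⟩
    map_add' x y := Subtype.ext <| by
      simp only [Matrix.add_apply, add_smul, Finset.sum_add_distrib]
      change _ = (x - _) + (y - _)
      abel
    map_smul' c x := Subtype.ext <| by
      change c • x - _ = c • (x - _)
      rw [smul_sub, Finset.smul_sum]
      simp only [Matrix.smul_apply, smul_smul, smul_eq_mul] }

/-- The strictly lower block triangular matrices form a complement of the parabolic subalgebra. -/
def parabolicComplement : AbelianComplement (parabolic n m) (Fin m × Fin n) where
  Y i := Matrix.single (Fin.natAdd n i.1) (Fin.castAdd m i.2) 1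
  coord :=
    { toFun x i := x (Fin.natAdd n i.1) (Fin.castAdd m i.2)
      map_add' _ _ := rfl
      map_smul' _ _ := rfl }
  par := parabolicProj n m
  comm i j := by
    rw [LieRing.of_associative_ring_bracket, Matrix.single_mul_single_of_ne,
      Matrix.single_mul_single_of_ne, sub_zero]
    · simp [Fin.ext_iff]; omega
    · simp [Fin.ext_iff]; omega
  decomp x := by
    change x = _ + (x - _)
    exact (add_sub_cancel _ _).symm
  coord_Y i := by
    ext j
    change Matrix.single _ _ (1 : ℂ) _ _ = _
    by_cases h : j = i
    · subst h; simp
    · rw [Matrix.single_apply_of_ne, Pi.single_eq_of_ne h]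
      rintro ⟨h1, h2⟩
      exact h (Prod.ext (Fin.natAdd_injective _ _ h1).symm (Fin.castAdd_injective _ _ h2).symm)
  par_Y i := by
    apply Subtype.ext
    change (_ - _ : gl (n + m)) = 0
    rw [Finset.sum_eq_single i]
    · simp
    · intro j _ h
      rw [Matrix.single_apply_of_ne, zero_smul]
      rintro ⟨h1, h2⟩
      exact h (Prod.ext (Fin.natAdd_injective _ _ h1).symm (Fin.castAdd_injective _ _ h2).symm)
    · simp
  coord_par x := funext fun i => x.2 i.1 i.2
  par_par x := Subtype.ext <| by
    change (x : gl (n + m)) - _ = x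
    rw [Finset.sum_eq_zero, sub_zero]
    intro i _
    rw [x.2 i.1 i.2, zero_smul]
  step x i j := Subtype.ext <| by
    set Z : gl (n + m) := ⁅(x : gl (n + m)),
      (Matrix.single (Fin.natAdd n i.1) (Fin.castAdd m i.2) 1 : gl (n + m))⁆ with hZ
    set z : gl (n + m) := Z - ∑ i : Fin m × Fin n, Z (Fin.natAdd n i.1) (Fin.castAdd m i.2) •
        (Matrix.single (Fin.natAdd n i.1) (Fin.castAdd m i.2) 1 : gl (n + m)) with hz
    -- Removing the lower left block from Z leaves a block diagonal matrix z, so the bracket W of z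
    -- with another lower left unit lies in the lower left block and the projection kills it.
    have h0 : ∀ a b, z (Fin.castAdd m a) (Fin.natAdd n b) = 0 := by
      intro a b
      rw [hz, Matrix.sub_apply, hZ, lie_single_upper, Matrix.sum_apply, Finset.sum_eq_zero, sub_zero]
      intro i _
      rw [Matrix.smul_apply, Matrix.single_apply_of_ne, smul_zero]
      rintro ⟨h1, -⟩
      exact castAdd_ne_natAdd _ _ h1.symm
    have h1 := lie_single_of_diag n m z j h0
    set W : gl (n + m) := ⁅z, (Matrix.single (Fin.natAdd n j.1) (Fin.castAdd m j.2) 1 : gl (n + m))⁆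
    change (W - ∑ i : Fin m × Fin n, W (Fin.natAdd n i.1) (Fin.castAdd m i.2) •
        (Matrix.single (Fin.natAdd n i.1) (Fin.castAdd m i.2) 1 : gl (n + m))) = 0
    refine Matrix.ext fun r s => ?_
    have h2 : ∀ i : Fin m × Fin n, ¬ (Fin.natAdd n i.1 = r ∧ Fin.castAdd m i.2 = s) →
      (W (Fin.natAdd n i.1) (Fin.castAdd m i.2) •
        (Matrix.single (Fin.natAdd n i.1) (Fin.castAdd m i.2) 1 : gl (n + m))) r s = 0 := by
      intro i h
      rw [Matrix.smul_apply, Matrix.single_apply_of_ne _ _ _ _ _ h, smul_zero]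
    rw [Matrix.sub_apply, Matrix.sum_apply, Matrix.zero_apply]
    induction r using Fin.addCases with
    | left a =>
      rw [h1 _ _ (Or.inl ⟨a, rfl⟩), Finset.sum_eq_zero fun i _ => h2 i fun h =>
        castAdd_ne_natAdd _ _ h.1.symm, sub_zero]
    | right b =>
      induction s using Fin.addCases with
      | right b' =>
        rw [h1 _ _ (Or.inr ⟨b', rfl⟩), Finset.sum_eq_zero fun i _ => h2 i fun h =>
          castAdd_ne_natAdd _ _ h.2, sub_zero]
      | left a =>
        rw [Finset.sum_eq_single (b, a)]
        · simp
        · intro i _ h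
          refine h2 i fun h' => h (Prod.ext (Fin.natAdd_injective _ _ h'.1)
            (Fin.castAdd_injective _ _ h'.2))
        · simp

end Complement

variable {n m : ℕ}

theorem C_exact_left (N : LieMod.{u} (gl m)) {A B D : LieMod.{u} (gl n)} {f : A ⟶ B} {g : B ⟶ D}
    (h : IsShortExact f g) : IsShortExact ((C n m).map (Prod.mkHom f (𝟙 N)))
      ((C n m).map (Prod.mkHom g (𝟙 N))) :=
  (parabolicComplement n m).ind_exact (tensorLeft_exact (shift n m)
    (tensor_exact_left ((res (blockSnd n m)).obj N) (f := (res (blockFst n m)).map f)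
      (g := (res (blockFst n m)).map g) h))

theorem C_exact_right (M : LieMod.{u} (gl n)) {A B D : LieMod.{u} (gl m)} {f : A ⟶ B} {g : B ⟶ D}
    (h : IsShortExact f g) : IsShortExact ((C n m).map (Prod.mkHom (𝟙 M) f))
      ((C n m).map (Prod.mkHom (𝟙 M) g)) :=
  (parabolicComplement n m).ind_exact (tensorLeft_exact (shift n m)
    (tensor_exact_right ((res (blockFst n m)).obj M) (f := (res (blockSnd n m)).map f)
      (g := (res (blockSnd n m)).map g) h))

variable {M : LieMod.{u} (gl n)} {N : LieMod.{u} (gl m)}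

/-- The underlying space of `C₀`. -/
abbrev C₀Carrier (M : LieMod.{u} (gl n)) (N : LieMod.{u} (gl m)) : Type u :=
  shift n m ⊗[ℂ] (M ⊗[ℂ] N)

/-- `v ⊗ w` as an element of `C₀`. -/
def mkC₀ (v : M) (w : N) : (C₀ n m).obj (M, N) :=
  (((1 : ℂ) : shift n m) ⊗ₜ[ℂ] (v ⊗ₜ[ℂ] w) : C₀Carrier M N)

/-- The character of the parabolic subalgebra by which it acts on `shift`. -/
def shiftChar (n m : ℕ) (x : gl (n + m)) : ℂ :=
  -(m : ℂ) / 2 * (x.submatrix (Fin.castAdd m) (Fin.castAdd m)).trace +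
    (n : ℂ) / 2 * (x.submatrix (Fin.natAdd n) (Fin.natAdd n)).trace

theorem lie_mkC₀ (x : parabolic n m) (v : M) (w : N) :
    ⁅x, (mkC₀ v w : (C₀ n m).obj (M, N))⁆ = shiftChar n m x • mkC₀ v w +
      mkC₀ ⁅blockFst n m x, v⁆ w + mkC₀ v ⁅blockSnd n m x, w⁆ := by
  have h1 : ∀ y : shift n m, ⁅x, y⁆ = shiftChar n m x • y := fun y => rfl
  have h2 : ⁅x, (v ⊗ₜ[ℂ] w : tensor.obj ((res (blockFst n m)).obj M, (res (blockSnd n m)).obj N))⁆ =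
      (⁅blockFst n m x, v⁆ ⊗ₜ[ℂ] w + v ⊗ₜ[ℂ] ⁅blockSnd n m x, w⁆ : M ⊗[ℂ] N) :=
    TensorProduct.LieModule.lie_tmul_right (M := (res (blockFst n m)).obj M)
      (N := (res (blockSnd n m)).obj N) x v w
  have h3 : ∀ (y : shift n m) (s t : M ⊗[ℂ] N), ((shiftChar n m x • y) ⊗ₜ[ℂ] (v ⊗ₜ[ℂ] w) +
      y ⊗ₜ[ℂ] (s + t) : C₀Carrier M N) =
      shiftChar n m x • (y ⊗ₜ[ℂ] (v ⊗ₜ[ℂ] w)) + y ⊗ₜ[ℂ] s + y ⊗ₜ[ℂ] t := by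
    intro y s t
    rw [TensorProduct.tmul_add, TensorProduct.smul_tmul', add_assoc]
  have h4 : ∀ y : shift n m, ⁅x, (y ⊗ₜ (v ⊗ₜ[ℂ] w) : (tensorLeft (shift n m)).obj
      (tensor.obj ((res (blockFst n m)).obj M, (res (blockSnd n m)).obj N)))⁆ =
      (shiftChar n m x • (y ⊗ₜ[ℂ] (v ⊗ₜ[ℂ] w)) + y ⊗ₜ[ℂ] (⁅blockFst n m x, v⁆ ⊗ₜ[ℂ] w) +
        y ⊗ₜ[ℂ] (v ⊗ₜ[ℂ] ⁅blockSnd n m x, w⁆) : C₀Carrier M N) := by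
    intro y
    refine (lie_tmul (V := shift n m) (M := tensor.obj ((res (blockFst n m)).obj M,
      (res (blockSnd n m)).obj N)) x y (v ⊗ₜ[ℂ] w : M ⊗[ℂ] N)).trans ?_
    exact (congrArg₂ (fun a (b : M ⊗[ℂ] N) => (a ⊗ₜ[ℂ] (v ⊗ₜ[ℂ] w) + y ⊗ₜ[ℂ] b : C₀Carrier M N)) (h1 y) h2).trans
      (h3 _ _ _)
  exact h4 (1 : ℂ)

/-- `v ⊗ w ↦ mkC₀ v w` as a linear equivalence. -/
def mkC₀Equiv (M : LieMod.{u} (gl n)) (N : LieMod.{u} (gl m)) :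
    M ⊗[ℂ] N ≃ₗ[ℂ] (C₀ n m).obj (M, N) :=
  (TensorProduct.lid ℂ (M ⊗[ℂ] N)).symm

theorem mkC₀Equiv_tmul (v : M) (w : N) : mkC₀Equiv M N (v ⊗ₜ w) = mkC₀ v w := rfl

/-- `mkC` as a bilinear map. -/
def mkCLin (M : LieMod.{u} (gl n)) (N : LieMod.{u} (gl m)) : M →ₗ[ℂ] N →ₗ[ℂ] (C n m).obj (M, N) :=
  TensorProduct.curry ((indIn ((C₀ n m).obj (M, N))) ∘ₗ (mkC₀Equiv M N).toLinearMap)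

theorem lie_mkC (x : gl (n + m)) (hx : x ∈ parabolic n m) (v : M) (w : N) :
    ⁅x, mkC n m v w⁆ = shiftChar n m x • mkC n m v w +
      mkC n m ⁅(x.submatrix (Fin.castAdd m) (Fin.castAdd m) : gl n), v⁆ w +
      mkC n m v ⁅(x.submatrix (Fin.natAdd n) (Fin.natAdd n) : gl m), w⁆ := by
  refine (lie_indMk (N := (C₀ n m).obj (M, N)) ⟨x, hx⟩ (mkC₀ v w)).trans ?_
  refine (congrArg (indIn ((C₀ n m).obj (M, N))) (lie_mkC₀ ⟨x, hx⟩ v w)).trans ?_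
  rw [map_add, map_add, map_smul]
  rfl

theorem C_map_mkC {M' : LieMod.{u} (gl n)} {N' : LieMod.{u} (gl m)} (f : M ⟶ M') (g : N ⟶ N')
    (v : M) (w : N) :
    toLin ((C n m).map (Prod.mkHom f g)) (mkC n m v w) = mkC n m (toLin f v) (toLin g w) := rfl

theorem C₀_top (S : Submodule ℂ ((C₀ n m).obj (M, N))) (h : ∀ v w, mkC₀ v w ∈ S)
    (t : (C₀ n m).obj (M, N)) : t ∈ S := by
  obtain ⟨t, rfl⟩ := (mkC₀Equiv M N).surjective t
  induction t using TensorProduct.induction_on with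
  | zero => rw [map_zero]; exact zero_mem _
  | tmul v w => exact h v w
  | add a b ha hb => rw [map_add]; exact add_mem ha hb

theorem C_top (S : LieSubmodule ℂ (gl (n + m)) ((C n m).obj (M, N)))
    (h : ∀ v w, mkC n m v w ∈ S) : S = ⊤ := by
  refine eq_top_iff.2 fun x _ => ind_top S (fun t => ?_) x
  exact C₀_top ((S : Submodule ℂ ((C n m).obj (M, N))).comap (indIn ((C₀ n m).obj (M, N)))) h t

end GLn
end

noncomputable section

/-! ### Central characters -/

namespace GLn

open LieMod

theorem env_induction {L : Type} [LieRing L] [LieAlgebra ℂ L]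
    {P : UniversalEnvelopingAlgebra ℂ L → Prop} (halg : ∀ r, P (algebraMap ℂ _ r))
    (hι : ∀ x, P (UniversalEnvelopingAlgebra.ι ℂ x)) (hmul : ∀ a b, P a → P b → P (a * b))
    (hadd : ∀ a b, P a → P b → P (a + b)) (w : UniversalEnvelopingAlgebra ℂ L) : P w := by
  obtain ⟨t, rfl⟩ : ∃ t, UniversalEnvelopingAlgebra.mkAlgHom ℂ L t = w :=
    RingCon.mk'_surjective (c := UniversalEnvelopingAlgebra.ringCon ℂ L) w
  induction t using TensorAlgebra.induction with
  | algebraMap r => rw [AlgHom.commutes]; exact halg r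
  | ι x => exact hι x
  | mul a b ha hb => rw [map_mul]; exact hmul _ _ ha hb
  | add a b ha hb => rw [map_add]; exact hadd _ _ ha hb

theorem ι_mul_ι {L : Type} [LieRing L] [LieAlgebra ℂ L] (x y : L) :
    UniversalEnvelopingAlgebra.ι ℂ x * UniversalEnvelopingAlgebra.ι ℂ y =
      UniversalEnvelopingAlgebra.ι ℂ y * UniversalEnvelopingAlgebra.ι ℂ x +
        UniversalEnvelopingAlgebra.ι ℂ ⁅x, y⁆ := by
  rw [LieHom.map_lie, LieRing.of_associative_ring_bracket]; abel

variable {n : ℕ}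

/-- The generator `E_{ab}` of `U(gl n)`. -/
def gen (a b : Fin n) : Env n := UniversalEnvelopingAlgebra.ι ℂ (Matrix.single a b 1 : gl n)

/-- The subalgebra of `U(gl n)` generated by the strictly lower triangular matrices. -/
def lowerAlg (n : ℕ) : Subalgebra ℂ (Env n) :=
  Algebra.adjoin ℂ {t | ∃ a b : Fin n, b < a ∧ t = gen a b}

/-- Upper triangular matrices. -/
def IsUpper (x : gl n) : Prop := ∀ a b, b < a → x a b = 0

theorem gen_mem_lowerAlg {a b : Fin n} (h : b < a) : gen a b ∈ lowerAlg n :=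
  Algebra.subset_adjoin ⟨a, b, h, rfl⟩

theorem exists_lower_add_upper (y : gl n) : ∃ t ∈ lowerAlg n, ∃ x : gl n, IsUpper x ∧
    UniversalEnvelopingAlgebra.ι ℂ y = t + UniversalEnvelopingAlgebra.ι ℂ x := by
  let z : gl n := ∑ a, ∑ b, if b < a then y a b • (Matrix.single a b 1 : gl n) else 0
  refine ⟨UniversalEnvelopingAlgebra.ι ℂ z, ?_, y - z, ?_, ?_⟩
  · rw [map_sum]
    refine sum_mem fun a _ => ?_
    rw [map_sum]
    refine sum_mem fun b _ => ?_
    split_ifs with h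
    · rw [map_smul]
      exact Subalgebra.smul_mem _ (gen_mem_lowerAlg h) _
    · rw [map_zero]; exact zero_mem _
  · intro a b hab
    have : z a b = y a b := by
      simp only [z, Matrix.sum_apply]
      rw [Finset.sum_eq_single a, Finset.sum_eq_single b]
      · simp [hab]
      · intro b' _ hb
        split_ifs <;> simp [hb]
      · simp
      · intro a' _ ha
        refine Finset.sum_eq_zero fun b' _ => ?_
        split_ifs <;> simp [ha]
      · simp
    rw [Matrix.sub_apply, this, sub_self]
  · rw [map_sub]; abel

/-- `U(𝔫₋) 𝔟 + U(𝔫₋)`. -/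
def lowerUpper (n : ℕ) : Submodule ℂ (Env n) :=
  Submodule.span ℂ ({t | ∃ w ∈ lowerAlg n, ∃ x : gl n, IsUpper x ∧
    t = w * UniversalEnvelopingAlgebra.ι ℂ x} ∪ lowerAlg n)

theorem lowerAlg_mul_lowerUpper {w t : Env n} (hw : w ∈ lowerAlg n) (ht : t ∈ lowerUpper n) :
    w * t ∈ lowerUpper n := by
  induction ht using Submodule.span_induction with
  | mem t ht =>
    rcases ht with ⟨w', hw', x, hx, rfl⟩ | ht
    · rw [← mul_assoc]
      exact Submodule.subset_span (Or.inl ⟨_, mul_mem hw hw', x, hx, rfl⟩)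
    · exact Submodule.subset_span (Or.inr (mul_mem hw ht))
  | zero => rw [mul_zero]; exact zero_mem _
  | add a b _ _ ha hb => rw [mul_add]; exact add_mem ha hb
  | smul r a _ ha => rw [mul_smul_comm]; exact Submodule.smul_mem _ _ ha

theorem ι_mem_lowerUpper (y : gl n) : UniversalEnvelopingAlgebra.ι ℂ y ∈ lowerUpper n := by
  obtain ⟨t, ht, x, hx, e⟩ := exists_lower_add_upper y
  rw [e]
  exact add_mem (Submodule.subset_span (Or.inr ht))
    (Submodule.subset_span (Or.inl ⟨1, one_mem _, x, hx, (one_mul _).symm⟩))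

/-- An upper triangular x is moved to the right past lower triangular generators. Each commutator
again splits into a lower and an upper triangular part, which is why x has to vary in the induction.
-/
theorem ι_mul_mem_lowerUpper {w : Env n} (hw : w ∈ lowerAlg n) (x : gl n) (hx : IsUpper x) :
    UniversalEnvelopingAlgebra.ι ℂ x * w ∈ lowerUpper n := by
  induction hw using Algebra.adjoin_induction generalizing x with
  | mem w hw =>
    obtain ⟨a, b, h, rfl⟩ := hw
    rw [gen, ι_mul_ι]
    exact add_mem (Submodule.subset_span (Or.inl ⟨_, gen_mem_lowerAlg h, x, hx, rfl⟩))
      (ι_mem_lowerUpper _)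
  | algebraMap r =>
    rw [← Algebra.commutes]
    exact Submodule.subset_span (Or.inl ⟨_, Subalgebra.algebraMap_mem _ _, x, hx, rfl⟩)
  | add a b _ _ ha hb => rw [mul_add]; exact add_mem (ha x hx) (hb x hx)
  | mul a b ha' hb' ha hb =>
    -- The hypothesis on b for all upper triangular elements makes U(𝔫₋)𝔟 + U(𝔫₋) stable under right
    -- multiplication by b.
    have key : ∀ t ∈ lowerUpper n, t * b ∈ lowerUpper n := by
      intro t ht
      induction ht using Submodule.span_induction with
      | mem t ht =>
        rcases ht with ⟨w', hw', x, hx, rfl⟩ | ht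
        · rw [mul_assoc]
          exact lowerAlg_mul_lowerUpper hw' (hb x hx)
        · exact Submodule.subset_span (Or.inr (mul_mem ht hb'))
      | zero => rw [zero_mul]; exact zero_mem _
      | add a b _ _ ha hb => rw [add_mul]; exact add_mem ha hb
      | smul r a _ ha => rw [smul_mul_assoc]; exact Submodule.smul_mem _ _ ha
    rw [← mul_assoc]
    exact key _ (ha x hx)

/-- Modulo the left ideal the strictly upper part of x vanishes and its diagonal part d becomes the
scalar (μ - ρ)(d). -/
theorem lowerUpper_le (μ : Fin n → ℂ) : lowerUpper n ≤
    Subalgebra.toSubmodule (lowerAlg n) ⊔ (vermaIdeal n μ).restrictScalars ℂ := by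
  rw [lowerUpper, Submodule.span_le]
  rintro t (⟨w, hw, x, hx, rfl⟩ | ht)
  · let d : Fin n → ℂ := fun k => x k k
    have e : x = (x - Matrix.diagonal d) + Matrix.diagonal d := by abel
    have hu : IsStrictUpper (x - Matrix.diagonal d : gl n) := by
      intro a b hab
      rw [Matrix.sub_apply]
      rcases hab.lt_or_eq with h | rfl
      · rw [hx a b h, Matrix.diagonal_apply_ne _ h.ne', sub_zero]
      · rw [Matrix.diagonal_apply_eq, sub_self]
    have e2 : w * UniversalEnvelopingAlgebra.ι ℂ x =
        w * algebraMap ℂ (Env n) (∑ k, d k * (μ k - rho n k)) +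
        (w * UniversalEnvelopingAlgebra.ι ℂ (x - Matrix.diagonal d : gl n) +
        w * (UniversalEnvelopingAlgebra.ι ℂ (Matrix.diagonal d : gl n) -
          algebraMap ℂ (Env n) (∑ k, d k * (μ k - rho n k)))) := by
      conv_lhs => rw [e, map_add]
      noncomm_ring
    rw [e2]
    refine add_mem (Submodule.mem_sup_left
      ((lowerAlg n).mul_mem hw (Subalgebra.algebraMap_mem _ _)))
      (Submodule.mem_sup_right (add_mem ?_ ?_))
    · exact (vermaIdeal n μ).smul_mem w (Submodule.subset_span (Or.inl ⟨_, hu, rfl⟩))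
    · exact (vermaIdeal n μ).smul_mem w (Submodule.subset_span (Or.inr ⟨d, rfl⟩))
  · exact Submodule.mem_sup_left ht

/-- The Verma module is U(𝔫₋) applied to its generator: the sum contains 1 and is stable under left
multiplication by every element of gl_n. -/
theorem lowerAlg_sup_vermaIdeal (μ : Fin n → ℂ) (u : Env n) :
    u ∈ Subalgebra.toSubmodule (lowerAlg n) ⊔ (vermaIdeal n μ).restrictScalars ℂ := by
  have key : ∀ t ∈ Subalgebra.toSubmodule (lowerAlg n) ⊔ (vermaIdeal n μ).restrictScalars ℂ,
      u * t ∈ Subalgebra.toSubmodule (lowerAlg n) ⊔ (vermaIdeal n μ).restrictScalars ℂ := by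
    induction u using env_induction with
    | halg r =>
      intro t ht
      rw [← Algebra.smul_def]
      exact Submodule.smul_mem _ _ ht
    | hι y =>
      intro t ht
      obtain ⟨w, hw, i, hi, rfl⟩ := Submodule.mem_sup.1 ht
      rw [mul_add]
      refine add_mem ?_ (Submodule.mem_sup_right ((vermaIdeal n μ).smul_mem _ hi))
      obtain ⟨t, ht, x, hx, e⟩ := exists_lower_add_upper y
      rw [e, add_mul]
      exact add_mem (Submodule.mem_sup_left ((lowerAlg n).mul_mem ht hw))
        (lowerUpper_le μ (ι_mul_mem_lowerUpper hw x hx))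
    | hmul a b ha hb => intro t ht; rw [mul_assoc]; exact ha _ (hb _ ht)
    | hadd a b ha hb => intro t ht; rw [add_mul]; exact add_mem (ha _ ht) (hb _ ht)
  have := key 1 (Submodule.mem_sup_left (one_mem (lowerAlg n)))
  rwa [mul_one] at this

/-- A diagonal matrix with distinct integral entries, used to grade `U(gl n)`. -/
def gradElt (n : ℕ) : gl n := Matrix.diagonal fun k => -((k : ℕ) : ℂ)

theorem gradElt_comm (a b : Fin n) : UniversalEnvelopingAlgebra.ι ℂ (gradElt n) * gen a b =
    gen a b * UniversalEnvelopingAlgebra.ι ℂ (gradElt n) - (((a : ℕ) : ℂ) - (b : ℕ)) • gen a b := by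
  have : ⁅gradElt n, (Matrix.single a b 1 : gl n)⁆ =
      -((((a : ℕ) : ℂ) - (b : ℕ)) • (Matrix.single a b 1 : gl n)) := by
    refine Matrix.ext fun k l => ?_
    rw [lie_single_apply, gradElt, Matrix.diagonal_apply, Matrix.diagonal_apply, Matrix.neg_apply,
      Matrix.smul_apply, Matrix.single_apply]
    by_cases hk : k = a <;> by_cases hl : l = b
    · subst hk hl
      simp only [if_true, and_self, smul_eq_mul]
      ring
    · simp [hl, Ne.symm hl]
    · simp [hk, Ne.symm hk]
    · simp [hk, hl, Ne.symm hk]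
  rw [gen, ι_mul_ι, this, map_neg, map_smul, ← sub_eq_add_neg]

/-- A monomial in the E_{ab} with b < a has degree k equal to the sum of the positive numbers a - b,
so degree zero occurs only for the empty product. -/
theorem lowerAlg_le_span : Subalgebra.toSubmodule (lowerAlg n) ≤ Submodule.span ℂ
    {w | ∃ k : ℕ, UniversalEnvelopingAlgebra.ι ℂ (gradElt n) * w =
      w * UniversalEnvelopingAlgebra.ι ℂ (gradElt n) - (k : ℂ) • w ∧ (k = 0 → w = 1)} := by
  rw [lowerAlg, Algebra.adjoin_eq_span]
  refine Submodule.span_mono fun w hw => ?_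
  induction hw using Submonoid.closure_induction with
  | mem w hw =>
    obtain ⟨a, b, h, rfl⟩ := hw
    refine ⟨(a : ℕ) - b, ?_, fun h0 => ?_⟩
    · rw [gradElt_comm, Nat.cast_sub (Fin.le_def.1 h.le)]
    · exact absurd (Fin.lt_def.1 h) (by omega)
  | one => exact ⟨0, by simp, fun _ => rfl⟩
  | mul v w _ _ hv hw =>
    obtain ⟨j, hj, hj0⟩ := hv
    obtain ⟨k, hk, hk0⟩ := hw
    refine ⟨j + k, ?_, fun h => ?_⟩
    · rw [← mul_assoc, hj, sub_mul, mul_assoc, hk, mul_sub, smul_mul_assoc, mul_smul_comm,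
        Nat.cast_add, add_smul, mul_assoc]
      abel
    · rw [hj0 (by omega), hk0 (by omega), one_mul]

/-- The canonical generator of a Verma module. -/
def vermaGen (n : ℕ) (μ : Fin n → ℂ) : Verma n μ := Submodule.Quotient.mk 1

theorem smul_vermaGen (μ : Fin n → ℂ) (u : Env n) :
    u • vermaGen n μ = Submodule.Quotient.mk u := by
  rw [vermaGen, ← Submodule.Quotient.mk_smul, smul_eq_mul, mul_one]

theorem smul_vermaGen_eq_zero (μ : Fin n → ℂ) (u : Env n) :
    u • vermaGen n μ = 0 ↔ u ∈ vermaIdeal n μ := by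
  rw [smul_vermaGen, Submodule.Quotient.mk_eq_zero]

theorem diagonal_smul_vermaGen (μ d : Fin n → ℂ) :
    UniversalEnvelopingAlgebra.ι ℂ (Matrix.diagonal d : gl n) • vermaGen n μ =
      (∑ k, d k * (μ k - rho n k)) • vermaGen n μ := by
  rw [← sub_eq_zero, ← algebraMap_smul (Env n) (∑ k, d k * (μ k - rho n k)), ← sub_smul,
    smul_vermaGen_eq_zero]
  exact Submodule.subset_span (Or.inr ⟨d, rfl⟩)

theorem upper_smul_vermaGen (μ : Fin n → ℂ) {x : gl n} (hx : IsStrictUpper x) :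
    UniversalEnvelopingAlgebra.ι ℂ x • vermaGen n μ = 0 :=
  (smul_vermaGen_eq_zero _ _).2 (Submodule.subset_span (Or.inl ⟨x, hx, rfl⟩))

/-- The center acts on the generator of a Verma module by scalars. -/
theorem exists_central_character (μ : Fin n → ℂ) (z : Subalgebra.center ℂ (Env n)) :
    ∃ c : ℂ, (z : Env n) - algebraMap ℂ _ c ∈ vermaIdeal n μ := by
  set h := UniversalEnvelopingAlgebra.ι ℂ (gradElt n) with hh
  let T : Module.End ℂ (Verma n μ) := Algebra.lsmul ℂ ℂ (Verma n μ) h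
  set e : ℂ := ∑ k : Fin n, -((k : ℕ) : ℂ) * (μ k - rho n k)
  have hT : h • vermaGen n μ = e • vermaGen n μ := diagonal_smul_vermaGen _ _
  have hcomm : ∀ (u : Env n) (a : ℂ), h * u = u * h - a • u →
      u • vermaGen n μ ∈ T.eigenspace (e - a) := by
    intro u a hu
    rw [Module.End.mem_eigenspace_iff]
    change h • u • vermaGen n μ = _
    rw [smul_smul, hu, sub_smul, mul_smul, hT, sub_smul, smul_comm u e, smul_assoc]
  -- U(𝔫₋) acts on the generator by scalars modulo the eigenspaces of `gradElt` with eigenvalue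
  -- different from e, the one of the generator.
  have key : ∀ w ∈ lowerAlg n, ∃ c : ℂ, w • vermaGen n μ - c • vermaGen n μ ∈
      ⨆ k, ⨆ (_ : k ≠ e), T.eigenspace k := by
    intro w hw
    have hw' := lowerAlg_le_span hw
    clear hw
    induction hw' using Submodule.span_induction with
    | mem w hw =>
      obtain ⟨k, hk, hk0⟩ := hw
      by_cases h0 : k = 0
      · exact ⟨1, by rw [hk0 h0, one_smul, one_smul, sub_self]; exact zero_mem _⟩
      · refine ⟨0, ?_⟩
        rw [zero_smul, sub_zero]
        refine Submodule.mem_iSup_of_mem (e - k) (Submodule.mem_iSup_of_mem ?_ (hcomm w k hk))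
        simpa using h0
    | zero => exact ⟨0, by simp⟩
    | add a b _ _ ha hb =>
      obtain ⟨c, hc⟩ := ha
      obtain ⟨d, hd⟩ := hb
      refine ⟨c + d, ?_⟩
      rw [add_smul, add_smul, add_sub_add_comm]
      exact add_mem hc hd
    | smul r a _ ha =>
      obtain ⟨c, hc⟩ := ha
      refine ⟨r * c, ?_⟩
      rw [smul_assoc, mul_smul, ← smul_sub]
      exact Submodule.smul_mem _ _ hc
  obtain ⟨w, hw, i, hi, hwi⟩ := Submodule.mem_sup.1 (lowerAlg_sup_vermaIdeal μ z)
  obtain ⟨c, hc⟩ := key w hw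
  have hz : (z : Env n) • vermaGen n μ = w • vermaGen n μ := by
    rw [← hwi, add_smul, (smul_vermaGen_eq_zero μ i).2 hi, add_zero]
  rw [← hz] at hc
  refine ⟨c, ?_⟩
  rw [← smul_vermaGen_eq_zero, sub_smul, algebraMap_smul]
  -- As z commutes with h, the vector z v - c v has eigenvalue e; it also lies in the sum of the
  -- other eigenspaces, so it is zero.
  refine Submodule.disjoint_def.1 (Module.End.eigenspaces_iSupIndep T e) _ (sub_mem ?_ ?_) hc
  · have := hcomm z 0 (by rw [zero_smul, sub_zero]; exact (Subalgebra.mem_center_iff.1 z.2 h))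
    rwa [sub_zero] at this
  · have := hcomm 1 0 (by simp)
    rw [one_smul, sub_zero] at this
    exact Submodule.smul_mem _ _ this

/-- A central element that kills the generator kills the whole cyclic module. -/
theorem mem_centralIdeal_iff (μ : Fin n → ℂ) (z : Subalgebra.center ℂ (Env n)) :
    z ∈ centralIdeal n μ ↔ (z : Env n) ∈ vermaIdeal n μ := by
  rw [centralIdeal, Ideal.mem_comap, Module.mem_annihilator]
  constructor
  · intro h
    exact (smul_vermaGen_eq_zero μ _).1 (h _)
  · intro h v
    obtain ⟨u, rfl⟩ := Submodule.Quotient.mk_surjective _ v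
    change (z : Env n) • Submodule.Quotient.mk u = 0
    rw [← Submodule.Quotient.mk_smul, Submodule.Quotient.mk_eq_zero, smul_eq_mul,
      ← Subalgebra.mem_center_iff.1 z.2 u]
    exact (vermaIdeal n μ).smul_mem u h

theorem exists_sub_mem_centralIdeal (μ : Fin n → ℂ) (z : Subalgebra.center ℂ (Env n)) :
    ∃ c : ℂ, z - algebraMap ℂ _ c ∈ centralIdeal n μ := by
  obtain ⟨c, hc⟩ := exists_central_character μ z
  exact ⟨c, (mem_centralIdeal_iff _ _).2 hc⟩

/-- Every central element is a scalar modulo the ideal, so the quotient is at most one-dimensional;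
`h` says that it is not zero. -/
theorem centralIdeal_isMaximal (μ : Fin n → ℂ) (h : centralIdeal n μ ≠ ⊤) :
    (centralIdeal n μ).IsMaximal := by
  rw [Ideal.isMaximal_iff]
  refine ⟨(Ideal.ne_top_iff_one _).1 h, fun I x hI hx hxI => ?_⟩
  obtain ⟨c, hc⟩ := exists_sub_mem_centralIdeal μ x
  have hc0 : c ≠ 0 := by
    rintro rfl
    rw [map_zero, sub_zero] at hc
    exact hx hc
  have h1 : algebraMap ℂ (Subalgebra.center ℂ (Env n)) c ∈ I := by
    have := sub_mem hxI (hI hc)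
    rwa [sub_sub_cancel] at this
  have := I.mul_mem_left (algebraMap ℂ _ c⁻¹) h1
  rwa [← map_mul, inv_mul_cancel₀ hc0, map_one] at this

end GLn
end

noncomputable section

/-! ### Separation of central characters -/

namespace GLn

open LieMod

variable {n : ℕ}

theorem gen_comm (i j k l : Fin n) : gen i j * gen k l - gen k l * gen i j =
    (if k = j then gen i l else 0) - (if l = i then gen k j else 0) := by
  rw [gen, gen, ← LieRing.of_associative_ring_bracket, ← LieHom.map_lie]
  have : ⁅(Matrix.single i j 1 : gl n), (Matrix.single k l 1 : gl n)⁆ =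
      (if k = j then Matrix.single i l 1 else 0) - (if l = i then Matrix.single k j 1 else 0) := by
    rw [LieRing.of_associative_ring_bracket]
    congr 1
    · split_ifs with h
      · subst h; simp
      · exact Matrix.single_mul_single_of_ne _ _ _ _ (Ne.symm h) _
    · split_ifs with h
      · subst h; simp
      · exact Matrix.single_mul_single_of_ne _ _ _ _ h _
  rw [this, map_sub]
  split_ifs <;> simp [gen]

/-- The matrix of generators of `U(gl n)`. -/
def genMat (n : ℕ) : Matrix (Fin n) (Fin n) (Env n) := Matrix.of gen

/-- The entries of E^p transform under the adjoint action exactly as those of E. Taking the trace,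
the two Kronecker terms cancel and tr E^p becomes central. -/
theorem gen_comm_pow (p : ℕ) (i j k l : Fin n) :
    gen i j * (genMat n ^ p) k l - (genMat n ^ p) k l * gen i j =
      (if k = j then (genMat n ^ p) i l else 0) - (if l = i then (genMat n ^ p) k j else 0) := by
  induction p generalizing k l with
  | zero =>
    rw [pow_zero]
    have e : (if k = j then if i = l then (1 : Env n) else 0 else 0) =
        if l = i then if k = j then 1 else 0 else 0 := by
      simp only [eq_comm (a := i) (b := l), ← ite_and, and_comm]
    simp only [Matrix.one_apply]
    rw [e, sub_self]
    by_cases h : k = l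
    · rw [if_pos h, mul_one, one_mul, sub_self]
    · rw [if_neg h, mul_zero, zero_mul, sub_self]
  | succ p ih =>
    have e : ∀ k l, (genMat n ^ (p + 1)) k l = ∑ r, (genMat n ^ p) k r * gen r l := fun k l => by
      rw [pow_succ, Matrix.mul_apply]; rfl
    have h : ∀ r, gen i j * ((genMat n ^ p) k r * gen r l) - (genMat n ^ p) k r * gen r l * gen i j =
        ((if k = j then (genMat n ^ p) i r else 0) - (if r = i then (genMat n ^ p) k j else 0)) *
          gen r l + (genMat n ^ p) k r * ((if r = j then gen i l else 0) -
            (if l = i then gen r j else 0)) := by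
      intro r
      rw [← ih, ← gen_comm]
      noncomm_ring
    rw [e, Finset.mul_sum, Finset.sum_mul, ← Finset.sum_sub_distrib, Finset.sum_congr rfl fun r _ => h r]
    simp only [sub_mul, mul_sub, ite_mul, mul_ite, zero_mul, mul_zero, Finset.sum_add_distrib,
      Finset.sum_sub_distrib, Finset.sum_ite_eq', Finset.mem_univ, if_true, Finset.sum_ite_irrel,
      Finset.sum_const_zero, ← e]
    abel

theorem single_sum (x : gl n) : x = ∑ a, ∑ b, x a b • (Matrix.single a b 1 : gl n) := by
  conv_lhs => rw [Matrix.matrix_eq_sum_single x]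
  simp

/-- The central element `tr E^p` of `U(gl n)`. -/
def traceElt (n p : ℕ) : Subalgebra.center ℂ (Env n) := ⟨(genMat n ^ p).trace, by
  have hgen : ∀ i j, gen i j * (genMat n ^ p).trace = (genMat n ^ p).trace * gen i j := by
    intro i j
    rw [← sub_eq_zero, Matrix.trace, Finset.mul_sum, Finset.sum_mul, ← Finset.sum_sub_distrib]
    simp only [Matrix.diag_apply, gen_comm_pow, Finset.sum_sub_distrib, Finset.sum_ite_eq',
      Finset.mem_univ, if_true, sub_self]
  rw [Subalgebra.mem_center_iff]
  intro u
  induction u using env_induction with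
  | halg r => exact Algebra.commutes _ _
  | hι x =>
    rw [single_sum x, map_sum, Finset.sum_mul, Finset.mul_sum]
    refine Finset.sum_congr rfl fun a _ => ?_
    rw [map_sum, Finset.sum_mul, Finset.mul_sum]
    refine Finset.sum_congr rfl fun b _ => ?_
    rw [map_smul, smul_mul_assoc, mul_smul_comm]
    congr 1
    exact hgen a b
  | hmul a b ha hb => rw [mul_assoc, hb, ← mul_assoc, ha, mul_assoc]
  | hadd a b ha hb => rw [add_mul, mul_add, ha, hb]⟩

/-- The eigenvalue of `(E^p)_{kk}` on the highest weight vector of weight `μ - ρ`. -/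
def diagEigen (μ : Fin n → ℂ) : ℕ → Fin n → ℂ
  | 0, _ => 1
  | p + 1, k => (μ k - rho n k) * diagEigen μ p k +
      ∑ r, if k < r then diagEigen μ p k - diagEigen μ p r else 0

theorem gen_smul_vermaGen_lt (μ : Fin n → ℂ) {k l : Fin n} (h : k < l) :
    gen k l • vermaGen n μ = 0 := by
  refine upper_smul_vermaGen μ fun a b hab => ?_
  rw [Matrix.single_apply_of_ne]
  rintro ⟨rfl, rfl⟩
  exact absurd h (not_lt.2 hab)

theorem gen_smul_vermaGen_self (μ : Fin n → ℂ) (k : Fin n) :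
    gen k k • vermaGen n μ = (μ k - rho n k) • vermaGen n μ := by
  have h := diagonal_smul_vermaGen μ (Pi.single k 1)
  rw [Matrix.diagonal_single] at h
  rw [gen, h]
  simp [Pi.single_apply]

/-- In (E^{p+1})_{kl} = ∑_r (E^p)_{kr} E_{rl}, the terms with r < l kill the generator, r = l gives
a weight, and for r > l the commutator can be used because (E^p)_{kr} kills the generator when k <
r. For k = l this is the recursion defining `diagEigen`. -/
theorem genMat_pow_smul_vermaGen (μ : Fin n → ℂ) (p : ℕ) :
    (∀ k l, k < l → (genMat n ^ p) k l • vermaGen n μ = 0) ∧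
    ∀ k, (genMat n ^ p) k k • vermaGen n μ = diagEigen μ p k • vermaGen n μ := by
  induction p with
  | zero =>
    refine ⟨fun k l h => ?_, fun k => ?_⟩
    · rw [pow_zero, Matrix.one_apply_ne h.ne, zero_smul]
    · rw [pow_zero, Matrix.one_apply_eq, one_smul, diagEigen, one_smul]
  | succ p ih =>
    obtain ⟨ih1, ih2⟩ := ih
    have e : ∀ k l, (genMat n ^ (p + 1)) k l • vermaGen n μ =
        ∑ r, ((genMat n ^ p) k r * gen r l) • vermaGen n μ := fun k l => by
      rw [pow_succ, Matrix.mul_apply, Finset.sum_smul]; rfl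
    have h1 : ∀ k r l, r < l → ((genMat n ^ p) k r * gen r l) • vermaGen n μ = 0 := by
      intro k r l h
      rw [mul_smul, gen_smul_vermaGen_lt μ h, smul_zero]
    -- The first two summands on the right cancel; the rest is the commutator of (E^p)_{kr} with
    -- E_{rl}, the reversed product being zero on the generator.
    have h2 : ∀ k r l, k < r → ((genMat n ^ p) k r * gen r l) • vermaGen n μ =
        ((if l = r then (0 : Env n) else (genMat n ^ p) k l) -
          (if l = r then (0 : Env n) else (genMat n ^ p) k l) +
        ((genMat n ^ p) k l - (if k = l then (genMat n ^ p) r r else 0))) • vermaGen n μ := by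
      intro k r l h
      have := gen_comm_pow p r l k r
      rw [if_pos rfl, sub_eq_iff_eq_add] at this
      have h3 : (genMat n ^ p) k r * gen r l = gen r l * (genMat n ^ p) k r +
        ((genMat n ^ p) k l - (if k = l then (genMat n ^ p) r r else 0)) := by
        rw [this]; abel
      rw [h3, sub_self, zero_add, add_smul, mul_smul, ih1 k r h, smul_zero, zero_add]
    refine ⟨fun k l h => ?_, fun k => ?_⟩
    · rw [e]
      refine Finset.sum_eq_zero fun r _ => ?_
      rcases lt_trichotomy r l with hr | rfl | hr
      · exact h1 _ _ _ hr
      · rw [mul_smul, gen_smul_vermaGen_self, ← algebraMap_smul (Env n), smul_smul,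
          ← Algebra.commutes, mul_smul, ih1 k r h, smul_zero]
      · rw [h2 _ _ _ (h.trans hr), sub_self, zero_add, if_neg h.ne, sub_zero, ih1 k l h]
    · rw [e, diagEigen, add_smul, Finset.sum_smul]
      rw [← Finset.add_sum_erase _ _ (Finset.mem_univ k), ← Finset.add_sum_erase _
        (fun r => (if k < r then diagEigen μ p k - diagEigen μ p r else 0) • vermaGen n μ)
        (Finset.mem_univ k), if_neg (lt_irrefl k), zero_smul, zero_add]
      congr 1
      · rw [mul_smul, gen_smul_vermaGen_self, ← algebraMap_smul (Env n), smul_smul,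
          ← Algebra.commutes, mul_smul, ih2 k, algebraMap_smul, smul_smul]
      · refine Finset.sum_congr rfl fun r hr => ?_
        rcases lt_or_gt_of_ne (Finset.ne_of_mem_erase hr) with h | h
        · rw [h1 _ _ _ h, if_neg h.not_gt, zero_smul]
        · rw [h2 _ _ _ h, sub_self, zero_add, if_pos rfl, if_pos h, sub_smul, ih2, ih2, sub_smul]

theorem traceElt_smul_vermaGen (μ : Fin n → ℂ) (p : ℕ) :
    (traceElt n p : Env n) • vermaGen n μ = (∑ k, diagEigen μ p k) • vermaGen n μ := by
  change (∑ k, (genMat n ^ p) k k) • vermaGen n μ = _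
  rw [Finset.sum_smul, Finset.sum_smul]
  exact Finset.sum_congr rfl fun k _ => (genMat_pow_smul_vermaGen μ p).2 k

/-- The difference of tr E^p and its eigenvalue at μ lies in the smaller ideal, hence also acts by
zero at ν, where the generator is not zero. -/
theorem sum_diagEigen_eq {μ ν : Fin n → ℂ} (h : centralIdeal n μ ≤ centralIdeal n ν)
    (hν : centralIdeal n ν ≠ ⊤) (p : ℕ) : ∑ k, diagEigen μ p k = ∑ k, diagEigen ν p k := by
  have h1 : traceElt n p - algebraMap ℂ _ (∑ k, diagEigen μ p k) ∈ centralIdeal n ν := by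
    refine h ((mem_centralIdeal_iff _ _).2 ?_)
    rw [← smul_vermaGen_eq_zero]
    change ((traceElt n p : Env n) - algebraMap ℂ (Env n) (∑ k, diagEigen μ p k)) • vermaGen n μ = 0
    rw [sub_smul, traceElt_smul_vermaGen, algebraMap_smul, sub_self]
  rw [mem_centralIdeal_iff, ← smul_vermaGen_eq_zero] at h1
  change ((traceElt n p : Env n) - algebraMap ℂ (Env n) (∑ k, diagEigen μ p k)) • vermaGen n ν = 0 at h1
  rw [sub_smul, traceElt_smul_vermaGen, algebraMap_smul, ← sub_smul, smul_eq_zero] at h1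
  rcases h1 with h1 | h1
  · exact (sub_eq_zero.1 h1).symm
  · refine absurd ((Ideal.eq_top_iff_one _).2 ((mem_centralIdeal_iff ν 1).2 ?_)) hν
    rw [← smul_vermaGen_eq_zero, h1, smul_zero]

/-! ### Generating functions for the eigenvalues of tr E^p -/

section PowerSeries

open PowerSeries

/-- The weight, shifted so that the characters are symmetric functions of it. -/
def shiftedWeight (μ : Fin n → ℂ) (k : ℕ) : ℂ :=
  if h : k < n then μ ⟨k, h⟩ + ((n : ℂ) - 1) / 2 else 0

/-- The generating function of `diagEigen`. -/
def diagSeries (μ : Fin n → ℂ) (k : ℕ) : PowerSeries ℂ :=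
  PowerSeries.mk fun p => if h : k < n then diagEigen μ p ⟨k, h⟩ else 0

/-- In the recursion for `diagEigen` the k-th term has coefficient μ_k - ρ_k plus the number n - 1 -
k of indices r > k, which is μ_k + (n - 1)/2. -/
theorem diagSeries_eq (μ : Fin n → ℂ) {k : ℕ} (hk : k < n) :
    (1 - PowerSeries.C (shiftedWeight μ k) * X) * diagSeries μ k =
      1 - X * ∑ r ∈ Finset.Ico (k + 1) n, diagSeries μ r := by
  have hsum : ∀ f : Fin n → ℂ, ∑ r, (if (⟨k, hk⟩ : Fin n) < r then f r else 0) =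
      ∑ r ∈ Finset.Ico (k + 1) n, if h : r < n then f ⟨r, h⟩ else 0 := by
    intro f
    have : ∀ r : Fin n, (if (⟨k, hk⟩ : Fin n) < r then f r else 0) =
        (fun r : ℕ => if k < r then (if h : r < n then f ⟨r, h⟩ else 0) else 0) r := by
      intro r
      simp [Fin.lt_def]
    rw [Finset.sum_congr rfl fun r _ => this r, Fin.sum_univ_eq_sum_range
      (fun r : ℕ => if k < r then (if h : r < n then f ⟨r, h⟩ else 0) else 0), ← Finset.sum_filter]
    refine Finset.sum_congr ?_ fun _ _ => rfl
    ext r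
    simp only [Finset.mem_filter, Finset.mem_range, Finset.mem_Ico]
    omega
  ext p
  rw [sub_mul, one_mul, mul_assoc]
  cases p with
  | zero => simp [diagSeries, hk, diagEigen]
  | succ p =>
    rw [map_sub, map_sub, coeff_C_mul, coeff_succ_X_mul, coeff_succ_X_mul, map_sum]
    simp only [diagSeries, coeff_mk, dif_pos hk, coeff_one, Nat.succ_ne_zero, if_false, zero_sub,
      diagEigen, shiftedWeight]
    have e1 : ∑ r : Fin n, (if (⟨k, hk⟩ : Fin n) < r then diagEigen μ p ⟨k, hk⟩ - diagEigen μ p r else 0) =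
        ((n : ℂ) - 1 - k) * diagEigen μ p ⟨k, hk⟩ -
          ∑ r ∈ Finset.Ico (k + 1) n, if h : r < n then diagEigen μ p ⟨r, h⟩ else 0 := by
      rw [hsum, Finset.sum_congr rfl (g := fun r => diagEigen μ p ⟨k, hk⟩ -
        if h : r < n then diagEigen μ p ⟨r, h⟩ else 0), Finset.sum_sub_distrib, Finset.sum_const,
        Nat.card_Ico, nsmul_eq_mul, Nat.cast_sub (by omega)]
      · push_cast; ring
      · intro r hr
        simp [(Finset.mem_Ico.1 hr).2]
    rw [e1, rho]
    ring

/-- Let T_j = 1 - X ∑_{r ≥ j} a_r and let s_j be the shifted weight. By `diagSeries_eq`, (1 - s_j X)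
a_j = T_{j+1}, hence (1 - s_j X) T_j = (1 - (s_j + 1) X) T_{j+1}, and the product telescopes. -/
theorem prod_diagSeries (μ : Fin n → ℂ) {j : ℕ} (hj : j ≤ n) :
    (∏ r ∈ Finset.range j, (1 - PowerSeries.C (shiftedWeight μ r) * X)) *
      (1 - X * ∑ r ∈ Finset.Ico 0 n, diagSeries μ r) =
    (∏ r ∈ Finset.range j, (1 - PowerSeries.C (shiftedWeight μ r + 1) * X)) *
      (1 - X * ∑ r ∈ Finset.Ico j n, diagSeries μ r) := by
  induction j with
  | zero => simp
  | succ j ih =>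
    rw [Finset.prod_range_succ, Finset.prod_range_succ, mul_right_comm, ih (by omega)]
    have h := diagSeries_eq μ (show j < n by omega)
    rw [Finset.sum_eq_sum_Ico_succ_bot (by omega : j < n)]
    have h2 : (PowerSeries.C (shiftedWeight μ j + 1) : PowerSeries ℂ) = PowerSeries.C (shiftedWeight μ j) + 1 := by simp
    rw [h2]
    linear_combination (-(∏ r ∈ Finset.range j, (1 - PowerSeries.C (shiftedWeight μ r + 1) * X)) * X) * h

end PowerSeries

/-- For j = n the telescoped identity expresses the generating function of the traces as a quotient
of two products. Equal traces give equal quotients, cross-multiplied here. -/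
theorem prod_shiftedWeight_eq {μ ν : Fin n → ℂ}
    (h : ∀ p, ∑ k, diagEigen μ p k = ∑ k, diagEigen ν p k) :
    (∏ r ∈ Finset.range n, (1 - Polynomial.C (shiftedWeight μ r) * Polynomial.X)) *
      (∏ r ∈ Finset.range n, (1 - Polynomial.C (shiftedWeight ν r + 1) * Polynomial.X)) =
    (∏ r ∈ Finset.range n, (1 - Polynomial.C (shiftedWeight ν r) * Polynomial.X)) *
      (∏ r ∈ Finset.range n, (1 - Polynomial.C (shiftedWeight μ r + 1) * Polynomial.X)) := by
  have hs : ∑ r ∈ Finset.Ico 0 n, diagSeries μ r = ∑ r ∈ Finset.Ico 0 n, diagSeries ν r := by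
    ext p
    rw [map_sum, map_sum]
    simp only [diagSeries, PowerSeries.coeff_mk, Nat.Ico_zero_eq_range]
    rw [Finset.sum_range, Finset.sum_range]
    simpa using h p
  have h1 := prod_diagSeries μ (le_refl n)
  have h2 := prod_diagSeries ν (le_refl n)
  rw [hs] at h1
  simp only [Finset.Ico_self, Finset.sum_empty, mul_zero, sub_zero, mul_one] at h1 h2
  have hco : ∀ f : ℕ → ℂ, ((∏ r ∈ Finset.range n, (1 - Polynomial.C (f r) * Polynomial.X) :
      Polynomial ℂ) : PowerSeries ℂ) =
      ∏ r ∈ Finset.range n, (1 - PowerSeries.C (f r) * PowerSeries.X) := by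
    intro f
    rw [← Polynomial.coeToPowerSeries.ringHom_apply, map_prod]
    simp
  rw [← Polynomial.coe_inj, Polynomial.coe_mul, Polynomial.coe_mul, hco, hco, hco, hco, ← h1, ← h2]
  ring

/-- The difference of multiplicities is invariant under s ↦ s - 1 and has finite support, so it
vanishes. -/
theorem multiset_eq_of_shift {A B : Multiset ℂ} (h : A + B.map (· + 1) = B + A.map (· + 1)) :
    A = B := by
  have hc : ∀ (M : Multiset ℂ) s, (M.map (· + 1)).count s = M.count (s - 1) := by
    intro M s
    conv_lhs => rw [← sub_add_cancel s 1]
    exact Multiset.count_map_eq_count' _ _ (add_left_injective 1) _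
  have hd : ∀ s, (A.count s : ℤ) - B.count s = A.count (s - 1) - B.count (s - 1) := by
    intro s
    have := congrArg (Multiset.count s) h
    rw [Multiset.count_add, Multiset.count_add, hc, hc] at this
    omega
  have hd' : ∀ (k : ℕ) s, (A.count s : ℤ) - B.count s = A.count (s - k) - B.count (s - k) := by
    intro k
    induction k with
    | zero => simp
    | succ k ih => intro s; rw [ih, hd, Nat.cast_succ, sub_sub]
  ext s
  have hinf : (Set.range fun k : ℕ => s - (k : ℂ)).Infinite :=
    Set.infinite_range_of_injective fun a b hab => by simpa using hab
  obtain ⟨_, ⟨k, rfl⟩, hk⟩ := hinf.exists_notMem_finset (A.toFinset ∪ B.toFinset)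
  simp only [Finset.mem_union, Multiset.mem_toFinset, not_or] at hk
  have := hd' k s
  rw [Multiset.count_eq_zero_of_notMem hk.1, Multiset.count_eq_zero_of_notMem hk.2] at this
  omega

/-- The central character determines the weight up to permutation. -/
theorem weight_eq_of_centralIdeal_le {μ ν : Fin n → ℂ} (h : centralIdeal n μ ≤ centralIdeal n ν)
    (hν : centralIdeal n ν ≠ ⊤) :
    Multiset.map μ Finset.univ.val = Multiset.map ν Finset.univ.val := by
  have h1 := prod_shiftedWeight_eq (sum_diagEigen_eq h hν)
  set A := Multiset.map (shiftedWeight μ) (Finset.range n).val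
  set B := Multiset.map (shiftedWeight ν) (Finset.range n).val
  have hAB : A = B := by
    refine multiset_eq_of_shift ?_
    -- Evaluating at 1/s and clearing denominators turns each factor 1 - aX into s - a, so that the
    -- products become monic polynomials whose roots can be compared.
    have hp : ∀ f : ℕ → ℂ, ∀ s : ℂ, s ≠ 0 → s ^ n * (∏ r ∈ Finset.range n,
        (1 - Polynomial.C (f r) * Polynomial.X)).eval s⁻¹ =
        ((Multiset.map (fun a => Polynomial.X - Polynomial.C a)
          (Multiset.map f (Finset.range n).val)).prod).eval s := by
      intro f s hs
      rw [Multiset.map_map]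
      change _ = Polynomial.eval s (∏ r ∈ Finset.range n, _)
      rw [Polynomial.eval_prod, Polynomial.eval_prod]
      conv_lhs => rw [← Finset.card_range n, ← Finset.prod_const, Finset.card_range,
        ← Finset.prod_mul_distrib]
      refine Finset.prod_congr rfl fun r _ => ?_
      simp only [Polynomial.eval_sub, Polynomial.eval_one, Polynomial.eval_mul, Polynomial.eval_C,
        Polynomial.eval_X, Function.comp_apply]
      field_simp
    have hA' : A.map (· + 1) = Multiset.map (fun r => shiftedWeight μ r + 1) (Finset.range n).val :=
      Multiset.map_map _ _ _
    have hB' : B.map (· + 1) = Multiset.map (fun r => shiftedWeight ν r + 1) (Finset.range n).val :=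
      Multiset.map_map _ _ _
    have hpoly : (Multiset.map (fun a => Polynomial.X - Polynomial.C a) (A + B.map (· + 1))).prod =
        (Multiset.map (fun a => Polynomial.X - Polynomial.C a) (B + A.map (· + 1))).prod := by
      refine Polynomial.eq_of_infinite_eval_eq _ _
        (((Set.finite_singleton (0 : ℂ)).infinite_compl).mono fun s hs => ?_)
      have hs : s ≠ 0 := hs
      have h2 := congrArg (fun P => s ^ n * s ^ n * Polynomial.eval s⁻¹ P) h1
      simp only [Polynomial.eval_mul] at h2
      change Polynomial.eval s _ = Polynomial.eval s _
      rw [Multiset.map_add, Multiset.map_add, Multiset.prod_add, Multiset.prod_add,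
        Polynomial.eval_mul, Polynomial.eval_mul, hA', hB', ← hp _ s hs, ← hp _ s hs, ← hp _ s hs,
        ← hp _ s hs]
      linear_combination h2
    rw [← Polynomial.roots_multiset_prod_X_sub_C (A + _), hpoly,
      Polynomial.roots_multiset_prod_X_sub_C]
  have hm : ∀ μ : Fin n → ℂ, Multiset.map μ Finset.univ.val =
      (Multiset.map (shiftedWeight μ) (Finset.range n).val).map (· - ((n : ℂ) - 1) / 2) := by
    intro μ
    rw [Multiset.map_map, ← Nat.Iio_eq_range, ← Fin.map_valEmbedding_univ, Finset.map_val, Multiset.map_map]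
    refine Multiset.map_congr rfl fun k _ => ?_
    simp [shiftedWeight]
  rw [hm μ, hm ν]
  exact congrArg (Multiset.map _) hAB

end GLn
end

noncomputable section

/-! ### Singular vectors -/

namespace GLn

open LieMod

variable {n m : ℕ} {M : LieMod.{u} (gl n)}

theorem act_mem (N : LieSubmodule ℂ (gl n) M) (u : Env n) {v : M} (hv : v ∈ N) :
    act M u v ∈ N := by
  induction u using env_induction generalizing v with
  | halg r =>
    rw [AlgHom.commutes]
    exact N.toSubmodule.smul_mem r hv
  | hι x => rw [act_ι]; exact N.lie_mem hv
  | hmul a b ha hb => rw [map_mul]; exact ha (hb hv)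
  | hadd a b ha hb => rw [map_add]; exact add_mem (ha hv) (hb hv)

theorem act_center_lie (z : Subalgebra.center ℂ (Env n)) (x : gl n) (v : M) :
    act M (z : Env n) ⁅x, v⁆ = ⁅x, act M (z : Env n) v⁆ := by
  rw [← act_ι, ← act_ι, ← Module.End.mul_apply, ← Module.End.mul_apply, ← map_mul, ← map_mul,
    Subalgebra.mem_center_iff.1 z.2]

/-- The vectors which a central element maps into a submodule. -/
def centralComap (z : Subalgebra.center ℂ (Env n)) (N : LieSubmodule ℂ (gl n) M) :
    LieSubmodule ℂ (gl n) M :=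
  { N.toSubmodule.comap (act M (z : Env n)) with
    lie_mem := fun {x v} (hv : act M (z : Env n) v ∈ N) => by
      change act M (z : Env n) ⁅x, v⁆ ∈ N
      rw [act_center_lie]
      exact N.lie_mem hv }

theorem mem_centralComap {z : Subalgebra.center ℂ (Env n)} {N : LieSubmodule ℂ (gl n) M} {v : M} :
    v ∈ centralComap z N ↔ act M (z : Env n) v ∈ N := Iff.rfl

/-- `v` is a weight vector of weight `μ - ρ` which is annihilated by `𝔫₊` modulo the submodule `N`. -/
structure IsSingular (N : LieSubmodule ℂ (gl n) M) (μ : Fin n → ℂ) (v : M) : Prop where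
  weight : v ∈ weightSpace M (fun k => μ k - rho n k)
  upper : ∀ x : gl n, IsStrictUpper x → ⁅x, v⁆ ∈ N

/-- Modulo N a singular vector is an image of the generator of the Verma module. -/
theorem IsSingular.act_mem {N : LieSubmodule ℂ (gl n) M} {μ : Fin n → ℂ} {v : M}
    (h : IsSingular N μ v) {u : Env n} (hu : u ∈ vermaIdeal n μ) : act M u v ∈ N := by
  induction hu using Submodule.span_induction with
  | mem u hu =>
    rcases hu with ⟨x, hx, rfl⟩ | ⟨d, rfl⟩
    · rw [act_ι]; exact h.upper x hx
    · rw [map_sub, LinearMap.sub_apply, act_ι, h.weight d, AlgHom.commutes]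
      exact (sub_self ((∑ k, d k * (μ k - rho n k)) • v)) ▸ zero_mem N
  | zero => rw [map_zero]; exact zero_mem N
  | add a b _ _ ha hb => rw [map_add]; exact add_mem ha hb
  | smul a b _ hb =>
    rw [smul_eq_mul, map_mul]
    exact GLn.act_mem N a hb

/-- A central element acts on v modulo N by the same scalar as on the Verma generator, and the
scalar is visible because v is not in N. So any singular vector reveals the central character of its
weight. -/
theorem IsSingular.mem_centralIdeal_iff {N : LieSubmodule ℂ (gl n) M} {μ : Fin n → ℂ} {v : M}
    (h : IsSingular N μ v) (hv : v ∉ N) (z : Subalgebra.center ℂ (Env n)) :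
    z ∈ centralIdeal n μ ↔ act M (z : Env n) v ∈ N := by
  rw [GLn.mem_centralIdeal_iff]
  refine ⟨h.act_mem, fun hz => ?_⟩
  obtain ⟨c, hc⟩ := exists_central_character μ z
  have h1 := sub_mem hz (h.act_mem hc)
  rw [map_sub, LinearMap.sub_apply, sub_sub_cancel, AlgHom.commutes] at h1
  have h1 : c • v ∈ N := h1
  by_cases hc0 : c = 0
  · rwa [hc0, map_zero, sub_zero] at hc
  · refine absurd ?_ hv
    have := N.toSubmodule.smul_mem c⁻¹ h1
    rwa [smul_smul, inv_mul_cancel₀ hc0, one_smul] at this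

theorem IsSingular.centralIdeal_ne_top {N : LieSubmodule ℂ (gl n) M} {μ : Fin n → ℂ} {v : M}
    (h : IsSingular N μ v) (hv : v ∉ N) : centralIdeal n μ ≠ ⊤ := by
  intro ht
  have := (h.mem_centralIdeal_iff hv 1).1 (ht ▸ Submodule.mem_top)
  rw [OneMemClass.coe_one, map_one] at this
  exact hv this

theorem lie_diagonal_single (d : Fin n → ℂ) (a b : Fin n) :
    ⁅(Matrix.diagonal d : gl n), (Matrix.single a b 1 : gl n)⁆ =
      (d a - d b) • (Matrix.single a b 1 : gl n) := by
  refine Matrix.ext fun k l => ?_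
  rw [lie_single_apply, Matrix.diagonal_apply, Matrix.diagonal_apply, Matrix.smul_apply,
    Matrix.single_apply]
  by_cases hk : k = a <;> by_cases hl : l = b
  · subst hk hl; simp
  · simp [hl, Ne.symm hl]
  · simp [hk, Ne.symm hk]
  · simp [hk, hl, Ne.symm hk]

theorem lie_single_mem_weightSpace {μ : Fin n → ℂ} {v : M} (hv : v ∈ weightSpace M μ)
    (a b : Fin n) : ⁅(Matrix.single a b 1 : gl n), v⁆ ∈
      weightSpace M (μ + (Pi.single a 1 - Pi.single b 1)) := by
  intro d
  have e : ∑ k, d k * (μ + (Pi.single a 1 - Pi.single b 1) : Fin n → ℂ) k =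
      (d a - d b) + ∑ k, d k * μ k := by
    simp only [Pi.add_apply, Pi.sub_apply, mul_add, mul_sub, Finset.sum_add_distrib,
      Finset.sum_sub_distrib, Pi.single_apply, mul_ite, mul_one, mul_zero, Finset.sum_ite_eq',
      Finset.mem_univ, if_true]
    ring
  rw [leibniz_lie, lie_diagonal_single, smul_lie, hv d, lie_smul, ← add_smul, e]

theorem mem_of_lie_single (N : Submodule ℂ M) (v : M)
    (h : ∀ a b : Fin n, a < b → ⁅(Matrix.single a b 1 : gl n), v⁆ ∈ N) {x : gl n}
    (hx : IsStrictUpper x) : ⁅x, v⁆ ∈ N := by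
  rw [Matrix.matrix_eq_sum_single x, sum_lie]
  refine sum_mem fun a _ => ?_
  rw [sum_lie]
  refine sum_mem fun b _ => ?_
  rcases lt_or_ge a b with hab | hab
  · rw [← mul_one (x a b), ← smul_eq_mul, ← Matrix.smul_single, smul_lie]
    exact N.smul_mem _ (h a b hab)
  · rw [hx a b hab, Matrix.single_zero, zero_lie]
    exact zero_mem N

theorem lie_single_single (a b k l : Fin n) :
    ⁅(Matrix.single a b 1 : gl n), (Matrix.single l k 1 : gl n)⁆ =
      (if l = b then Matrix.single a k 1 else 0) - (if k = a then Matrix.single l b 1 else 0) := by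
  rw [LieRing.of_associative_ring_bracket]
  congr 1
  · split_ifs with h
    · subst h; simp
    · exact Matrix.single_mul_single_of_ne _ _ _ _ (Ne.symm h) _
  · split_ifs with h
    · subst h; simp
    · exact Matrix.single_mul_single_of_ne _ _ _ _ h _

theorem isStrictUpper_single {a b : Fin n} (h : a < b) :
    IsStrictUpper (Matrix.single a b 1 : gl n) := by
  intro k l hkl
  refine Matrix.single_apply_of_ne _ _ _ _ _ ?_
  rintro ⟨rfl, rfl⟩
  exact absurd h (not_lt.2 hkl)

/-- A simple root vector maps a singular vector to a singular one if the weight is orthogonal to the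
root. -/
theorem IsSingular.lower {μ : Fin n → ℂ} {v : M} (h : IsSingular (⊥ : LieSubmodule ℂ (gl n) M) μ v)
    {k l : Fin n} (hkl : (l : ℕ) = k + 1) (hμ : μ k - μ l = 1) :
    IsSingular (⊥ : LieSubmodule ℂ (gl n) M) (μ ∘ Equiv.swap k l)
      ⁅(Matrix.single l k 1 : gl n), v⁆ := by
  have hlt : k < l := Fin.lt_def.2 (by omega)
  refine ⟨?_, fun x hx => mem_of_lie_single (⊥ : LieSubmodule ℂ (gl n) M).toSubmodule _
    (fun a b hab => ?_) hx⟩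
  · have := lie_single_mem_weightSpace h.weight l k
    convert this using 2
    ext r
    simp only [Function.comp_apply, Pi.add_apply, Pi.sub_apply, Pi.single_apply]
    by_cases h1 : r = k
    · subst h1
      rw [Equiv.swap_apply_left, if_neg hlt.ne, if_pos rfl]
      linear_combination -hμ
    · by_cases h2 : r = l
      · subst h2
        rw [Equiv.swap_apply_right, if_neg h1, if_pos rfl]
        linear_combination hμ
      · rw [Equiv.swap_apply_of_ne_of_ne h1 h2, if_neg h1, if_neg h2]
        ring
  · have hu : ∀ a b : Fin n, a < b → ⁅(Matrix.single a b 1 : gl n), v⁆ = 0 := fun a b hab =>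
      (LieSubmodule.mem_bot _).1 (h.upper _ (isStrictUpper_single hab))
    change _ ∈ (⊥ : LieSubmodule ℂ (gl n) M)
    rw [LieSubmodule.mem_bot, leibniz_lie, hu a b hab, lie_zero, add_zero, lie_single_single, sub_lie]
    -- For the simple root itself the bracket is the coroot, which acts by μ_k - μ_l - 1 = 0. In the
    -- mixed cases it is, up to sign, another strictly upper matrix unit because k and l are
    -- adjacent; otherwise it is zero.
    by_cases h1 : l = b <;> by_cases h2 : k = a
    · subst h1 h2
      have hw := h.weight (Pi.single k 1 - Pi.single l 1)
      rw [if_pos rfl, if_pos rfl, ← sub_lie]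
      have e : (Matrix.single k k 1 - Matrix.single l l 1 : gl n) =
          Matrix.diagonal (Pi.single k 1 - Pi.single l 1) := by
        rw [← Matrix.diagonal_single, ← Matrix.diagonal_single, Matrix.diagonal_sub]
        rfl
      rw [e, hw]
      have : ∑ r, (Pi.single k 1 - Pi.single l 1 : Fin n → ℂ) r * (μ r - rho n r) = 0 := by
        simp only [Pi.sub_apply, sub_mul, Pi.single_apply, ite_mul, one_mul, zero_mul,
          Finset.sum_sub_distrib, Finset.sum_ite_eq', Finset.mem_univ, if_true, rho, hkl]
        push_cast
        linear_combination hμ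
      rw [this, zero_smul]
    · rw [if_pos h1, if_neg h2, zero_lie, sub_zero]
      refine hu _ _ (lt_of_le_of_ne (Fin.le_def.2 ?_) (Ne.symm h2))
      have := Fin.lt_def.1 (h1 ▸ hab : a < l)
      omega
    · rw [if_neg h1, if_pos h2, zero_lie, zero_sub, hu, neg_zero]
      refine lt_of_le_of_ne (Fin.le_def.2 ?_) h1
      have := Fin.lt_def.1 (h2 ▸ hab : k < b)
      omega
    · rw [if_neg h1, if_neg h2, zero_lie, sub_zero]

/-- The vector v and its image are nonzero and singular for the two weights, and a central element
acts on both by the same scalar. -/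
theorem centralIdeal_swap_of_lower {μ : Fin n → ℂ} {v : M}
    (h : IsSingular (⊥ : LieSubmodule ℂ (gl n) M) μ v) {k l : Fin n} (hkl : (l : ℕ) = k + 1)
    (hμ : μ k - μ l = 1) (hv : ⁅(Matrix.single l k 1 : gl n), v⁆ ≠ 0) :
    centralIdeal n (μ ∘ Equiv.swap k l) = centralIdeal n μ := by
  have hv0 : v ∉ (⊥ : LieSubmodule ℂ (gl n) M) := fun h0 => hv (by
    rw [(LieSubmodule.mem_bot _).1 h0, lie_zero])
  ext z
  rw [(h.lower hkl hμ).mem_centralIdeal_iff (fun h => hv ((LieSubmodule.mem_bot _).1 h)),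
    LieSubmodule.mem_bot, act_center_lie]
  constructor
  · intro hz
    obtain ⟨c, hc⟩ := exists_central_character μ z
    have h1 := h.act_mem hc
    rw [LieSubmodule.mem_bot, map_sub, LinearMap.sub_apply, sub_eq_zero, AlgHom.commutes] at h1
    have h1 : act M (z : Env n) v = c • v := h1
    rw [h1, lie_smul, smul_eq_zero] at hz
    rw [GLn.mem_centralIdeal_iff]
    rwa [hz.resolve_right hv, map_zero, sub_zero] at hc
  · intro hz
    have := (h.mem_centralIdeal_iff hv0 z).1 hz
    rw [(LieSubmodule.mem_bot _).1 this, lie_zero]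

/-! ### Singular vectors in induced modules -/

section Induced

variable {N : LieMod.{u} (gl m)}

theorem mkC_mem_weightSpace {μ : Fin n → ℂ} {ν : Fin m → ℂ} {v : M} {w : N}
    (hv : v ∈ weightSpace M μ) (hw : w ∈ weightSpace N ν) :
    mkC n m v w ∈ weightSpace ((C n m).obj (M, N))
      (Fin.append (fun k => μ k - (m : ℂ) / 2) (fun k => ν k + (n : ℂ) / 2)) := by
  intro d
  have hd : (Matrix.diagonal d : gl (n + m)) ∈ parabolic n m := fun b a =>
    Matrix.diagonal_apply_ne _ (castAdd_ne_natAdd a b).symm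
  have e1 : (Matrix.diagonal d : gl (n + m)).submatrix (Fin.castAdd m) (Fin.castAdd m) =
      Matrix.diagonal fun a => d (Fin.castAdd m a) :=
    Matrix.submatrix_diagonal _ _ (Fin.castAdd_injective n m)
  have e2 : (Matrix.diagonal d : gl (n + m)).submatrix (Fin.natAdd n) (Fin.natAdd n) =
      Matrix.diagonal fun b => d (Fin.natAdd n b) :=
    Matrix.submatrix_diagonal _ _ (Fin.natAdd_injective m n)
  rw [lie_mkC _ hd, shiftChar, e1, e2, hv, hw]
  change _ + mkCLin M N _ w + mkCLin M N v _ = _ • mkCLin M N v w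
  rw [map_smul, LinearMap.smul_apply, map_smul]
  change _ • mkCLin M N v w + _ + _ = _
  rw [← add_smul, ← add_smul]
  congr 1
  simp only [Fin.sum_univ_add, Fin.append_left, Fin.append_right, mul_add, mul_sub,
    Finset.sum_add_distrib, Finset.sum_sub_distrib, Matrix.trace_diagonal, ← Finset.sum_mul]
  ring

/-- Strictly upper triangular matrices belong to the parabolic subalgebra and have diagonal blocks
of trace zero, so the character of `shift` contributes nothing. -/
theorem strictUpper_mkC {x : gl (n + m)} (hx : IsStrictUpper x) (v : M) (w : N) :
    ∃ (x₁ : gl n) (x₂ : gl m), IsStrictUpper x₁ ∧ IsStrictUpper x₂ ∧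
      ⁅x, mkC n m v w⁆ = mkC n m ⁅x₁, v⁆ w + mkC n m v ⁅x₂, w⁆ := by
  have h1 : IsStrictUpper (x.submatrix (Fin.castAdd m) (Fin.castAdd m) : gl n) :=
    fun a b h => hx _ _ (Fin.le_def.2 (Fin.le_def.1 h))
  have h2 : IsStrictUpper (x.submatrix (Fin.natAdd n) (Fin.natAdd n) : gl m) :=
    fun a b h => hx _ _ (Fin.le_def.2 (Nat.add_le_add_left (Fin.le_def.1 h) n))
  refine ⟨_, _, h1, h2, ?_⟩
  rw [lie_mkC x (fun b a => hx _ _ (Fin.le_def.2 ?_)) v w, shiftChar, Matrix.trace, Matrix.trace,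
    Finset.sum_eq_zero (f := Matrix.diag (x.submatrix (Fin.castAdd m) (Fin.castAdd m)))
      fun k _ => h1 k k le_rfl,
    Finset.sum_eq_zero (f := Matrix.diag (x.submatrix (Fin.natAdd n) (Fin.natAdd n)))
      fun k _ => h2 k k le_rfl, mul_zero, mul_zero, add_zero, zero_smul, zero_add]
  simp only [Fin.val_castAdd, Fin.val_natAdd]
  omega

/-- This is the purpose of the twist Y: ρ_{n+m} exceeds (ρ_n, ρ_m) by m/2 on the first block and by
-n/2 on the second. -/
theorem append_sub_rho (μ : Fin n → ℂ) (ν : Fin m → ℂ) :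
    (fun k => Fin.append μ ν k - rho (n + m) k) =
      Fin.append (fun k => μ k - rho n k - (m : ℂ) / 2) (fun k => ν k - rho m k + (n : ℂ) / 2) := by
  ext k
  refine Fin.addCases (fun a => ?_) (fun b => ?_) k
  · simp only [Fin.append_left, rho, Fin.val_castAdd]
    push_cast; ring
  · simp only [Fin.append_right, rho, Fin.val_natAdd]
    push_cast; ring

theorem isSingular_mkC {μ : Fin n → ℂ} {ν : Fin m → ℂ} {v : M} {w : N}
    (hv : IsSingular (⊥ : LieSubmodule ℂ (gl n) M) μ v)
    (hw : IsSingular (⊥ : LieSubmodule ℂ (gl m) N) ν w) :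
    IsSingular (⊥ : LieSubmodule ℂ (gl (n + m)) ((C n m).obj (M, N))) (Fin.append μ ν)
      (mkC n m v w) := by
  refine ⟨?_, fun x hx => ?_⟩
  · rw [append_sub_rho]
    exact mkC_mem_weightSpace hv.weight hw.weight
  · obtain ⟨x₁, x₂, h1, h2, e⟩ := strictUpper_mkC hx v w
    rw [e, (LieSubmodule.mem_bot _).1 (hv.upper x₁ h1), (LieSubmodule.mem_bot _).1 (hw.upper x₂ h2)]
    change mkCLin M N 0 w + mkCLin M N v 0 ∈ _
    rw [map_zero, map_zero, LinearMap.zero_apply, add_zero]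
    exact zero_mem _

theorem tmul_ne_zero_of_ne_zero {V W : Type*} [AddCommGroup V] [Module ℂ V] [AddCommGroup W]
    [Module ℂ W] {v : V} {w : W} (hv : v ≠ 0) (hw : w ≠ 0) : v ⊗ₜ[ℂ] w ≠ 0 := by
  obtain ⟨f, hf⟩ := not_forall.1 (mt (Module.forall_dual_apply_eq_zero_iff ℂ v).1 hv)
  obtain ⟨g, hg⟩ := not_forall.1 (mt (Module.forall_dual_apply_eq_zero_iff ℂ w).1 hw)
  intro h
  have := congrArg (LinearMap.mul' ℂ ℂ ∘ₗ TensorProduct.map f g) h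
  rw [map_zero, LinearMap.comp_apply, TensorProduct.map_tmul, LinearMap.mul'_apply] at this
  exact mul_ne_zero hf hg this

/-- In the polynomial model this element is a pure tensor of nonzero vectors. The cases f = 1 and f
a variable are used. -/
theorem toIndAux_mkC₀_ne_zero {f : MvPolynomial (Fin m × Fin n) ℂ} (hf : f ≠ 0) {v : M} {w : N}
    (hv : v ≠ 0) (hw : w ≠ 0) :
    (parabolicComplement n m).toIndAux ((C₀ n m).obj (M, N)) (f ⊗ₜ mkC₀ v w) ≠ 0 := by
  have h0 : (mkC₀ v w : (C₀ n m).obj (M, N)) ≠ 0 := by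
    rw [← mkC₀Equiv_tmul]
    refine (mkC₀Equiv M N).map_ne_zero_iff.2 ?_
    exact tmul_ne_zero_of_ne_zero hv hw
  refine ((parabolicComplement n m).indEquiv ((C₀ n m).obj (M, N))).map_ne_zero_iff.2 ?_
  exact tmul_ne_zero_of_ne_zero hf h0

theorem mkC_ne_zero {v : M} {w : N} (hv : v ≠ 0) (hw : w ≠ 0) : mkC n m v w ≠ 0 := by
  have := toIndAux_mkC₀_ne_zero (n := n) (m := m) one_ne_zero hv hw
  rwa [AbelianComplement.toIndAux_tmul, map_one, map_one, Module.End.one_apply] at this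

theorem lie_mkC_ne_zero {v : M} {w : N} (hv : v ≠ 0) (hw : w ≠ 0) (a : Fin n) (b : Fin m) :
    ⁅(Matrix.single (Fin.natAdd n b) (Fin.castAdd m a) 1 : gl (n + m)), mkC n m v w⁆ ≠ 0 := by
  have := toIndAux_mkC₀_ne_zero (n := n) (m := m) (MvPolynomial.X_ne_zero (b, a)) hv hw
  rwa [AbelianComplement.toIndAux_tmul, AbelianComplement.polyHom_X, act_ι] at this

end Induced

/-- Split off the last coordinate and induce from gl_n ⊕ gl_1, where gl_1 acts by a character; the
induced vector is nonzero by the polynomial model. -/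
theorem exists_singular (n : ℕ) (μ : Fin n → ℂ) : ∃ (M : LieMod.{0} (gl n)) (v : M), v ≠ 0 ∧
    IsSingular (⊥ : LieSubmodule ℂ (gl n) M) μ v := by
  have hχ : ∀ (r : ℕ) (c : ℂ) (x y : gl r), (c • Matrix.traceLinearMap (Fin r) ℂ ℂ) ⁅x, y⁆ = 0 := by
    intro r c x y
    rw [LinearMap.smul_apply, Matrix.traceLinearMap_apply, LieRing.of_associative_ring_bracket,
      Matrix.trace_sub, Matrix.trace_mul_comm, sub_self, smul_zero]
  induction n with
  | zero =>
    refine ⟨ofCharacter _ (hχ 0 0), (1 : ℂ), one_ne_zero (α := ℂ), fun d => ?_, fun x hx => ?_⟩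
    · change ((0 : ℂ) • Matrix.traceLinearMap (Fin 0) ℂ ℂ) _ * 1 = (∑ k, d k * _) * (1 : ℂ)
      simp
    · change ((0 : ℂ) • Matrix.traceLinearMap (Fin 0) ℂ ℂ) x * 1 = (0 : ℂ)
      simp
  | succ n ih =>
    obtain ⟨M, v, hv, hs⟩ := ih fun k => μ (Fin.castAdd 1 k)
    let N : LieMod.{0} (gl 1) := ofCharacter _ (hχ 1 (μ (Fin.natAdd n 0) - rho 1 0))
    let w : N := (1 : ℂ)
    have hw : w ≠ 0 := one_ne_zero (α := ℂ)
    have hw' : IsSingular (⊥ : LieSubmodule ℂ (gl 1) N) (fun k => μ (Fin.natAdd n k)) w := by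
      refine ⟨fun d => ?_, fun x hx => ?_⟩
      · change ((μ (Fin.natAdd n 0) - rho 1 0) • Matrix.traceLinearMap (Fin 1) ℂ ℂ)
          (Matrix.diagonal d) * 1 = (∑ k, d k * (μ (Fin.natAdd n k) - rho 1 k)) * (1 : ℂ)
        simp [mul_comm]
      · change ((μ (Fin.natAdd n 0) - rho 1 0) • Matrix.traceLinearMap (Fin 1) ℂ ℂ) x * 1 = (0 : ℂ)
        simp [Matrix.trace, hx 0 0 le_rfl]
    refine ⟨_, mkC n 1 v w, mkC_ne_zero hv hw, ?_⟩
    have := isSingular_mkC hs hw'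
    rwa [Fin.append_castAdd_natAdd] at this

/-- Cut the weight between the positions k and l and induce. The simple root vector E_{lk} then
belongs to the lower left block, where it acts as a variable of the model and does not kill the
singular vector. -/
theorem centralIdeal_swap {μ : Fin n → ℂ} {k l : Fin n} (hkl : (l : ℕ) = k + 1)
    (hμ : μ k - μ l = 1) : centralIdeal n (μ ∘ Equiv.swap k l) = centralIdeal n μ := by
  obtain ⟨r, hr⟩ : ∃ r, n = (k + 1) + (r + 1) := ⟨n - (k + 2), by omega⟩
  obtain ⟨k, hk⟩ := k
  obtain ⟨l, hl⟩ := l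
  simp only at hkl hr
  subst hr hkl
  obtain ⟨M, v, hv, hs⟩ := exists_singular (k + 1) fun i => μ (Fin.castAdd (r + 1) i)
  obtain ⟨N, w, hw, ht⟩ := exists_singular (r + 1) fun i => μ (Fin.natAdd (k + 1) i)
  have h := isSingular_mkC hs ht
  rw [Fin.append_castAdd_natAdd] at h
  refine centralIdeal_swap_of_lower h rfl hμ ?_
  exact lie_mkC_ne_zero hv hw (Fin.last k) 0

/-- The weights that are obtained from `e₁ + ⋯ + e_c` by permuting the coordinates. -/
def IsZeroOne (c : ℤ) (μ : Fin n → ℂ) : Prop := (∀ k, μ k = 0 ∨ μ k = 1) ∧ ∑ k, μ k = c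

theorem multiset_zeroOne {A : Multiset ℂ} (h : ∀ a ∈ A, a = 0 ∨ a = 1) :
    A.sum = A.count 1 ∧ A.card = A.count 0 + A.count 1 := by
  induction A using Multiset.induction_on with
  | empty => simp
  | cons a A ih =>
    obtain ⟨h1, h2⟩ := ih fun b hb => h b (Multiset.mem_cons_of_mem hb)
    rw [Multiset.sum_cons, Multiset.card_cons, h1, h2]
    rcases h a (Multiset.mem_cons_self a A) with rfl | rfl
    · simp [add_right_comm]
    · simp [add_assoc, add_comm]

/-- The number of ones is the sum c and the number of zeros is n - c. -/
theorem IsZeroOne.map_eq {c : ℤ} {μ ν : Fin n → ℂ} (hμ : IsZeroOne c μ) (hν : IsZeroOne c ν) :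
    Multiset.map μ Finset.univ.val = Multiset.map ν Finset.univ.val := by
  have key : ∀ {μ : Fin n → ℂ}, IsZeroOne c μ → ∀ a ∈ Multiset.map μ Finset.univ.val, a = 0 ∨ a = 1 := by
    intro μ h a ha
    obtain ⟨k, _, rfl⟩ := Multiset.mem_map.1 ha
    exact h.1 k
  obtain ⟨h1, h2⟩ := multiset_zeroOne (key hμ)
  obtain ⟨h3, h4⟩ := multiset_zeroOne (key hν)
  have h5 : Multiset.count 1 (Multiset.map μ Finset.univ.val) =
      Multiset.count 1 (Multiset.map ν Finset.univ.val) := by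
    have e1 : (Multiset.map μ Finset.univ.val).sum = (c : ℂ) := hμ.2
    have e2 : (Multiset.map ν Finset.univ.val).sum = (c : ℂ) := hν.2
    rw [e1] at h1
    rw [e2, h1] at h3
    exact_mod_cast h3
  rw [Multiset.card_map] at h2 h4
  ext a
  by_cases ha : a = 0 ∨ a = 1
  · rcases ha with rfl | rfl
    · omega
    · exact h5
  · rw [Multiset.count_eq_zero_of_notMem fun h => ha (key hμ a h),
      Multiset.count_eq_zero_of_notMem fun h => ha (key hν a h)]

theorem IsZeroOne.of_map_eq {c : ℤ} {μ ν : Fin n → ℂ} (hν : IsZeroOne c ν)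
    (h : Multiset.map μ Finset.univ.val = Multiset.map ν Finset.univ.val) : IsZeroOne c μ := by
  refine ⟨fun k => ?_, ?_⟩
  · have : μ k ∈ Multiset.map μ Finset.univ.val := Multiset.mem_map_of_mem _ (Finset.mem_univ k)
    rw [h] at this
    obtain ⟨l, _, e⟩ := Multiset.mem_map.1 this
    rw [← e]
    exact hν.1 l
  · exact (congrArg Multiset.sum h).trans hν.2

theorem IsZeroOne.bounds {c : ℤ} {μ : Fin n → ℂ} (h : IsZeroOne c μ) : 0 ≤ c ∧ c ≤ n := by
  obtain ⟨h1, h2⟩ := multiset_zeroOne (A := Multiset.map μ Finset.univ.val) fun a ha => by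
    obtain ⟨k, _, rfl⟩ := Multiset.mem_map.1 ha
    exact h.1 k
  have e : (Multiset.map μ Finset.univ.val).sum = (c : ℂ) := h.2
  rw [e] at h1
  have h1 : c = (Multiset.count 1 (Multiset.map μ Finset.univ.val) : ℕ) := by exact_mod_cast h1
  rw [Multiset.card_map] at h2
  have : Multiset.card (Finset.univ : Finset (Fin n)).val = n := Finset.card_fin n
  omega

theorem isZeroOne_fundWeight {c : ℤ} (h0 : 0 ≤ c) (h1 : c ≤ n) : IsZeroOne c (fundWeight n c) := by
  refine ⟨fun k => ?_, ?_⟩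
  · unfold fundWeight
    split_ifs <;> simp
  · obtain ⟨c, rfl⟩ := Int.eq_ofNat_of_zero_le h0
    have e : ∀ k : Fin n, fundWeight n (c : ℤ) k = (fun k : ℕ => if k < c then (1 : ℂ) else 0) k :=
      fun k => by simp [fundWeight]
    rw [Finset.sum_congr rfl fun k _ => e k,
      Fin.sum_univ_eq_sum_range (fun k : ℕ => if k < c then (1 : ℂ) else 0), ← Finset.sum_filter]
    have : Finset.filter (fun k => k < c) (Finset.range n) = Finset.range c := by
      ext k; simp only [Finset.mem_filter, Finset.mem_range]; omega
    simp [this]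

theorem isZeroOne_append {c c' : ℤ} {μ : Fin n → ℂ} {ν : Fin m → ℂ} (hμ : IsZeroOne c μ)
    (hν : IsZeroOne c' ν) : IsZeroOne (c + c') (Fin.append μ ν) := by
  refine ⟨fun k => ?_, ?_⟩
  · refine Fin.addCases (fun a => ?_) (fun b => ?_) k
    · rw [Fin.append_left]; exact hμ.1 a
    · rw [Fin.append_right]; exact hν.1 b
  · simp only [Fin.sum_univ_add, Fin.append_left, Fin.append_right, hμ.2, hν.2]
    push_cast; rfl

/-- Converse of `isZeroOne_append`. The sums of both parts have to be prescribed, as d alone does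
not tell how the ones are distributed. -/
theorem IsZeroOne.of_append {c c' d : ℤ} {μ : Fin n → ℂ} {ν : Fin m → ℂ}
    (h : IsZeroOne d (Fin.append μ ν)) (hμ : ∑ k, μ k = c) (hν : ∑ k, ν k = c') :
    IsZeroOne c μ ∧ IsZeroOne c' ν := by
  refine ⟨⟨fun k => ?_, hμ⟩, ⟨fun k => ?_, hν⟩⟩
  · have := h.1 (Fin.castAdd m k)
    rwa [Fin.append_left] at this
  · have := h.1 (Fin.natAdd n k)
    rwa [Fin.append_right] at this

/-- Equal entries are not affected by the swap; entries 1, 0 are covered by `centralIdeal_swap`, and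
entries 0, 1 by the same result for the swapped weight. -/
theorem centralIdeal_swap_of_zeroOne {μ : Fin n → ℂ} (h : ∀ k, μ k = 0 ∨ μ k = 1) {k l : Fin n}
    (hkl : (l : ℕ) = k + 1) : centralIdeal n (μ ∘ Equiv.swap k l) = centralIdeal n μ := by
  rcases h k with hk | hk <;> rcases h l with hl | hl
  · have : μ ∘ Equiv.swap k l = μ := by
      ext r
      rw [Function.comp_apply, Equiv.swap_apply_def]
      split_ifs with h1 h2
      · rw [h1, hk, hl]
      · rw [h2, hk, hl]
      · rfl
    rw [this]
  · have e : μ = (μ ∘ Equiv.swap k l) ∘ Equiv.swap k l := by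
      ext r; simp
    have h3 := centralIdeal_swap (μ := μ ∘ Equiv.swap k l) hkl (by simp [hk, hl])
    rw [← e] at h3
    exact h3.symm
  · exact centralIdeal_swap hkl (by rw [hk, hl, sub_zero])
  · have : μ ∘ Equiv.swap k l = μ := by
      ext r
      rw [Function.comp_apply, Equiv.swap_apply_def]
      split_ifs with h1 h2
      · rw [h1, hk, hl]
      · rw [h2, hk, hl]
      · rfl
    rw [this]

/-- Adjacent transpositions generate the symmetric group, and permuting preserves the zero-one
condition. -/
theorem centralIdeal_comp_perm {μ : Fin n → ℂ} (h : ∀ k, μ k = 0 ∨ μ k = 1)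
    (σ : Equiv.Perm (Fin n)) : centralIdeal n (μ ∘ σ) = centralIdeal n μ := by
  cases n with
  | zero => rw [Subsingleton.elim (μ ∘ σ) μ]
  | succ n =>
    have hσ : σ ∈ Submonoid.closure (Set.range fun i : Fin n => Equiv.swap i.castSucc i.succ) := by
      rw [Equiv.Perm.mclosure_swap_castSucc_succ]; trivial
    induction hσ using Submonoid.closure_induction generalizing μ with
    | mem σ hσ =>
      obtain ⟨i, rfl⟩ := hσ
      exact centralIdeal_swap_of_zeroOne h (by simp)
    | one => rfl
    | mul σ τ _ _ hσ hτ =>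
      rw [Equiv.Perm.coe_mul, ← Function.comp_assoc, hτ (μ := μ ∘ σ) fun k => h _, hσ h]

/-- All permutations of `e₁ + ⋯ + e_c` give the same central character. -/
theorem IsZeroOne.centralIdeal_eq {c : ℤ} {μ ν : Fin n → ℂ} (hμ : IsZeroOne c μ)
    (hν : IsZeroOne c ν) : centralIdeal n μ = centralIdeal n ν := by
  obtain ⟨σ, rfl⟩ : ∃ σ : Equiv.Perm (Fin n), μ = ν ∘ σ := by
    have hcard : ∀ (ρ : Fin n → ℂ) (a : ℂ), Fintype.card {k // ρ k = a} =
        Multiset.count a (Multiset.map ρ Finset.univ.val) := by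
      intro ρ a
      rw [Multiset.count_map, Fintype.card_subtype]
      simp only [eq_comm]
      rfl
    have he : ∀ a, Nonempty ({k // μ k = a} ≃ {k // ν k = a}) := fun a => by
      rw [← Fintype.card_eq, hcard, hcard, hμ.map_eq hν]
    refine ⟨Equiv.ofFiberEquiv (f := μ) (g := ν) fun a => (he a).some, funext fun k => ?_⟩
    exact (Equiv.ofFiberEquiv_map (f := μ) (g := ν) (fun a => (he a).some) k).symm
  exact centralIdeal_comp_perm hν.1 σ

end GLn
end

noncomputable section

/-! ### Pure tensors -/

namespace LieMod

variable {L : Type} [LieRing L] [LieAlgebra ℂ L]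

/-- The bilinear map `(v, w) ↦ v ⊗ w`. -/
def tm (V : LieMod.{0} L) (M : LieMod.{u} L) : V →ₗ[ℂ] M →ₗ[ℂ] (tensorLeft V).obj M :=
  TensorProduct.mk ℂ V M

variable {V : LieMod.{0} L} {M : LieMod.{u} L}

theorem lie_tm (x : L) (v : V) (w : M) : ⁅x, tm V M v w⁆ = tm V M ⁅x, v⁆ w + tm V M v ⁅x, w⁆ :=
  lie_tmul x v w

theorem tm_top (S : Submodule ℂ ((tensorLeft V).obj M)) (h : ∀ v w, tm V M v w ∈ S)
    (t : (tensorLeft V).obj M) : t ∈ S := by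
  induction t using TensorProduct.induction_on with
  | zero => exact zero_mem S
  | tmul v w => exact h v w
  | add t t' ht ht' => exact add_mem ht ht'

end LieMod

/-! ### Weights and nilpotency -/

namespace GLn

open LieMod

variable {n m : ℕ} {M M' : LieMod.{u} (gl n)} {N : LieMod.{u} (gl m)}

/-- `v` is annihilated by all products of `K` strictly upper triangular matrices. -/
def Nil : ℕ → M → Prop
  | 0, v => v = 0
  | K + 1, v => ∀ x : gl n, IsStrictUpper x → Nil K ⁅x, v⁆

theorem nil_iff (K : ℕ) (v : M) : Nil K v ↔ ∀ l : List (gl n), (∀ x ∈ l, IsStrictUpper x) →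
    l.length = K → l.foldr (fun x w => ⁅x, w⁆) v = 0 := by
  induction K generalizing v with
  | zero =>
    refine ⟨fun h l _ hl => ?_, fun h => h [] (by simp) rfl⟩
    rw [List.length_eq_zero_iff.1 hl]
    exact h
  | succ K ih =>
    refine ⟨fun h l hl hK => ?_, fun h x hx => (ih _).2 fun l hl hK => ?_⟩
    · rcases List.eq_nil_or_concat l with rfl | ⟨l, x, rfl⟩
      · simp at hK
      · rw [List.concat_eq_append] at hl hK ⊢
        rw [List.foldr_append]
        refine (ih _).1 (h x (hl x (by simp))) l (fun y hy => hl y (by simp [hy])) ?_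
        simpa using hK
    · have := h (l ++ [x]) (fun y hy => ?_) (by simp [hK])
      · rwa [List.foldr_append] at this
      · rcases List.mem_append.1 hy with hy | hy
        · exact hl y hy
        · rw [List.mem_singleton.1 hy]; exact hx

theorem nil_zero (K : ℕ) : Nil K (0 : M) := by
  induction K with
  | zero => exact rfl
  | succ K ih => intro x _; rwa [lie_zero]

theorem Nil.succ {K : ℕ} {v : M} (h : Nil K v) : Nil (K + 1) v := by
  induction K generalizing v with
  | zero => rw [show v = 0 from h]; exact nil_zero _
  | succ K ih => intro x hx; exact ih (h x hx)

theorem Nil.mono {K K' : ℕ} {v : M} (h : Nil K v) (hK : K ≤ K') : Nil K' v := by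
  induction hK with
  | refl => exact h
  | step _ ih => exact ih.succ

theorem Nil.add {K : ℕ} {v w : M} (hv : Nil K v) (hw : Nil K w) : Nil K (v + w) := by
  induction K generalizing v w with
  | zero => rw [show v = 0 from hv, show w = 0 from hw, add_zero]; exact nil_zero 0
  | succ K ih => intro x hx; rw [lie_add]; exact ih (hv x hx) (hw x hx)

theorem Nil.smul {K : ℕ} {v : M} (hv : Nil K v) (c : ℂ) : Nil K (c • v) := by
  induction K generalizing v with
  | zero => rw [show v = 0 from hv, smul_zero]; exact nil_zero 0
  | succ K ih => intro x hx; rw [lie_smul]; exact ih (hv x hx)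

theorem Nil.map {K : ℕ} {v : M} (hv : Nil K v) (f : M ⟶ M') : Nil K (toLin f v) := by
  induction K generalizing v with
  | zero => rw [show v = 0 from hv, map_zero]; exact nil_zero 0
  | succ K ih => intro x hx; rw [← LieModuleHom.map_lie]; exact ih (hv x hx)

/-- The hypothesis puts the entries of y on the diagonals b - a ≥ n - d. A bracket with a strictly
upper matrix lowers d by one, and d = 0 forces y = 0; so of d + K factors, too many hit either y or
v. -/
theorem Nil.lie {K d : ℕ} {v : M} {y : gl n} (hv : Nil K v)
    (hy : ∀ a b : Fin n, y a b ≠ 0 → n + (a : ℕ) < (b : ℕ) + d + 1) : Nil (d + K) ⁅y, v⁆ := by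
  induction hs : d + K generalizing d K y v with
  | zero =>
    rw [show K = 0 by omega] at hv
    rw [show v = 0 from hv, lie_zero]
    exact nil_zero 0
  | succ s ih =>
    intro x hx
    rw [leibniz_lie]
    refine Nil.add ?_ ?_
    · rcases d with _ | d
      · have : y = 0 := by
          ext a b
          by_contra h
          have := hy a b h
          omega
        rw [this, lie_zero, zero_lie]
        exact nil_zero _
      · refine ih hv (d := d) (fun a b hab => ?_) (by omega)
        by_contra hlt
        refine hab ?_
        rw [LieRing.of_associative_ring_bracket, Matrix.sub_apply, Matrix.mul_apply, Matrix.mul_apply,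
          Finset.sum_eq_zero, Finset.sum_eq_zero, sub_zero]
        · intro r _
          by_cases h1 : y a r = 0
          · rw [h1, zero_mul]
          · have := hy a r h1
            rw [hx r b (Fin.le_def.2 (by omega)), mul_zero]
        · intro r _
          by_cases h1 : y r b = 0
          · rw [h1, mul_zero]
          · have := hy r b h1
            rw [hx a r (Fin.le_def.2 (by omega)), zero_mul]
    · rcases K with _ | K
      · rw [show v = 0 from hv, lie_zero, lie_zero]
        exact nil_zero _
      · exact ih (hv x hx) hy (by omega)

/-- The locally `𝔫₊`-nilpotent vectors. -/
def nilSub (M : LieMod.{u} (gl n)) : LieSubmodule ℂ (gl n) M where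
  carrier := {v | ∃ K, Nil K v}
  add_mem' := fun ⟨K, hK⟩ ⟨K', hK'⟩ =>
    ⟨max K K', (hK.mono (le_max_left _ _)).add (hK'.mono (le_max_right _ _))⟩
  zero_mem' := ⟨0, rfl⟩
  smul_mem' c _ := fun ⟨K, hK⟩ => ⟨K, hK.smul c⟩
  -- For d = 2n the condition on the entries of y is void.
  lie_mem {y v} := fun ⟨K, hK⟩ => ⟨2 * n + K, hK.lie fun a b _ => by omega⟩

/-- The span of the weight vectors with weights in `T`. -/
def wtSup (T : Set (Fin n → ℂ)) (M : LieMod.{u} (gl n)) : Submodule ℂ M :=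
  ⨆ μ ∈ T, weightSpace M μ

theorem mem_wtSup {T : Set (Fin n → ℂ)} {μ : Fin n → ℂ} (hμ : μ ∈ T) {v : M}
    (hv : v ∈ weightSpace M μ) : v ∈ wtSup T M :=
  Submodule.mem_iSup_of_mem μ (Submodule.mem_iSup_of_mem hμ hv)

theorem wtSup_le {T : Set (Fin n → ℂ)} {S : Submodule ℂ M}
    (h : ∀ μ ∈ T, ∀ v ∈ weightSpace M μ, v ∈ S) : wtSup T M ≤ S :=
  iSup₂_le h

theorem weightSpace_map {μ : Fin n → ℂ} {v : M} (hv : v ∈ weightSpace M μ) (f : M ⟶ M') :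
    toLin f v ∈ weightSpace M' μ := fun d => by
  rw [← LieModuleHom.map_lie, hv d, map_smul]

/-- Sets of weights which are stable under adding roots. -/
def RootClosed (T : Set (Fin n → ℂ)) : Prop :=
  ∀ μ ∈ T, ∀ a b, μ + (Pi.single a 1 - Pi.single b 1) ∈ T

/-- `wtSup` as a submodule. -/
def wtSub {T : Set (Fin n → ℂ)} (hT : RootClosed T) (M : LieMod.{u} (gl n)) :
    LieSubmodule ℂ (gl n) M where
  __ := wtSup T M
  lie_mem {x v} hv := by
    have : wtSup T M ≤ (wtSup T M).comap (LieModule.toEnd ℂ (gl n) M x) := by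
      refine wtSup_le fun μ hμ v hv => ?_
      rw [Submodule.mem_comap, LieModule.toEnd_apply_apply, Matrix.matrix_eq_sum_single x, sum_lie]
      refine sum_mem fun a _ => ?_
      rw [sum_lie]
      refine sum_mem fun b _ => ?_
      rw [← mul_one (x a b), ← smul_eq_mul, ← Matrix.smul_single, smul_lie]
      exact Submodule.smul_mem _ _ (mem_wtSup (hT μ hμ a b) (lie_single_mem_weightSpace hv a b))
    exact this hv

/-- Finitely generated, locally nilpotent modules with weights in `T`. -/
structure InO (T : Set (Fin n → ℂ)) (M : LieMod.{u} (gl n)) : Prop where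
  fg : ∃ s : Finset M, LieSubmodule.lieSpan ℂ (gl n) (s : Set M) = ⊤
  wt : wtSup T M = ⊤
  nil : ∀ v : M, ∃ K, Nil K v

theorem catO_iff : catO n M ↔ InO Set.univ M := by
  have : wtSup Set.univ M = ⨆ μ, weightSpace M μ := by simp [wtSup]
  refine ⟨fun h => ⟨h.1, this.trans h.2.1, fun v => ?_⟩, fun h => ⟨h.fg, this.symm.trans h.wt, fun v => ?_⟩⟩
  · obtain ⟨K, hK⟩ := h.2.2 v
    exact ⟨K, (nil_iff K v).2 hK⟩
  · obtain ⟨K, hK⟩ := h.nil v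
    exact ⟨K, (nil_iff K v).1 hK⟩

theorem InO.mono {T T' : Set (Fin n → ℂ)} (h : InO T M) (hT : T ⊆ T') : InO T' M :=
  ⟨h.fg, eq_top_iff.2 (h.wt ▸ biSup_mono hT), h.nil⟩

theorem InO.catO {T : Set (Fin n → ℂ)} (h : InO T M) : catO n M :=
  catO_iff.2 (h.mono (Set.subset_univ T))

/-- Both conditions cut out submodules, `wtSub` and `nilSub`, so generators suffice. -/
theorem InO.of_generators {T : Set (Fin n → ℂ)} (hT : RootClosed T) (s : Finset M)
    (hs : LieSubmodule.lieSpan ℂ (gl n) (s : Set M) = ⊤) (hw : ∀ v ∈ s, v ∈ wtSup T M)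
    (hn : ∀ v ∈ s, ∃ K, Nil K v) : InO T M := by
  refine ⟨⟨s, hs⟩, ?_, fun v => ?_⟩
  · refine eq_top_iff.2 fun v _ => ?_
    have : LieSubmodule.lieSpan ℂ (gl n) (s : Set M) ≤ wtSub hT M := LieSubmodule.lieSpan_le.2 hw
    exact this (hs ▸ LieSubmodule.mem_top v)
  · have : LieSubmodule.lieSpan ℂ (gl n) (s : Set M) ≤ nilSub M := LieSubmodule.lieSpan_le.2 hn
    exact this (hs ▸ LieSubmodule.mem_top v)

theorem InO.of_surjective {T : Set (Fin n → ℂ)} (h : InO T M) (f : M ⟶ M')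
    (hf : Function.Surjective (toLin f)) : InO T M' := by
  classical
  obtain ⟨s, hs⟩ := h.fg
  refine ⟨⟨s.image (toLin f), eq_top_iff.2 fun v _ => ?_⟩, eq_top_iff.2 fun v _ => ?_, fun v => ?_⟩
  · obtain ⟨w, rfl⟩ := hf v
    have : LieSubmodule.lieSpan ℂ (gl n) (s : Set M) ≤
        (LieSubmodule.lieSpan ℂ (gl n) ((s.image (toLin f) : Finset M') : Set M')).comap (toLin f) :=
      LieSubmodule.lieSpan_le.2 fun x hx => LieSubmodule.subset_lieSpan
        (Finset.mem_coe.2 (Finset.mem_image_of_mem _ (Finset.mem_coe.1 hx)))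
    exact this (hs ▸ LieSubmodule.mem_top w)
  · obtain ⟨w, rfl⟩ := hf v
    have : wtSup T M ≤ (wtSup T M').comap (toLin f).toLinearMap :=
      wtSup_le fun μ hμ v hv => mem_wtSup hμ (weightSpace_map hv f)
    exact this (h.wt ▸ Submodule.mem_top)
  · obtain ⟨w, rfl⟩ := hf v
    obtain ⟨K, hK⟩ := h.nil w
    exact ⟨K, hK.map f⟩

/-! ### Tensor products -/

section Tensor

variable {V : LieMod.{0} (gl n)}

theorem tmul_mem_weightSpace {μ ν : Fin n → ℂ} {v : V} {w : M} (hv : v ∈ weightSpace V μ)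
    (hw : w ∈ weightSpace M ν) : tm V M v w ∈ weightSpace ((tensorLeft V).obj M) (μ + ν) := fun d => by
  rw [lie_tm, hv d, hw d, map_smul, map_smul, LinearMap.smul_apply, ← add_smul]
  simp only [Pi.add_apply, mul_add, Finset.sum_add_distrib]

theorem Nil.tmul {K K' : ℕ} {v : V} {w : M} (hv : Nil K v) (hw : Nil K' w) :
    Nil (K + K') (tm V M v w) := by
  induction hs : K + K' generalizing K K' v w with
  | zero =>
    rw [show K = 0 by omega] at hv
    rw [show v = 0 from hv, map_zero, LinearMap.zero_apply]
    exact rfl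
  | succ s ih =>
    intro x hx
    rw [lie_tm]
    refine Nil.add ?_ ?_
    · rcases K with _ | K
      · rw [show v = 0 from hv, lie_zero, map_zero, LinearMap.zero_apply]
        exact nil_zero _
      · exact ih (hv x hx) hw (by omega)
    · rcases K' with _ | K'
      · rw [show w = 0 from hw, lie_zero, map_zero]
        exact nil_zero _
      · exact ih hv (hw x hx) (by omega)

theorem InO.tensor [Module.Finite ℂ V] {T₁ T₂ T : Set (Fin n → ℂ)} (hT : RootClosed T)
    (h : ∀ μ ∈ T₁, ∀ ν ∈ T₂, μ + ν ∈ T) (hV : InO T₁ V) (hM : InO T₂ M) :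
    InO T ((tensorLeft V).obj M) := by
  classical
  obtain ⟨s, hs⟩ := hM.fg
  obtain ⟨b, hb⟩ := Module.Finite.fg_top (R := ℂ) (M := V)
  refine InO.of_generators hT (Finset.image₂ (fun v w => tm V M v w) b s) ?_ ?_ ?_
  · set X := LieSubmodule.lieSpan ℂ (gl n)
      ((Finset.image₂ (fun v w => tm V M v w) b s : Finset _) : Set ((tensorLeft V).obj M)) with hX
    -- The w with V ⊗ w inside X form a submodule because v ⊗ xw = x(v ⊗ w) - xv ⊗ w. Hence a
    -- spanning set of V and generators of M together generate V ⊗ M.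
    let P : LieSubmodule ℂ (gl n) M :=
      { (⨅ v : V, X.toSubmodule.comap (tm V M v) : Submodule ℂ M) with
        lie_mem := fun {x w} hw => by
          have hw : ∀ v, tm V M v w ∈ X := (Submodule.mem_iInf _).1 hw
          refine (Submodule.mem_iInf _).2 fun v => ?_
          have h1 := X.lie_mem (x := x) (hw v)
          rw [lie_tm] at h1
          exact (add_mem_cancel_left (hw _)).1 h1 }
    have hP : LieSubmodule.lieSpan ℂ (gl n) (s : Set M) ≤ P := by
      refine LieSubmodule.lieSpan_le.2 fun w hw => (Submodule.mem_iInf _).2 fun v => ?_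
      have : Submodule.span ℂ (b : Set V) ≤ X.toSubmodule.comap ((tm V M).flip w) :=
        Submodule.span_le.2 fun v hv =>
          LieSubmodule.subset_lieSpan (Finset.mem_coe.2 (Finset.mem_image₂_of_mem hv hw))
      exact this (hb ▸ Submodule.mem_top)
    refine eq_top_iff.2 fun t _ => tm_top X.toSubmodule (fun v w => ?_) t
    exact (Submodule.mem_iInf _).1 (hP (hs ▸ LieSubmodule.mem_top w)) v
  · intro t ht
    obtain ⟨v, -, w, -, rfl⟩ := Finset.mem_image₂.1 ht
    have h1 : ∀ v ∈ wtSup T₁ V, ∀ w ∈ wtSup T₂ M, tm V M v w ∈ wtSup T ((tensorLeft V).obj M) := by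
      intro v hv
      have : wtSup T₁ V ≤ ⨅ w ∈ wtSup T₂ M, (wtSup T ((tensorLeft V).obj M)).comap
          ((tm V M).flip w) := by
        refine wtSup_le fun μ hμ v hv => ?_
        simp only [Submodule.mem_iInf]
        intro w hw
        have : wtSup T₂ M ≤ (wtSup T ((tensorLeft V).obj M)).comap (tm V M v) :=
          wtSup_le fun ν hν w hw => mem_wtSup (h μ hμ ν hν) (tmul_mem_weightSpace hv hw)
        exact this hw
      have := this hv
      simp only [Submodule.mem_iInf] at this
      exact this
    exact h1 v (hV.wt ▸ Submodule.mem_top) w (hM.wt ▸ Submodule.mem_top)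
  · intro t ht
    obtain ⟨v, -, w, -, rfl⟩ := Finset.mem_image₂.1 ht
    obtain ⟨K, hK⟩ := hV.nil v
    obtain ⟨K', hK'⟩ := hM.nil w
    exact ⟨_, hK.tmul hK'⟩

end Tensor

/-! ### Parabolic induction -/

section Induced

/-- A block diagonal matrix. -/
def blockDiag (x : gl n) (y : gl m) : gl (n + m) := Matrix.of fun k l =>
  Fin.addCases (fun a => Fin.addCases (fun b => x a b) (fun _ => 0) l)
    (fun a => Fin.addCases (fun _ => 0) (fun b => y a b) l) k

theorem lie_blockDiag_mkC (x : gl n) (y : gl m) (v : M) (w : N) : ∃ c : ℂ,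
    ⁅blockDiag x y, mkC n m v w⁆ = c • mkC n m v w + mkC n m ⁅x, v⁆ w + mkC n m v ⁅y, w⁆ := by
  have e1 : (blockDiag x y).submatrix (Fin.castAdd m) (Fin.castAdd m) = x := by
    ext a b; simp [blockDiag]
  have e2 : (blockDiag x y).submatrix (Fin.natAdd n) (Fin.natAdd n) = y := by
    ext a b; simp [blockDiag]
  refine ⟨shiftChar n m (blockDiag x y), ?_⟩
  rw [lie_mkC _ (fun b a => by simp [blockDiag]), e1, e2]

/-- The vectors `v` such that `[v, w]` lies in a submodule. -/
def leftComap (X : LieSubmodule ℂ (gl (n + m)) ((C n m).obj (M, N))) (w : N) :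
    LieSubmodule ℂ (gl n) M where
  __ := X.toSubmodule.comap ((mkCLin M N).flip w)
  lie_mem {x v} hv := by
    have hv : mkC n m v w ∈ X := hv
    change mkC n m ⁅x, v⁆ w ∈ X
    obtain ⟨c, hc⟩ := lie_blockDiag_mkC x 0 v w
    have h1 := X.lie_mem (x := blockDiag x 0) hv
    have h2 : mkC n m v ⁅(0 : gl m), w⁆ = 0 := by
      rw [zero_lie]; exact map_zero (mkCLin M N v)
    rw [hc, h2, add_zero] at h1
    exact (add_mem_cancel_left (X.toSubmodule.smul_mem c hv)).1 h1

/-- The vectors `w` such that `[v, w]` lies in a submodule. -/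
def rightComap (X : LieSubmodule ℂ (gl (n + m)) ((C n m).obj (M, N))) (v : M) :
    LieSubmodule ℂ (gl m) N where
  __ := X.toSubmodule.comap (mkCLin M N v)
  lie_mem {x w} hw := by
    have hw : mkC n m v w ∈ X := hw
    change mkC n m v ⁅x, w⁆ ∈ X
    obtain ⟨c, hc⟩ := lie_blockDiag_mkC 0 x v w
    have h1 := X.lie_mem (x := blockDiag 0 x) hw
    have h2 : mkC n m ⁅(0 : gl n), v⁆ w = 0 := by
      rw [zero_lie]; exact LinearMap.congr_fun (map_zero (mkCLin M N)) w
    rw [hc, h2, add_zero] at h1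
    exact (add_mem_cancel_left (X.toSubmodule.smul_mem c hw)).1 h1

theorem Nil.mkC {K K' : ℕ} {v : M} {w : N} (hv : Nil K v) (hw : Nil K' w) :
    Nil (K + K') (mkC n m v w) := by
  have h0 : ∀ w : N, GLn.mkC n m (0 : M) w = 0 := fun w =>
    LinearMap.congr_fun (map_zero (mkCLin M N)) w
  have h0' : ∀ v : M, GLn.mkC n m v (0 : N) = 0 := fun v => map_zero (mkCLin M N v)
  induction hs : K + K' generalizing K K' v w with
  | zero =>
    rw [show K = 0 by omega] at hv
    rw [show v = 0 from hv, h0]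
    exact rfl
  | succ s ih =>
    intro x hx
    obtain ⟨x₁, x₂, h1, h2, e⟩ := strictUpper_mkC hx v w
    rw [e]
    refine Nil.add ?_ ?_
    · rcases K with _ | K
      · rw [show v = 0 from hv, lie_zero, h0]
        exact nil_zero _
      · exact ih (hv x₁ h1) hw (by omega)
    · rcases K' with _ | K'
      · rw [show w = 0 from hw, lie_zero, h0']
        exact nil_zero _
      · exact ih hv (hw x₂ h2) (by omega)

theorem InO.C {T₁ : Set (Fin n → ℂ)} {T₂ : Set (Fin m → ℂ)} {T : Set (Fin (n + m) → ℂ)}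
    (hT : RootClosed T) (h : ∀ μ ∈ T₁, ∀ ν ∈ T₂,
      Fin.append (fun k => μ k - (m : ℂ) / 2) (fun k => ν k + (n : ℂ) / 2) ∈ T)
    (hM : InO T₁ M) (hN : InO T₂ N) : InO T ((C n m).obj (M, N)) := by
  classical
  obtain ⟨s, hs⟩ := hM.fg
  obtain ⟨t, ht⟩ := hN.fg
  refine InO.of_generators hT (Finset.image₂ (fun v w => mkC n m v w) s t) ?_ ?_ ?_
  · refine C_top _ fun v w => ?_
    set X := LieSubmodule.lieSpan ℂ (gl (n + m))
      ((Finset.image₂ (fun v w => mkC n m v w) s t : Finset _) : Set ((GLn.C n m).obj (M, N)))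
    have h1 : ∀ v ∈ s, ∀ w : N, mkC n m v w ∈ X := fun v hv w => by
      have : LieSubmodule.lieSpan ℂ (gl m) (t : Set N) ≤ rightComap X v :=
        LieSubmodule.lieSpan_le.2 fun w hw =>
          LieSubmodule.subset_lieSpan (Finset.mem_coe.2 (Finset.mem_image₂_of_mem hv hw))
      exact this (ht ▸ LieSubmodule.mem_top w)
    have : LieSubmodule.lieSpan ℂ (gl n) (s : Set M) ≤ leftComap X w :=
      LieSubmodule.lieSpan_le.2 fun v hv => h1 v hv w
    exact this (hs ▸ LieSubmodule.mem_top v)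
  · intro x hx
    obtain ⟨v, -, w, -, rfl⟩ := Finset.mem_image₂.1 hx
    have h1 : wtSup T₁ M ≤ ⨅ w : N, (wtSup T ((GLn.C n m).obj (M, N))).comap
        ((mkCLin M N).flip w) := by
      refine wtSup_le fun μ hμ v hv => ?_
      rw [Submodule.mem_iInf]
      intro w
      have : wtSup T₂ N ≤ (wtSup T ((GLn.C n m).obj (M, N))).comap (mkCLin M N v) :=
        wtSup_le fun ν hν w hw => mem_wtSup (h μ hμ ν hν) (mkC_mem_weightSpace hv hw)
      exact this (hN.wt ▸ Submodule.mem_top)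
    exact (Submodule.mem_iInf _).1 (h1 (hM.wt ▸ Submodule.mem_top)) w
  · intro x hx
    obtain ⟨v, -, w, -, rfl⟩ := Finset.mem_image₂.1 hx
    obtain ⟨K, hK⟩ := hM.nil v
    obtain ⟨K', hK'⟩ := hN.nil w
    exact ⟨_, hK.mkC hK'⟩

end Induced

/-! ### Integral weights -/

/-- The weights `z - δ` with `z` integral of degree `c`. -/
def intWt (δ : Fin n → ℂ) (c : ℤ) : Set (Fin n → ℂ) :=
  {μ | ∃ z : Fin n → ℤ, ∑ k, z k = c ∧ ∀ k, μ k = z k - δ k}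

theorem rootClosed_intWt (δ : Fin n → ℂ) (c : ℤ) : RootClosed (intWt δ c) := by
  rintro μ ⟨z, hz, h⟩ a b
  refine ⟨z + (Pi.single a 1 - Pi.single b 1), ?_, fun k => ?_⟩
  · simp [Finset.sum_add_distrib, hz]
  · simp only [Pi.add_apply, Pi.sub_apply, h, Pi.single_apply]
    push_cast
    ring

theorem intWt_add {δ δ' : Fin n → ℂ} {c c' : ℤ} {μ ν : Fin n → ℂ} (hμ : μ ∈ intWt δ c)
    (hν : ν ∈ intWt δ' c') : μ + ν ∈ intWt (δ + δ') (c + c') := by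
  obtain ⟨z, hz, h⟩ := hμ
  obtain ⟨z', hz', h'⟩ := hν
  refine ⟨z + z', ?_, fun k => ?_⟩
  · simp [Finset.sum_add_distrib, hz, hz']
  · simp only [Pi.add_apply, h, h']
    push_cast
    ring

theorem intWt_append {c c' : ℤ} {μ : Fin n → ℂ} {ν : Fin m → ℂ} (hμ : μ ∈ intWt (rho n) c)
    (hν : ν ∈ intWt (rho m) c') :
    Fin.append (fun k => μ k - (m : ℂ) / 2) (fun k => ν k + (n : ℂ) / 2) ∈
      intWt (rho (n + m)) (c + c') := by
  obtain ⟨z, hz, h⟩ := hμ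
  obtain ⟨z', hz', h'⟩ := hν
  refine ⟨Fin.append z z', ?_, fun k => ?_⟩
  · simp [Fin.sum_univ_add, hz, hz']
  · refine Fin.addCases (fun a => ?_) (fun b => ?_) k
    · simp only [Fin.append_left, h, rho, Fin.val_castAdd]
      push_cast; ring
    · simp only [Fin.append_right, h', rho, Fin.val_natAdd]
      push_cast; ring

end GLn
end

noncomputable section

/-! ### Filtrations by highest weight modules -/

namespace GLn

open LieMod

variable {n m : ℕ} {M M' : LieMod.{u} (gl n)} {N : LieMod.{u} (gl m)}

/-- Submodules with a finite filtration by highest weight modules with highest weights `μ - ρ`,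
`μ ∈ S`. -/
inductive Filt (S : Set (Fin n → ℂ)) : LieSubmodule ℂ (gl n) M → Prop
  | bot : Filt S ⊥
  | step (P : LieSubmodule ℂ (gl n) M) (μ : Fin n → ℂ) (v : M) : Filt S P → IsSingular P μ v →
      μ ∈ S → Filt S (P ⊔ LieSubmodule.lieSpan ℂ (gl n) {v})

/-- The ideal `I` of the center annihilates `M`. -/
def Kills (I : Ideal (Subalgebra.center ℂ (Env n))) (M : LieMod.{u} (gl n)) : Prop :=
  ∀ z ∈ I, ∀ v : M, act M (z : Env n) v = 0

theorem Kills.of_injective {I : Ideal (Subalgebra.center ℂ (Env n))} (h : Kills I M') (f : M ⟶ M')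
    (hf : Function.Injective (toLin f)) : Kills I M := fun z hz v => hf (by
  rw [toLin_act, h z hz, map_zero])

/-- The central ideal of a layer's highest weight maps that layer into the preceding submodule, so
the product over all layers annihilates P. -/
theorem Filt.exists_list {S : Set (Fin n → ℂ)} {P : LieSubmodule ℂ (gl n) M} (h : Filt S P) :
    ∃ l : List (Fin n → ℂ), (∀ μ ∈ l, μ ∈ S) ∧
      ∀ z ∈ (l.map (centralIdeal n)).prod, ∀ v ∈ P, act M (z : Env n) v = 0 := by
  induction h with
  | bot => 
    refine ⟨[], by simp, fun z _ v hv => ?_⟩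
    rw [(LieSubmodule.mem_bot _).1 hv, map_zero]
  | step P μ v _ hv hμ ih =>
    obtain ⟨l, hl, h⟩ := ih
    refine ⟨l ++ [μ], fun ν hν => ?_, fun z hz w hw => ?_⟩
    · rcases List.mem_append.1 hν with hν | hν
      · exact hl ν hν
      · rwa [List.mem_singleton.1 hν]
    · rw [List.map_append, List.prod_append, List.map_singleton, List.prod_singleton] at hz
      induction hz using Submodule.mul_induction_on' with
      | mem_mul_mem a ha b hb =>
        have : P ⊔ LieSubmodule.lieSpan ℂ (gl n) {v} ≤ centralComap b P := by
          refine sup_le (fun w hw => act_mem P _ hw) (LieSubmodule.lieSpan_le.2 ?_)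
          rintro _ rfl
          exact hv.act_mem ((GLn.mem_centralIdeal_iff _ _).1 hb)
        rw [MulMemClass.coe_mul, map_mul]
        exact h a ha _ (this hw)
      | add a _ b _ ha hb =>
        rw [AddMemClass.coe_add, map_add, LinearMap.add_apply, ha, hb, add_zero]

theorem Filt.le_wtSub {S T : Set (Fin n → ℂ)} {P : LieSubmodule ℂ (gl n) M} (h : Filt S P)
    (hT : RootClosed T) (hS : ∀ μ ∈ S, (fun k => μ k - rho n k) ∈ T) : P ≤ wtSub hT M := by
  induction h with
  | bot => exact bot_le
  | step P μ v _ hv hμ ih =>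
    refine sup_le ih (LieSubmodule.lieSpan_le.2 ?_)
    rintro _ rfl
    exact mem_wtSup (hS μ hμ) hv.weight

/-- The vectors which can be adjoined to every filtered submodule. -/
def extendable (S : Set (Fin n → ℂ)) (M : LieMod.{u} (gl n)) : Submodule ℂ M where
  carrier := {v | ∀ P, Filt S P → ∃ P', Filt S P' ∧ P ≤ P' ∧ v ∈ P'}
  add_mem' {v w} hv hw P hP := by
    obtain ⟨P₁, h1, h2, h3⟩ := hv P hP
    obtain ⟨P₂, h4, h5, h6⟩ := hw P₁ h1
    exact ⟨P₂, h4, h2.trans h5, add_mem (h5 h3) h6⟩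
  zero_mem' P hP := ⟨P, hP, le_rfl, zero_mem P⟩
  smul_mem' c v hv P hP := by
    obtain ⟨P₁, h1, h2, h3⟩ := hv P hP
    exact ⟨P₁, h1, h2, P₁.toSubmodule.smul_mem c h3⟩

theorem exists_filt_finset {S : Set (Fin n → ℂ)} {ι : Type*} (s : Finset ι) (f : ι → M)
    (h : ∀ i ∈ s, f i ∈ extendable S M) (P : LieSubmodule ℂ (gl n) M) (hP : Filt S P) :
    ∃ P', Filt S P' ∧ P ≤ P' ∧ ∀ i ∈ s, f i ∈ P' := by
  classical
  induction s using Finset.induction_on with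
  | empty => exact ⟨P, hP, le_rfl, by simp⟩
  | insert i s _ ih =>
    obtain ⟨P₁, h1, h2, h3⟩ := ih fun j hj => h j (Finset.mem_insert_of_mem hj)
    obtain ⟨P₂, h4, h5, h6⟩ := h i (Finset.mem_insert_self i s) P₁ h1
    refine ⟨P₂, h4, h2.trans h5, fun j hj => ?_⟩
    rcases Finset.mem_insert.1 hj with rfl | hj
    · exact h6
    · exact h5 (h3 j hj)

/-- Every module of the category `O` has a finite filtration by highest weight modules. -/
theorem InO.filt {T : Set (Fin n → ℂ)} (hT : RootClosed T) (h : InO T M)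
    {I : Ideal (Subalgebra.center ℂ (Env n))} (hI : Kills I M) :
    Filt {μ | (fun k => μ k - rho n k) ∈ T ∧ I ≤ centralIdeal n μ ∧ centralIdeal n μ ≠ ⊤}
      (⊤ : LieSubmodule ℂ (gl n) M) := by
  set S : Set (Fin n → ℂ) :=
    {μ | (fun k => μ k - rho n k) ∈ T ∧ I ≤ centralIdeal n μ ∧ centralIdeal n μ ≠ ⊤}
  -- Induction on nilpotency: once all E_{ab} v with a < b have been adjoined, v itself is singular
  -- modulo the submodule reached and supplies the next layer.
  have key : ∀ K : ℕ, ∀ μ ∈ T, ∀ v ∈ weightSpace M μ, Nil K v → v ∈ extendable S M := by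
    intro K
    induction K with
    | zero => intro μ _ v _ hv; rw [show v = 0 from hv]; exact zero_mem _
    | succ K ih =>
      intro μ hμ v hv hK P hP
      obtain ⟨P₁, h1, h2, h3⟩ := exists_filt_finset (S := S)
        (Finset.univ.filter fun i : Fin n × Fin n => i.1 < i.2)
        (fun i => ⁅(Matrix.single i.1 i.2 1 : gl n), v⁆) (fun i hi => ih _ (hT μ hμ i.1 i.2) _
          (lie_single_mem_weightSpace hv i.1 i.2)
          (hK _ (isStrictUpper_single (Finset.mem_filter.1 hi).2))) P hP
      by_cases hvP : v ∈ P₁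
      · exact ⟨P₁, h1, h2, hvP⟩
      · have e : (fun k => (μ k + rho n k) - rho n k) = μ := by ext k; ring
        have hs : IsSingular P₁ (fun k => μ k + rho n k) v := by
          refine ⟨by rwa [e], fun x hx => ?_⟩
          exact mem_of_lie_single P₁.toSubmodule v (fun a b hab => h3 (a, b) (by simpa using hab)) hx
        -- Because v is outside `P₁`, the central ideal of the new layer is proper and contains
        -- every ideal that kills M.
        refine ⟨_, .step P₁ _ v h1 hs ⟨by rwa [e], fun z hz => ?_, hs.centralIdeal_ne_top hvP⟩,
          h2.trans le_sup_left, ?_⟩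
        · rw [hs.mem_centralIdeal_iff hvP, hI z hz]
          exact zero_mem _
        · exact (le_sup_right : _ ≤ P₁ ⊔ _)
            (LieSubmodule.subset_lieSpan (Set.mem_singleton v))
  have hall : ∀ v : M, v ∈ extendable S M := fun v => by
    have : wtSup T M ≤ extendable S M := wtSup_le fun μ hμ v hv => by
      obtain ⟨K, hK⟩ := h.nil v
      exact key K μ hμ v hv hK
    exact this (h.wt ▸ Submodule.mem_top)
  obtain ⟨s, hs⟩ := h.fg
  obtain ⟨P, h1, -, h3⟩ := exists_filt_finset s (fun v => v) (fun v _ => hall v) ⊥ .bot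
  have : P = ⊤ := eq_top_iff.2 (hs ▸ LieSubmodule.lieSpan_le.2 h3)
  exact this ▸ h1

/-- The submodule generated by the `[v, w]` with `v`, `w` in given submodules. -/
def spanC (A : LieSubmodule ℂ (gl n) M) (B : LieSubmodule ℂ (gl m) N) :
    LieSubmodule ℂ (gl (n + m)) ((C n m).obj (M, N)) :=
  LieSubmodule.lieSpan ℂ _ {x | ∃ v ∈ A, ∃ w ∈ B, x = mkC n m v w}

theorem mkC_mem_spanC {A : LieSubmodule ℂ (gl n) M} {B : LieSubmodule ℂ (gl m) N} {v : M} {w : N}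
    (hv : v ∈ A) (hw : w ∈ B) : mkC n m v w ∈ spanC A B :=
  LieSubmodule.subset_lieSpan ⟨v, hv, w, hw, rfl⟩

theorem spanC_le {A : LieSubmodule ℂ (gl n) M} {B : LieSubmodule ℂ (gl m) N}
    {X : LieSubmodule ℂ (gl (n + m)) ((C n m).obj (M, N))}
    (h : ∀ v ∈ A, ∀ w ∈ B, mkC n m v w ∈ X) : spanC A B ≤ X := by
  refine LieSubmodule.lieSpan_le.2 ?_
  rintro _ ⟨v, hv, w, hw, rfl⟩
  exact h v hv w hw

/-- Order the pairs of layers lexicographically. Adjoining [v, w] for the next pair of singular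
vectors works because n₊ sends it to [n₊ v, w] + [v, n₊ w], which lies in what was reached before.
-/
theorem Filt.C {S : Set (Fin n → ℂ)} {S' : Set (Fin m → ℂ)}
    (hM : Filt S (⊤ : LieSubmodule ℂ (gl n) M)) (hN : Filt S' (⊤ : LieSubmodule ℂ (gl m) N)) :
    Filt {κ | ∃ μ ∈ S, ∃ ν ∈ S', κ = Fin.append μ ν}
      (⊤ : LieSubmodule ℂ (gl (n + m)) ((C n m).obj (M, N))) := by
  have h0 : ∀ w : N, mkC n m (0 : M) w = 0 := fun w =>
    LinearMap.congr_fun (map_zero (mkCLin M N)) w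
  have h0' : ∀ v : M, mkC n m v (0 : N) = 0 := fun v => map_zero (mkCLin M N v)
  have key : ∀ A : LieSubmodule ℂ (gl n) M, Filt S A →
      Filt {κ | ∃ μ ∈ S, ∃ ν ∈ S', κ = Fin.append μ ν} (spanC A (⊤ : LieSubmodule ℂ (gl m) N)) := by
    intro A hA
    induction hA with
    | bot =>
      have : spanC (⊥ : LieSubmodule ℂ (gl n) M) (⊤ : LieSubmodule ℂ (gl m) N) = ⊥ :=
        eq_bot_iff.2 (spanC_le fun v hv w _ => by
          rw [(LieSubmodule.mem_bot _).1 hv, h0]; exact zero_mem _)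
      rw [this]
      exact .bot
    | step A μ v _ hv hμ ih =>
      -- With a layer v of M fixed, all pairs from A and N are already present, and the layers of N
      -- are added one by one.
      have key2 : ∀ B : LieSubmodule ℂ (gl m) N, Filt S' B →
          Filt {κ | ∃ μ ∈ S, ∃ ν ∈ S', κ = Fin.append μ ν} (spanC A (⊤ : LieSubmodule ℂ (gl m) N) ⊔
            spanC (A ⊔ LieSubmodule.lieSpan ℂ (gl n) {v}) B) := by
        intro B hB
        induction hB with
        | bot =>
          have : spanC (A ⊔ LieSubmodule.lieSpan ℂ (gl n) {v}) (⊥ : LieSubmodule ℂ (gl m) N) = ⊥ :=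
            eq_bot_iff.2 (spanC_le fun v _ w hw => by
              rw [(LieSubmodule.mem_bot _).1 hw, h0']; exact zero_mem _)
          rw [this, sup_bot_eq]
          exact ih
        | step B ν w _ hw hν ih2 =>
          have hvA : v ∈ A ⊔ LieSubmodule.lieSpan ℂ (gl n) {v} :=
            (le_sup_right : _ ≤ A ⊔ _) (LieSubmodule.subset_lieSpan (Set.mem_singleton v))
          have hwB : w ∈ B ⊔ LieSubmodule.lieSpan ℂ (gl m) {w} :=
            (le_sup_right : _ ≤ B ⊔ _) (LieSubmodule.subset_lieSpan (Set.mem_singleton w))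
          set X := spanC A (⊤ : LieSubmodule ℂ (gl m) N) ⊔
            spanC (A ⊔ LieSubmodule.lieSpan ℂ (gl n) {v}) B with hX
          have hX1 : ∀ a ∈ A, ∀ b : N, mkC n m a b ∈ X := fun a ha b =>
            (le_sup_left : _ ≤ spanC A _ ⊔ _) (mkC_mem_spanC ha (LieSubmodule.mem_top b))
          have hX2 : ∀ a ∈ A ⊔ LieSubmodule.lieSpan ℂ (gl n) {v}, ∀ b ∈ B, mkC n m a b ∈ X :=
            fun a ha b hb => (le_sup_right : _ ≤ spanC A _ ⊔ _) (mkC_mem_spanC ha hb)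
          have e : spanC A (⊤ : LieSubmodule ℂ (gl m) N) ⊔
              spanC (A ⊔ LieSubmodule.lieSpan ℂ (gl n) {v})
                (B ⊔ LieSubmodule.lieSpan ℂ (gl m) {w}) =
              X ⊔ LieSubmodule.lieSpan ℂ (gl (n + m)) {mkC n m v w} := by
            -- To see that [v, w] generates the rest, first let the second argument range over the
            -- enlarged B with v fixed (`rightComap`), then the first argument over the enlarged A
            -- (`leftComap`).
            refine le_antisymm (sup_le (le_sup_left.trans le_sup_left) (spanC_le ?_))
              (sup_le (sup_le le_sup_left (spanC_le fun a ha b hb => ?_))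
                (LieSubmodule.lieSpan_le.2 ?_))
            · set Y := X ⊔ LieSubmodule.lieSpan ℂ (gl (n + m)) {mkC n m v w}
              have hXY : X ≤ Y := le_sup_left
              have hvw : mkC n m v w ∈ Y := (le_sup_right : _ ≤ X ⊔ _)
                (LieSubmodule.subset_lieSpan (Set.mem_singleton _))
              have h1 : B ⊔ LieSubmodule.lieSpan ℂ (gl m) {w} ≤ rightComap Y v := by
                refine sup_le (fun b hb => hXY (hX2 v hvA b hb)) (LieSubmodule.lieSpan_le.2 ?_)
                rintro _ rfl
                exact hvw
              intro a ha b hb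
              have h2 : A ⊔ LieSubmodule.lieSpan ℂ (gl n) {v} ≤ leftComap Y b := by
                refine sup_le (fun a ha => hXY (hX1 a ha b)) (LieSubmodule.lieSpan_le.2 ?_)
                rintro _ rfl
                exact h1 hb
              exact h2 ha
            · exact (le_sup_right : _ ≤ spanC A _ ⊔ _)
                (mkC_mem_spanC ha ((le_sup_left : B ≤ _) hb))
            · rintro _ rfl
              exact (le_sup_right : _ ≤ spanC A _ ⊔ _) (mkC_mem_spanC hvA hwB)
          rw [e]
          refine .step X (Fin.append μ ν) _ ih2 ⟨?_, fun x hx => ?_⟩ ⟨μ, hμ, ν, hν, rfl⟩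
          · rw [append_sub_rho]
            exact mkC_mem_weightSpace hv.weight hw.weight
          · obtain ⟨x₁, x₂, hx₁, hx₂, e⟩ := strictUpper_mkC hx v w
            rw [e]
            exact add_mem (hX1 _ (hv.upper x₁ hx₁) w) (hX2 v hvA _ (hw.upper x₂ hx₂))
      have h2 := key2 ⊤ hN
      have : spanC A (⊤ : LieSubmodule ℂ (gl m) N) ≤
          spanC (A ⊔ LieSubmodule.lieSpan ℂ (gl n) {v}) (⊤ : LieSubmodule ℂ (gl m) N) :=
        spanC_le fun a ha b hb => mkC_mem_spanC ((le_sup_left : A ≤ _) ha) hb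
      rwa [sup_eq_right.2 this] at h2
  have := key ⊤ hM
  rwa [show spanC (⊤ : LieSubmodule ℂ (gl n) M) (⊤ : LieSubmodule ℂ (gl m) N) = ⊤ from
    C_top _ fun v w => mkC_mem_spanC (LieSubmodule.mem_top v) (LieSubmodule.mem_top w)] at this

/-! ### Blocks -/

open Classical in
/-- The ideal of the center which is nilpotent on the block with index `c`. -/
def blockIdeal (n : ℕ) (c : ℤ) : Ideal (Subalgebra.center ℂ (Env n)) :=
  if 0 ≤ c ∧ c ≤ n then centralIdeal n (fundWeight n c) else ⊤

/-- With the unit ideal for indices outside 0, …, n, being killed by a power of it means being zero,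
and all indices are treated alike. -/
theorem hasGenChar_iff {c : ℤ} : HasGenChar n c M ↔ ∃ k : ℕ, Kills (blockIdeal n c ^ k) M := by
  by_cases hc : 0 ≤ c ∧ c ≤ n
  · rw [blockIdeal, if_pos hc]
    refine ⟨?_, fun h => Or.inr ⟨hc.1, hc.2, h⟩⟩
    rintro (h | ⟨_, _, h⟩)
    · exact ⟨0, fun z _ v => h _⟩
    · exact h
  · rw [blockIdeal, if_neg hc]
    refine ⟨?_, fun ⟨k, h⟩ => Or.inl fun v => ?_⟩
    · rintro (h | ⟨h0, h1, _⟩)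
      · exact ⟨0, fun z _ v => h _⟩
      · exact absurd ⟨h0, h1⟩ hc
    · have := h 1 (by rw [Ideal.top_pow]; trivial) v
      rwa [OneMemClass.coe_one, map_one] at this

theorem IsZeroOne.centralIdeal_eq_blockIdeal {c : ℤ} {μ : Fin n → ℂ} (h : IsZeroOne c μ) :
    centralIdeal n μ = blockIdeal n c := by
  rw [blockIdeal, if_pos h.bounds]
  exact h.centralIdeal_eq (isZeroOne_fundWeight h.bounds.1 h.bounds.2)

/-- Separation of central characters: containment of the ideals already forces μ to be a permutation
of e₁ + ⋯ + e_c. -/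
theorem isZeroOne_of_blockIdeal_le {c : ℤ} {μ : Fin n → ℂ} (h : blockIdeal n c ≤ centralIdeal n μ)
    (hμ : centralIdeal n μ ≠ ⊤) : IsZeroOne c μ := by
  by_cases hc : 0 ≤ c ∧ c ≤ n
  · rw [blockIdeal, if_pos hc] at h
    exact (isZeroOne_fundWeight hc.1 hc.2).of_map_eq (weight_eq_of_centralIdeal_le h hμ).symm
  · rw [blockIdeal, if_neg hc] at h
    exact absurd (top_le_iff.1 h) hμ

/-- A maximal ideal that does not contain the block ideal is coprime to it. -/
theorem isCoprime_of_not_isZeroOne {c : ℤ} {μ : Fin n → ℂ} (h : ¬ IsZeroOne c μ) :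
    centralIdeal n μ ⊔ blockIdeal n c = ⊤ := by
  by_cases hμ : centralIdeal n μ = ⊤
  · rw [hμ, top_sup_eq]
  · have := centralIdeal_isMaximal μ hμ
    refine this.1.2 _ (lt_of_le_of_ne le_sup_left fun e => h ?_)
    exact isZeroOne_of_blockIdeal_le (le_sup_right.trans e.ge) hμ

theorem sum_of_mem_intWt {c : ℤ} {μ : Fin n → ℂ}
    (h : (fun k => μ k - rho n k) ∈ intWt (rho n) c) : ∑ k, μ k = c := by
  obtain ⟨z, hz, h⟩ := h
  rw [← hz, Int.cast_sum]
  exact Finset.sum_congr rfl fun k _ => sub_left_injective (h k)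

theorem IsZeroOne.mem_intWt {c : ℤ} {μ : Fin n → ℂ} (h : IsZeroOne c μ) :
    (fun k => μ k - rho n k) ∈ intWt (rho n) c := by
  have : ∀ k, ∃ z : ℤ, μ k = z := fun k => by
    rcases h.1 k with h | h
    · exact ⟨0, by simp [h]⟩
    · exact ⟨1, by simp [h]⟩
  choose z hz using this
  refine ⟨z, ?_, fun k => congrArg (· - rho n k) (hz k)⟩
  have := h.2
  simp only [hz] at this
  exact_mod_cast this

theorem isZeroOne_of_pow_le {c : ℤ} {k : ℕ} {μ : Fin n → ℂ}
    (h : blockIdeal n c ^ k ≤ centralIdeal n μ) (hμ : centralIdeal n μ ≠ ⊤) : IsZeroOne c μ := by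
  have := (centralIdeal_isMaximal μ hμ).isPrime
  exact isZeroOne_of_blockIdeal_le (this.le_of_pow_le h) hμ

theorem filt_of_kills {c : ℤ} {k : ℕ} (h : catO n M) (hk : Kills (blockIdeal n c ^ k) M) :
    Filt {μ | IsZeroOne c μ} (⊤ : LieSubmodule ℂ (gl n) M) := by
  have := (catO_iff.1 h).filt (fun μ _ a b => Set.mem_univ _) hk
  have mono : ∀ {S S' : Set (Fin n → ℂ)} {P : LieSubmodule ℂ (gl n) M}, S ⊆ S' → Filt S P →
      Filt S' P := by
    intro S S' P hS hP
    induction hP with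
    | bot => exact .bot
    | step P μ v _ hv hμ ih => exact .step P μ v ih hv (hS hμ)
  exact mono (fun μ hμ => isZeroOne_of_pow_le hμ.2.1 hμ.2.2) this

/-- Integrality and degree of the weights are automatic in a block: its highest weights are zero-one
vectors of sum c minus ρ, and roots are integral of degree zero. -/
theorem block_iff {c : ℤ} : block n c M ↔ InO (intWt (rho n) c) M ∧
    ∃ k : ℕ, Kills (blockIdeal n c ^ k) M := by
  refine ⟨fun ⟨h, hc⟩ => ?_, fun ⟨h, hc⟩ => ⟨h.catO, hasGenChar_iff.2 hc⟩⟩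
  obtain ⟨k, hk⟩ := hasGenChar_iff.1 hc
  have hO := catO_iff.1 h
  refine ⟨⟨hO.fg, eq_top_iff.2 fun v _ => ?_, hO.nil⟩, k, hk⟩
  exact (filt_of_kills h hk).le_wtSub (rootClosed_intWt (rho n) c) (fun μ hμ => IsZeroOne.mem_intWt hμ)
    (LieSubmodule.mem_top v)

/-- Sort the factors: those of zero-one weights of sum c equal the block ideal and are collected in
a power, the others are coprime to it and so is their product. -/
theorem exists_split_list {c : ℤ} (l : List (Fin n → ℂ)) :
    ∃ (k : ℕ) (K : Ideal (Subalgebra.center ℂ (Env n))), K ⊔ blockIdeal n c = ⊤ ∧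
      blockIdeal n c ^ k * K ≤ (l.map (centralIdeal n)).prod := by
  induction l with
  | nil => exact ⟨0, ⊤, top_sup_eq _, by simp [Ideal.one_eq_top]⟩
  | cons μ l ih =>
    obtain ⟨k, K, hK, h⟩ := ih
    rw [List.map_cons, List.prod_cons]
    by_cases hμ : IsZeroOne c μ
    · refine ⟨k + 1, K, hK, ?_⟩
      rw [hμ.centralIdeal_eq_blockIdeal, pow_succ', mul_assoc]
      exact Ideal.mul_mono_right h
    · refine ⟨k, centralIdeal n μ * K, ?_, ?_⟩
      · rw [sup_comm, Ideal.sup_mul_eq_of_coprime_left, sup_comm, hK]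
        rw [sup_comm]
        exact isCoprime_of_not_isZeroOne hμ
      · rw [mul_left_comm]
        exact Ideal.mul_mono_right h

theorem exists_split {c : ℤ} (h : catO n M) :
    ∃ (k : ℕ) (K : Ideal (Subalgebra.center ℂ (Env n))), K ⊔ blockIdeal n c = ⊤ ∧
      Kills (blockIdeal n c ^ k * K) M := by
  have hf := (catO_iff.1 h).filt (I := ⊥) (fun μ _ a b => Set.mem_univ _) fun z hz v => by
    rw [(Submodule.mem_bot _).1 hz]
    simp
  obtain ⟨l, -, hl⟩ := hf.exists_list
  obtain ⟨k, K, hK, h⟩ := exists_split_list (c := c) l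
  exact ⟨k, K, hK, fun z hz v => hl z (h hz) v (LieSubmodule.mem_top v)⟩

/-- All layers of C(M, N) have concatenated zero-one weights, hence the one central ideal of index c
+ c'. -/
theorem C_kills {c c' : ℤ} {k k' : ℕ} (hM : catO n M) (hk : Kills (blockIdeal n c ^ k) M)
    (hN : catO m N) (hk' : Kills (blockIdeal m c' ^ k') N) :
    ∃ a : ℕ, Kills (blockIdeal (n + m) (c + c') ^ a) ((C n m).obj (M, N)) := by
  obtain ⟨l, hl, h⟩ := ((filt_of_kills hM hk).C (filt_of_kills hN hk')).exists_list
  have : ∃ a : ℕ, blockIdeal (n + m) (c + c') ^ a ≤ (l.map (centralIdeal (n + m))).prod := by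
    clear h
    induction l with
    | nil => exact ⟨0, le_rfl⟩
    | cons μ l ih =>
      obtain ⟨a, ha⟩ := ih fun ν hν => hl ν (List.mem_cons_of_mem _ hν)
      obtain ⟨μ₁, h1, μ₂, h2, e⟩ := hl μ List.mem_cons_self
      refine ⟨a + 1, ?_⟩
      rw [List.map_cons, List.prod_cons, pow_succ', e,
        (isZeroOne_append h1 h2).centralIdeal_eq_blockIdeal]
      exact Ideal.mul_mono_right ha
  obtain ⟨a, ha⟩ := this
  exact ⟨a, fun z hz v => h z (ha hz) v (LieSubmodule.mem_top v)⟩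

theorem exists_coprime_of_filt {c : ℤ} {S : Set (Fin n → ℂ)}
    (h : Filt S (⊤ : LieSubmodule ℂ (gl n) M)) (hS : ∀ μ ∈ S, ¬ IsZeroOne c μ) :
    ∃ K : Ideal (Subalgebra.center ℂ (Env n)), K ⊔ blockIdeal n c = ⊤ ∧ Kills K M := by
  obtain ⟨l, hl, h⟩ := h.exists_list
  refine ⟨_, ?_, fun z hz v => h z hz v (LieSubmodule.mem_top v)⟩
  clear h
  induction l with
  | nil => simp [Ideal.one_eq_top]
  | cons μ l ih =>
    rw [List.map_cons, List.prod_cons, sup_comm, Ideal.sup_mul_eq_of_coprime_left, sup_comm]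
    · exact ih fun ν hν => hl ν (List.mem_cons_of_mem _ hν)
    · rw [sup_comm]
      exact isCoprime_of_not_isZeroOne (hS μ (hl μ List.mem_cons_self))

/-- A layer of C(M, N) in the block c + c' would have zero-one parts by `IsZeroOne.of_append`, since
the degrees are c and c'. Its first part would have the central ideal of block c, which is
impossible as K is coprime to that ideal. -/
theorem C_kills_left {c c' : ℤ} {K : Ideal (Subalgebra.center ℂ (Env n))}
    (hM : InO (intWt (rho n) c) M) (hK : K ⊔ blockIdeal n c = ⊤) (hKM : Kills K M)
    (hN : InO (intWt (rho m) c') N) :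
    ∃ K' : Ideal (Subalgebra.center ℂ (Env (n + m))), K' ⊔ blockIdeal (n + m) (c + c') = ⊤ ∧
      Kills K' ((C n m).obj (M, N)) := by
  refine exists_coprime_of_filt ((hM.filt (rootClosed_intWt _ _) hKM).C
    (hN.filt (rootClosed_intWt _ _) (I := ⊥) fun z hz v => by
      rw [(Submodule.mem_bot _).1 hz]; simp)) ?_
  rintro _ ⟨μ, ⟨h1, h2, h3⟩, ν, ⟨h4, -, -⟩, rfl⟩ h
  have := (h.of_append (sum_of_mem_intWt h1) (sum_of_mem_intWt h4)).1.centralIdeal_eq_blockIdeal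
  exact h3 (top_le_iff.1 (hK ▸ sup_le h2 this.ge))

theorem C_kills_right {c c' : ℤ} {K : Ideal (Subalgebra.center ℂ (Env m))}
    (hM : InO (intWt (rho n) c) M) (hN : InO (intWt (rho m) c') N)
    (hK : K ⊔ blockIdeal m c' = ⊤) (hKN : Kills K N) :
    ∃ K' : Ideal (Subalgebra.center ℂ (Env (n + m))), K' ⊔ blockIdeal (n + m) (c + c') = ⊤ ∧
      Kills K' ((C n m).obj (M, N)) := by
  refine exists_coprime_of_filt ((hM.filt (rootClosed_intWt _ _) (I := ⊥) fun z hz v => by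
      rw [(Submodule.mem_bot _).1 hz]; simp).C (hN.filt (rootClosed_intWt _ _) hKN)) ?_
  rintro _ ⟨μ, ⟨h1, -, -⟩, ν, ⟨h4, h2, h3⟩, rfl⟩ h
  have := (h.of_append (sum_of_mem_intWt h1) (sum_of_mem_intWt h4)).2.centralIdeal_eq_blockIdeal
  exact h3 (top_le_iff.1 (hK ▸ sup_le h2 this.ge))

end GLn
end

noncomputable section

/-! ### Block components -/

namespace GLn

open LieMod

variable {n m : ℕ}

/-- `s` identifies `A'` with the component of `A` in the block with index `c`, and `r` is the
projection to it. -/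
structure IsComp (c : ℤ) {A' A : LieMod.{u} (gl n)} (s : A' ⟶ A) (r : A ⟶ A') : Prop where
  id : s ≫ r = 𝟙 A'
  kills : ∃ k : ℕ, Kills (blockIdeal n c ^ k) A'
  coprime : ∃ K : Ideal (Subalgebra.center ℂ (Env n)), K ⊔ blockIdeal n c = ⊤ ∧
    ∀ z ∈ K, ∀ v : A, toLin r v = 0 → act A (z : Env n) v = 0

theorem Kills.act_toLin {A B : LieMod.{u} (gl n)} {K : Ideal (Subalgebra.center ℂ (Env n))}
    (h : Kills K A) (f : A ⟶ B) {z : Subalgebra.center ℂ (Env n)} (hz : z ∈ K) (v : A) :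
    act B (z : Env n) (toLin f v) = 0 := by
  rw [← toLin_act, h z hz, map_zero]

theorem eq_zero_of_killed {M : LieMod.{u} (gl n)} {I J : Ideal (Subalgebra.center ℂ (Env n))}
    (h : I ⊔ J = ⊤) {v : M} (hI : ∀ z ∈ I, act M (z : Env n) v = 0)
    (hJ : ∀ z ∈ J, act M (z : Env n) v = 0) : v = 0 := by
  obtain ⟨a, ha, b, hb, e⟩ := Submodule.mem_sup.1 ((Ideal.eq_top_iff_one _).1 h)
  have h1 : act M ((a + b : Subalgebra.center ℂ (Env n)) : Env n) v = 0 := by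
    rw [AddMemClass.coe_add, map_add, LinearMap.add_apply, hI a ha, hJ b hb, add_zero]
  rwa [e, OneMemClass.coe_one, map_one] at h1

section

variable {c : ℤ} {A' A B' B : LieMod.{u} (gl n)} {s : A' ⟶ A} {r : A ⟶ A'} {s' : B' ⟶ B} {r' : B ⟶ B'}

theorem IsComp.r_s (h : IsComp c s r) (v : A') : toLin r (toLin s v) = v :=
  congrArg (fun f => toLin f v) h.id

theorem IsComp.r_sub (h : IsComp c s r) (v : A) : toLin r (v - toLin s (toLin r v)) = 0 := by
  rw [map_sub, h.r_s, sub_self]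

/-- Taking block components is natural. -/
theorem IsComp.natural (h : IsComp c s r) (h' : IsComp c s' r') (g : A ⟶ B) :
    r ≫ s ≫ g = g ≫ r' ≫ s' := by
  obtain ⟨k, hk⟩ := h.kills
  obtain ⟨k', hk'⟩ := h'.kills
  obtain ⟨K, hK, hKA⟩ := h.coprime
  obtain ⟨K', hK', hKB⟩ := h'.coprime
  ext v
  set w := v - toLin s (toLin r v) with hw
  -- Morphisms preserve the splitting: the complement of A maps to that of B (`e1`) and the
  -- component to the component (`e2`), because the obstructing vector is killed by two coprime
  -- ideals.
  have e1 : toLin r' (toLin g w) = 0 := by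
    refine eq_zero_of_killed (Ideal.sup_pow_eq_top (n := k') hK) (fun z hz => ?_)
      (fun z hz => hk' z hz _)
    rw [← toLin_act, ← toLin_act, hKA z hz w (h.r_sub v), map_zero, map_zero]
  have e2 : toLin g (toLin s (toLin r v)) -
      toLin s' (toLin r' (toLin g (toLin s (toLin r v)))) = 0 := by
    refine eq_zero_of_killed (Ideal.sup_pow_eq_top (n := k) hK')
      (fun z hz => hKB z hz _ (h'.r_sub _)) (fun z hz => ?_)
    have hz0 : act B (z : Env n) (toLin g (toLin s (toLin r v))) = 0 := by
      rw [← toLin_act, ← toLin_act, hk z hz, map_zero, map_zero]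
    rw [map_sub, ← toLin_act s', ← toLin_act r', hz0, map_zero, map_zero, sub_zero]
  change toLin g (toLin s (toLin r v)) = toLin s' (toLin r' (toLin g v))
  rw [sub_eq_zero.1 e2]
  rw [hw, map_sub, map_sub, sub_eq_zero] at e1
  rw [e1]

theorem isComp_id {k : ℕ} (h : Kills (blockIdeal n c ^ k) A) : IsComp c (𝟙 A) (𝟙 A) :=
  ⟨Category.id_comp _, ⟨k, h⟩, ⊤, top_sup_eq _, fun z _ v hv => by
    rw [show v = 0 from hv, map_zero]⟩

/-- By naturality the retractions also commute with the maps, so the primed sequence is a retract of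
an exact one. -/
theorem IsComp.isShortExact {D' D : LieMod.{u} (gl n)} {s'' : D' ⟶ D} {r'' : D ⟶ D'}
    (h : IsComp c s r) (h' : IsComp c s' r') (h'' : IsComp c s'' r'') {f : A ⟶ B} {g : B ⟶ D}
    (hfg : IsShortExact f g) {f' : A' ⟶ B'} {g' : B' ⟶ D'} (hf : f' ≫ s' = s ≫ f)
    (hg : g' ≫ s'' = s' ≫ g) : IsShortExact f' g' := by
  have hf : ∀ v, toLin s' (toLin f' v) = toLin f (toLin s v) := fun v =>
    congrArg (fun f => toLin f v) hf
  have hg : ∀ v, toLin s'' (toLin g' v) = toLin g (toLin s' v) := fun v =>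
    congrArg (fun f => toLin f v) hg
  have inj : ∀ {v w : A'}, toLin s v = toLin s w → v = w := fun {v w} e => by
    rw [← h.r_s v, e, h.r_s]
  have inj'' : ∀ {v w : D'}, toLin s'' v = toLin s'' w → v = w := fun {v w} e => by
    rw [← h''.r_s v, e, h''.r_s]
  have nf : ∀ v, toLin r' (toLin f v) = toLin f' (toLin r v) := fun v => by
    have := congrArg (fun f => toLin r' (toLin f v)) (h.natural h' f)
    change toLin r' (toLin f (toLin s (toLin r v))) =
      toLin r' (toLin s' (toLin r' (toLin f v))) at this
    rw [h'.r_s, ← hf, h'.r_s] at this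
    exact this.symm
  have ng : ∀ v, toLin r'' (toLin g v) = toLin g' (toLin r' v) := fun v => by
    have := congrArg (fun f => toLin r'' (toLin f v)) (h'.natural h'' g)
    change toLin r'' (toLin g (toLin s' (toLin r' v))) =
      toLin r'' (toLin s'' (toLin r'' (toLin g v))) at this
    rw [h''.r_s, ← hg, h''.r_s] at this
    exact this.symm
  refine ⟨fun v w e => inj (hfg.1 ?_), fun v => ⟨fun e => ?_, ?_⟩, fun v => ?_⟩
  · rw [← hf, ← hf, e]
  · obtain ⟨w, hw⟩ := (hfg.2.1 (toLin s' v)).1 (by rw [← hg, e, map_zero])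
    exact ⟨toLin r w, by rw [← nf, hw, h'.r_s]⟩
  · rintro ⟨w, rfl⟩
    refine inj'' ?_
    rw [hg, hf, map_zero]
    exact (hfg.2.1 _).2 ⟨_, rfl⟩
  · obtain ⟨w, hw⟩ := hfg.2.2 (toLin s'' v)
    exact ⟨toLin r' w, by rw [← ng, hw, h''.r_s]⟩

/-- The complement of a block component. -/
def compl (r : A ⟶ A') : LieMod.{u} (gl n) := ofSub (toLin r).ker

/-- The inclusion of the complement. -/
def complIncl (r : A ⟶ A') : compl r ⟶ A := ⟨(toLin r).ker.incl⟩

/-- The projection to the complement. -/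
def IsComp.complProj (h : IsComp c s r) : A ⟶ compl r :=
  ⟨{ toFun := fun v => ⟨v - toLin s (toLin r v), (LieModuleHom.mem_ker (f := toLin r)).2 (h.r_sub v)⟩
     map_add' := fun v w => Subtype.ext (by
      change v + w - toLin s (toLin r (v + w)) =
        (v - toLin s (toLin r v)) + (w - toLin s (toLin r w))
      rw [map_add, map_add]; abel)
     map_smul' := fun t v => Subtype.ext (by
      change t • v - toLin s (toLin r (t • v)) = t • (v - toLin s (toLin r v))
      rw [map_smul, map_smul, smul_sub])
     map_lie' := fun {x v} => Subtype.ext (by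
      change ⁅x, v⁆ - toLin s (toLin r ⁅x, v⁆) = ⁅x, v - toLin s (toLin r v)⁆
      rw [LieModuleHom.map_lie, LieModuleHom.map_lie, lie_sub]) }⟩

theorem IsComp.complProj_surjective (h : IsComp c s r) : Function.Surjective (toLin h.complProj) := by
  rintro ⟨v, hv⟩
  refine ⟨v, Subtype.ext ?_⟩
  change v - toLin s (toLin r v) = v
  rw [(LieModuleHom.mem_ker (f := toLin r)).1 hv, map_zero, sub_zero]

theorem IsComp.surjective (h : IsComp c s r) : Function.Surjective (toLin r) :=
  fun v => ⟨toLin s v, h.r_s v⟩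

theorem IsComp.exists_kills_compl (h : IsComp c s r) :
    ∃ K : Ideal (Subalgebra.center ℂ (Env n)), K ⊔ blockIdeal n c = ⊤ ∧ Kills K (compl r) := by
  obtain ⟨K, hK, hK'⟩ := h.coprime
  refine ⟨K, hK, fun z hz v => Subtype.ext ?_⟩
  change toLin (complIncl r) (act (compl r) (z : Env n) v) = 0
  rw [toLin_act]
  exact hK' z hz v.1 ((LieModuleHom.mem_ker (f := toLin r)).1 v.2)

end

theorem act_mkC_left {P A : LieMod.{u} (gl n)} {B : LieMod.{u} (gl m)}
    {K : Ideal (Subalgebra.center ℂ (Env (n + m)))} (h : Kills K ((C n m).obj (P, B))) (f : P ⟶ A)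
    {z : Subalgebra.center ℂ (Env (n + m))} (hz : z ∈ K) (v : P) (w : B) :
    act ((C n m).obj (A, B)) (z : Env (n + m)) (mkC n m (toLin f v) w) = 0 :=
  h.act_toLin ((C n m).map (Prod.mkHom f (𝟙 B))) hz (mkC n m v w)

theorem act_mkC_right {P B : LieMod.{u} (gl m)} {A : LieMod.{u} (gl n)}
    {K : Ideal (Subalgebra.center ℂ (Env (n + m)))} (h : Kills K ((C n m).obj (A, P))) (f : P ⟶ B)
    {z : Subalgebra.center ℂ (Env (n + m))} (hz : z ∈ K) (v : A) (w : P) :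
    act ((C n m).obj (A, B)) (z : Env (n + m)) (mkC n m v (toLin f w)) = 0 :=
  h.act_toLin ((C n m).map (Prod.mkHom (𝟙 A) f)) hz (mkC n m v w)

/-- Induction takes block components to block components. -/
theorem IsComp.C {c c' : ℤ} {A' A : LieMod.{u} (gl n)} {B' B : LieMod.{u} (gl m)} {s : A' ⟶ A}
    {r : A ⟶ A'} {s' : B' ⟶ B} {r' : B ⟶ B'} (h : IsComp c s r) (h' : IsComp c' s' r')
    (hA : InO (intWt (rho n) c) A) (hB : InO (intWt (rho m) c') B) :
    IsComp (c + c') ((C n m).map (Prod.mkHom s s')) ((C n m).map (Prod.mkHom r r')) := by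
  obtain ⟨k, hk⟩ := h.kills
  obtain ⟨k', hk'⟩ := h'.kills
  refine ⟨?_, C_kills (hA.of_surjective r h.surjective).catO hk
    (hB.of_surjective r' h'.surjective).catO hk', ?_⟩
  · rw [← Functor.map_comp]
    have : Prod.mkHom s s' ≫ Prod.mkHom r r' = 𝟙 (A', B') := Prod.ext h.id h'.id
    rw [this]
    exact CategoryTheory.Functor.map_id _ _
  · obtain ⟨K, hK, hKA⟩ := h.exists_kills_compl
    obtain ⟨K', hK', hKB⟩ := h'.exists_kills_compl
    obtain ⟨K₁, h1, hK₁⟩ := C_kills_left (hA.of_surjective _ h.complProj_surjective) hK hKA hB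
    obtain ⟨K₂, h2, hK₂⟩ := C_kills_right hA (hB.of_surjective _ h'.complProj_surjective) hK' hKB
    refine ⟨K₁ * K₂, ?_, fun z hz x hx => ?_⟩
    · rw [sup_comm, Ideal.sup_mul_eq_of_coprime_left, sup_comm, h2]
      rw [sup_comm, h1]
    · have hz1 : z ∈ K₁ := (Ideal.mul_le_left : K₁ * K₂ ≤ K₁) hz
      have hz2 : z ∈ K₂ := (Ideal.mul_le_right : K₁ * K₂ ≤ K₂) hz
      let X : LieSubmodule ℂ (gl (n + m)) ((GLn.C n m).obj (A, B)) := centralComap z ⊥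
      have hX : ∀ {y : (GLn.C n m).obj (A, B)}, y ∈ X ↔ act _ (z : Env (n + m)) y = 0 := fun {y} =>
        mem_centralComap.trans (LieSubmodule.mem_bot _)
      have hl : ∀ v : compl r, ∀ w : B, mkC n m (toLin (complIncl r) v) w ∈ X := fun v w =>
        hX.2 (act_mkC_left hK₁ (complIncl r) hz1 v w)
      have hr : ∀ v : A, ∀ w : compl r', mkC n m v (toLin (complIncl r') w) ∈ X := fun v w =>
        hX.2 (act_mkC_right hK₂ (complIncl r') hz2 v w)
      let Φ : (GLn.C n m).obj (A, B) →ₗ⁅ℂ, gl (n + m)⁆ (GLn.C n m).obj (A, B) :=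
        LieModuleHom.id - (toLin ((GLn.C n m).map (Prod.mkHom s s'))).comp
          (toLin ((GLn.C n m).map (Prod.mkHom r r')))
      have hΦ : ∀ y, Φ y = y - toLin ((GLn.C n m).map (Prod.mkHom s s'))
        (toLin ((GLn.C n m).map (Prod.mkHom r r')) y) := fun y => rfl
      have htop : X.comap Φ = ⊤ := by
        refine C_top _ fun v w => ?_
        change Φ (mkC n m v w) ∈ X
        -- Both summands have one argument in a complement, so they are killed by K₁ and K₂
        -- respectively, and z lies in both ideals.
        have e : Φ (mkC n m v w) = mkC n m (v - toLin s (toLin r v)) w +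
            mkC n m (toLin s (toLin r v)) (w - toLin s' (toLin r' w)) := by
          rw [hΦ, C_map_mkC, C_map_mkC]
          change mkCLin A B v w - mkCLin A B _ _ = mkCLin A B (v - _) w + mkCLin A B _ (w - _)
          rw [map_sub, map_sub, LinearMap.sub_apply]
          abel
        rw [e]
        exact add_mem (hl (toLin h.complProj v) w) (hr _ (toLin h'.complProj w))
      have : x ∈ X.comap Φ := htop ▸ LieSubmodule.mem_top x
      have : Φ x ∈ X := this
      rw [hΦ, hx, map_zero, sub_zero] at this
      exact hX.1 this

/-- Write 1 = a + b with a in K and b in the k-th power of the block ideal. As the product of these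
ideals kills M, the element a acts as the projection to the block component. -/
theorem exists_isComp_proj {c : ℤ} {M : LieMod.{u} (gl n)} {k : ℕ}
    {K : Ideal (Subalgebra.center ℂ (Env n))} (hK : K ⊔ blockIdeal n c = ⊤)
    (h : Kills (blockIdeal n c ^ k * K) M) :
    ∃ r, IsComp c ((projIncl n c).app M) r := by
  obtain ⟨a, ha, b, hb, e⟩ := Submodule.mem_sup.1
    ((Ideal.eq_top_iff_one _).1 (Ideal.sup_pow_eq_top (n := k) hK))
  have hab : ∀ v : M, act M (a : Env n) v + act M (b : Env n) v = v := fun v => by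
    rw [← LinearMap.add_apply, ← map_add, ← AddMemClass.coe_add, e, OneMemClass.coe_one, map_one]
    rfl
  have hmul : ∀ (x y : Subalgebra.center ℂ (Env n)) (v : M),
      act M (x : Env n) (act M (y : Env n) v) = act M ((x * y : Subalgebra.center ℂ (Env n)) : Env n) v :=
    fun x y v => by rw [MulMemClass.coe_mul, map_mul]; rfl
  let P : LieSubmodule ℂ (gl n) M := ⨅ z ∈ blockIdeal n c ^ k, centralComap z ⊥
  have hP : ∀ {v}, v ∈ P ↔ ∀ z ∈ blockIdeal n c ^ k, act M (z : Env n) v = 0 := fun {v} => by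
    simp only [P, LieSubmodule.mem_iInf, mem_centralComap, LieSubmodule.mem_bot]
  have hPle : P ≤ projSub n c M := le_sSup (hasGenChar_iff.2 ⟨k, fun z hz v => Subtype.ext (by
    let g : ofSub P ⟶ M := ⟨P.incl⟩
    change toLin g (act (ofSub P) (z : Env n) v) = 0
    rw [toLin_act]
    exact hP.1 v.2 z hz)⟩)
  -- A submodule with the given generalized character may be killed only by a higher power k'. Still
  -- z v vanishes for z in the k-th power, being killed by K and by that k'-th power.
  have hleP : projSub n c M ≤ P := by
    refine sSup_le fun Q hQ v hv => hP.2 fun z hz => ?_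
    obtain ⟨k', hk'⟩ := hasGenChar_iff.1 hQ
    have hv' : ∀ z ∈ blockIdeal n c ^ k', act M (z : Env n) v = 0 := fun z hz => by
      let g : ofSub Q ⟶ M := ⟨Q.incl⟩
      let v' : ofSub Q := ⟨v, hv⟩
      exact hk'.act_toLin g hz v'
    refine eq_zero_of_killed (Ideal.sup_pow_eq_top (n := k') hK) (fun y hy => ?_) fun y hy => ?_
    · rw [hmul, mul_comm]
      exact h _ (Ideal.mul_mem_mul hz hy) v
    · rw [hmul, mul_comm, ← hmul, hv' y hy, map_zero]
  let r : M ⟶ (proj n c).obj M :=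
    ⟨{ toFun := fun v => ⟨act M (a : Env n) v, hPle (hP.2 fun z hz => by
          rw [hmul]; exact h _ (Ideal.mul_mem_mul hz ha) v)⟩
       map_add' := fun v w => Subtype.ext (map_add _ v w)
       map_smul' := fun t v => Subtype.ext (map_smul _ t v)
       map_lie' := fun {x v} => Subtype.ext (act_center_lie a x v) }⟩
  refine ⟨r, ?_, ⟨k, fun z hz v => Subtype.ext ?_⟩, K, hK, fun z hz v hv => ?_⟩
  · ext v
    refine Subtype.ext ?_
    change act M (a : Env n) v.1 = v.1
    have := hab v.1
    rwa [hP.1 (hleP v.2) b hb, add_zero] at this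
  · change toLin ((projIncl n c).app M) (act ((proj n c).obj M) (z : Env n) v) = 0
    rw [toLin_act]
    exact hP.1 (hleP v.2) z hz
  · have h1 : act M (a : Env n) v = 0 := congrArg Subtype.val hv
    have h2 := hab v
    rw [h1, zero_add] at h2
    have h3 : act M (z : Env n) (act M (b : Env n) v) = 0 := by
      rw [hmul, mul_comm]
      exact h _ (Ideal.mul_mem_mul hb hz) v
    rwa [h2] at h3

theorem exists_isComp_proj_of_catO (c : ℤ) {M : LieMod.{u} (gl n)} (h : catO n M) :
    ∃ r, IsComp c ((projIncl n c).app M) r := by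
  obtain ⟨k, K, hK, hM⟩ := exists_split (c := c) h
  exact exists_isComp_proj hK hM

/-- The projection of a module of the category `O` to a block. -/
theorem block_proj {c : ℤ} {M : LieMod.{u} (gl n)} (h : catO n M) : block n c ((proj n c).obj M) := by
  obtain ⟨r, hr⟩ := exists_isComp_proj_of_catO c h
  exact ⟨((catO_iff.1 h).of_surjective r hr.surjective).catO, hasGenChar_iff.2 hr.kills⟩

/-! ### Block components of functors -/

section Functors

variable {X : Type*} [Category X] {A' B' D' A B D : X ⥤ LieMod.{u} (gl n)} {c : ℤ}

/-- `s` identifies `A'` with a block component of `A` pointwise. -/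
def IsCompFunctor (c : ℤ) (s : A' ⟶ A) : Prop := ∀ x, ∃ r, IsComp c (s.app x) r

/-- Retractions chosen pointwise are automatically natural, by `IsComp.natural`. -/
theorem IsCompFunctor.exists_retraction {s : A' ⟶ A} (h : IsCompFunctor c s) :
    ∃ r : A ⟶ A', ∀ x, IsComp c (s.app x) (r.app x) := by
  choose r hr using h
  refine ⟨⟨r, fun x y g => ?_⟩, hr⟩
  have h1 := (hr x).natural (hr y) (A.map g)
  rw [← s.naturality] at h1
  have h2 := congrArg (fun f => f ≫ r y) h1
  simp only [Category.assoc, (hr y).id, Category.comp_id] at h2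
  exact h2.symm

/-- The block components of a short exact sequence form a direct summand of it. -/
theorem IsCompFunctor.exists_summand {s₁ : A' ⟶ A} {s₂ : B' ⟶ B} {s₃ : D' ⟶ D}
    (h₁ : IsCompFunctor c s₁) (h₂ : IsCompFunctor c s₂) (h₃ : IsCompFunctor c s₃)
    {α : A ⟶ B} {β : B ⟶ D} (hαβ : IsShortExactFunctors α β) :
    ∃ (α' : A' ⟶ B') (β' : B' ⟶ D'), IsShortExactFunctors α' β' ∧
      IsDirectSummand α' β' α β s₁ s₂ s₃ := by
  obtain ⟨r₁, hr₁⟩ := h₁.exists_retraction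
  obtain ⟨r₂, hr₂⟩ := h₂.exists_retraction
  obtain ⟨r₃, hr₃⟩ := h₃.exists_retraction
  have e₁ : s₁ ≫ r₁ = 𝟙 _ := NatTrans.ext (funext fun x => (hr₁ x).id)
  have e₂ : s₂ ≫ r₂ = 𝟙 _ := NatTrans.ext (funext fun x => (hr₂ x).id)
  have e₃ : s₃ ≫ r₃ = 𝟙 _ := NatTrans.ext (funext fun x => (hr₃ x).id)
  have nα : r₁ ≫ s₁ ≫ α = α ≫ r₂ ≫ s₂ :=
    NatTrans.ext (funext fun x => (hr₁ x).natural (hr₂ x) (α.app x))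
  have nβ : r₂ ≫ s₂ ≫ β = β ≫ r₃ ≫ s₃ :=
    NatTrans.ext (funext fun x => (hr₂ x).natural (hr₃ x) (β.app x))
  have k1 : (s₁ ≫ α ≫ r₂) ≫ s₂ = s₁ ≫ α := by
    rw [Category.assoc, Category.assoc, ← nα, ← Category.assoc, e₁, Category.id_comp]
  have k2 : (s₂ ≫ β ≫ r₃) ≫ s₃ = s₂ ≫ β := by
    rw [Category.assoc, Category.assoc, ← nβ, ← Category.assoc, e₂, Category.id_comp]
  refine ⟨s₁ ≫ α ≫ r₂, s₂ ≫ β ≫ r₃, fun x => ?_, ⟨k1, k2⟩, r₁, r₂, r₃, ⟨?_, ?_⟩, e₁, e₂, e₃⟩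
  · exact (hr₁ x).isShortExact (hr₂ x) (hr₃ x) (hαβ x) (congrArg (fun t => t.app x) k1)
      (congrArg (fun t => t.app x) k2)
  · have := congrArg (fun t => t ≫ r₂) nα
    simp only [Category.assoc, e₂, Category.comp_id] at this
    exact this.symm
  · have := congrArg (fun t => t ≫ r₃) nβ
    simp only [Category.assoc, e₃, Category.comp_id] at this
    exact this.symm

end Functors

end GLn
end

noncomputable section

/-! ### Exterior powers of an extension -/

namespace LieMod

variable {L : Type} [LieRing L] [LieAlgebra ℂ L]

/-- The module given by a submodule. -/
def subObj {M : LieMod.{u} L} (W : LieSubmodule ℂ L M) : LieMod.{u} L := ⟨W⟩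

/-- The inclusion between submodules. -/
def subIncl {M : LieMod.{u} L} {W W' : LieSubmodule ℂ L M} (h : W ≤ W') : subObj W ⟶ subObj W' :=
  ⟨LieSubmodule.inclusion h⟩

/-- The bilinear map `(v, w) ↦ v ⊗ w`. -/
def tm₂ (A B : LieMod.{u} L) : A →ₗ[ℂ] B →ₗ[ℂ] tensor.obj (A, B) := TensorProduct.mk ℂ A B

theorem lie_tm₂ {A B : LieMod.{u} L} (x : L) (v : A) (w : B) :
    ⁅x, tm₂ A B v w⁆ = tm₂ A B ⁅x, v⁆ w + tm₂ A B v ⁅x, w⁆ :=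
  TensorProduct.LieModule.lie_tmul_right x v w

theorem tm₂_top {A B : LieMod.{u} L} (S : Submodule ℂ (tensor.obj (A, B)))
    (h : ∀ v w, tm₂ A B v w ∈ S) (t : tensor.obj (A, B)) : t ∈ S := by
  induction t using TensorProduct.induction_on with
  | zero => exact zero_mem S
  | tmul v w => exact h v w
  | add t t' ht ht' => exact add_mem ht ht'

/-- The linear isomorphism Ψ need only be equivariant up to components of smaller index. The vectors
with coordinates of index below k then form submodules W_k, and the coordinate k is an equivariant
map on W_{k+1} with kernel W_k. -/
theorem exists_filtration_of_triangular {M : LieMod.{u} L} {a : ℕ} {D : Fin (a + 1) → LieMod.{u} L}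
    (Ψ : ((k : Fin (a + 1)) → D k) ≃ₗ[ℂ] M)
    (hΨ : ∀ (x : L) (k : Fin (a + 1)) (s : D k) (i : Fin (a + 1)), k ≤ i →
      Ψ.symm (⁅x, Ψ (Pi.single k s)⁆ - Ψ (Pi.single k ⁅x, s⁆)) i = 0) :
    ∃ W : Fin (a + 2) → LieSubmodule ℂ L M, W 0 = ⊥ ∧ W (Fin.last (a + 1)) = ⊤ ∧
      ∀ k : Fin (a + 1), ∃ (hk : W k.castSucc ≤ W k.succ) (q : subObj (W k.succ) ⟶ D k),
        IsShortExact (subIncl hk) q := by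
  -- On vectors without coordinates above i, the i-th coordinate is equivariant: contributions of
  -- smaller indices cannot rise to i.
  have key (x : L) (v : M) (i : Fin (a + 1)) (hv : ∀ l, i < l → Ψ.symm v l = 0) :
      Ψ.symm ⁅x, v⁆ i = ⁅x, Ψ.symm v i⁆ := by
    have e : v = ∑ k, Ψ (Pi.single k (Ψ.symm v k)) := by
      rw [← map_sum, Finset.univ_sum_single, LinearEquiv.apply_symm_apply]
    have e2 : ⁅x, v⁆ = ∑ k, ⁅x, Ψ (Pi.single k (Ψ.symm v k))⁆ := by
      conv_lhs => rw [e]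
      exact map_sum (LieModule.toEnd ℂ L M x) _ _
    have e3 (k : Fin (a + 1)) (s : D k) (hk : k ≤ i) :
        Ψ.symm ⁅x, Ψ (Pi.single k s)⁆ i = (Pi.single k ⁅x, s⁆ : (k : Fin (a + 1)) → D k) i := by
      have := hΨ x k s i hk
      rwa [map_sub, Pi.sub_apply, LinearEquiv.symm_apply_apply, sub_eq_zero] at this
    rw [e2, map_sum, Finset.sum_apply, Finset.sum_eq_single i]
    · rw [e3 i _ le_rfl, Pi.single_eq_same]
    · intro k _ hk
      rcases lt_or_gt_of_ne hk with h | h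
      · rw [e3 k _ h.le, Pi.single_eq_of_ne hk.symm]
      · rw [hv k h, Pi.single_zero, map_zero, lie_zero, map_zero, Pi.zero_apply]
    · simp
  let W (k : Fin (a + 2)) : LieSubmodule ℂ L M :=
    { carrier := {v | ∀ i : Fin (a + 1), (k : ℕ) ≤ i → Ψ.symm v i = 0}
      add_mem' := fun {v w} hv hw i hi => by rw [map_add, Pi.add_apply, hv i hi, hw i hi, add_zero]
      zero_mem' := fun i _ => by rw [map_zero, Pi.zero_apply]
      smul_mem' := fun c v hv i hi => by rw [map_smul, Pi.smul_apply, hv i hi, smul_zero]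
      lie_mem := fun {x v} hv i hi => by
        rw [key x v i fun l hl => hv l (hi.trans (Fin.le_def.1 hl.le)), hv i hi, lie_zero] }
  have hW {k : Fin (a + 2)} {v : M} : v ∈ W k ↔ ∀ i : Fin (a + 1), (k : ℕ) ≤ i → Ψ.symm v i = 0 :=
    Iff.rfl
  have mono (k : Fin (a + 1)) : W k.castSucc ≤ W k.succ := fun v hv =>
    hW.2 fun i hi => hW.1 hv i ((Nat.le_succ _).trans ((Fin.val_succ k).symm.trans_le hi))
  refine ⟨W, ?_, ?_, fun k => ⟨mono k, ?_⟩⟩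
  · refine (LieSubmodule.eq_bot_iff _).2 fun v hv => ?_
    exact Ψ.symm.map_eq_zero_iff.1 (funext fun i => hW.1 hv i (Nat.zero_le _))
  · refine eq_top_iff.2 fun v _ => hW.2 fun i hi => ?_
    exact absurd hi (not_le.2 i.2)
  · let q : subObj (W k.succ) ⟶ D k :=
      ⟨{ toFun := fun v => Ψ.symm v.1 k
         map_add' := fun v w => congrFun (map_add Ψ.symm v.1 w.1) k
         map_smul' := fun c v => congrFun (map_smul Ψ.symm c v.1) k
         map_lie' := fun {x v} => key x v.1 k fun l hl => v.2 l hl }⟩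
    refine ⟨q, LieSubmodule.inclusion_injective (mono k), fun v => ⟨fun hv => ?_, ?_⟩, fun s => ?_⟩
    · refine ⟨⟨v.1, hW.2 fun i hi => ?_⟩, rfl⟩
      rcases hi.eq_or_lt with h | h
      · obtain rfl : k = i := Fin.ext h
        exact hv
      · exact hW.1 v.2 i h
    · rintro ⟨w, rfl⟩
      exact hW.1 w.2 k le_rfl
    · refine ⟨⟨Ψ (Pi.single k s), hW.2 fun i hi => ?_⟩, ?_⟩
      · rw [LinearEquiv.symm_apply_apply, Pi.single_eq_of_ne]
        rintro rfl
        rw [Fin.val_succ] at hi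
        omega
      · change Ψ.symm (Ψ (Pi.single k s)) k = s
        rw [LinearEquiv.symm_apply_apply, Pi.single_eq_same]

/-! ### Exterior powers of an extension of B by A -/

section ExtPow

variable {A B V : LieMod.{0} L} {i j k a : ℕ}

/-- The inclusion of the exterior power in the exterior algebra. -/
def extVal : extPow k V →ₗ[ℂ] ExteriorAlgebra ℂ V := (⋀[ℂ]^k V).subtype

/-- Elements of the exterior power. -/
def extMk (x : ExteriorAlgebra ℂ V) (hx : x ∈ ⋀[ℂ]^k V) : extPow k V := ⟨x, hx⟩

theorem extVal_mk (x : ExteriorAlgebra ℂ V) (hx : x ∈ ⋀[ℂ]^k V) : extVal (extMk x hx) = x := rfl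

theorem extVal_mem (x : extPow k V) : extVal x ∈ ⋀[ℂ]^k V := x.2

theorem extVal_injective : Function.Injective (extVal : extPow k V →ₗ[ℂ] ExteriorAlgebra ℂ V) :=
  Subtype.val_injective

/-- The action on the exterior algebra by derivations. -/
abbrev extAct (V : LieMod.{0} L) (x : L) : Module.End ℂ (ExteriorAlgebra ℂ V) :=
  extDeriv (LieModule.toEnd ℂ L V x)

theorem extVal_lie (x : L) (v : extPow k V) : extVal ⁅x, v⁆ = extAct V x (extVal v) := rfl

theorem finrank_extPow [Module.Finite ℂ V] :
    Module.finrank ℂ (extPow k V) = (Module.finrank ℂ V).choose k :=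
  exteriorPower.finrank_eq ℂ k

instance extPow_finite [Module.Finite ℂ V] : Module.Finite ℂ (extPow k V) :=
  exteriorPower.instFinite

theorem ι_mul_mem {x : ExteriorAlgebra ℂ V} (v : V) (hx : x ∈ ⋀[ℂ]^k V) :
    ExteriorAlgebra.ι ℂ v * x ∈ ⋀[ℂ]^(k + 1) V := by
  change _ ∈ LinearMap.range (ExteriorAlgebra.ι ℂ) ^ (k + 1)
  rw [pow_succ']
  exact Submodule.mul_mem_mul ⟨v, rfl⟩ hx

theorem mul_ι_mem {x : ExteriorAlgebra ℂ V} (v : V) (hx : x ∈ ⋀[ℂ]^k V) :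
    x * ExteriorAlgebra.ι ℂ v ∈ ⋀[ℂ]^(k + 1) V := by
  change _ ∈ LinearMap.range (ExteriorAlgebra.ι ℂ) ^ (k + 1)
  rw [pow_succ]
  exact Submodule.mul_mem_mul hx ⟨v, rfl⟩

theorem ι_mul_eq {x : ExteriorAlgebra ℂ V} (v : V) (hx : x ∈ ⋀[ℂ]^k V) :
    ExteriorAlgebra.ι ℂ v * x = (-1 : ℂ) ^ k • (x * ExteriorAlgebra.ι ℂ v) := by
  induction hx using Submodule.pow_induction_on_left' with
  | algebraMap r => rw [pow_zero, one_smul, Algebra.commutes]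
  | add x y i hx hy ihx ihy => rw [mul_add, add_mul, ihx, ihy, smul_add]
  | mem_mul m hm i x hx ih =>
    obtain ⟨w, rfl⟩ := hm
    have h := eq_neg_of_add_eq_zero_left (ExteriorAlgebra.ι_add_mul_swap (R := ℂ) v w)
    rw [← mul_assoc, h, neg_mul, mul_assoc, ih, mul_smul_comm, pow_succ, mul_assoc, mul_neg_one,
      neg_smul]

variable (α : A ⟶ V) (σ : B →ₗ[ℂ] V)

/-- The multiplication `Λⁱ A ⊗ Λʲ B → Λ V`. -/
def mulLin (i j : ℕ) : tensor.obj (extPow i A, extPow j B) →ₗ[ℂ] ExteriorAlgebra ℂ V :=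
  TensorProduct.lift ((LinearMap.mul ℂ (ExteriorAlgebra ℂ V)).compl₁₂
    ((ExteriorAlgebra.map (toLin α).toLinearMap).toLinearMap ∘ₗ extVal)
    ((ExteriorAlgebra.map σ).toLinearMap ∘ₗ extVal))

theorem mulLin_tm₂ (v : extPow i A) (w : extPow j B) : mulLin α σ i j (tm₂ _ _ v w) =
    ExteriorAlgebra.map (toLin α).toLinearMap (extVal v) * ExteriorAlgebra.map σ (extVal w) := rfl

theorem mul_mem_range_mulLin {x : ExteriorAlgebra ℂ A} {y : ExteriorAlgebra ℂ B}
    (hx : x ∈ ⋀[ℂ]^i A) (hy : y ∈ ⋀[ℂ]^j B) :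
    ExteriorAlgebra.map (toLin α).toLinearMap x * ExteriorAlgebra.map σ y ∈
      LinearMap.range (mulLin α σ i j) :=
  ⟨tm₂ _ _ (extMk x hx) (extMk y hy), rfl⟩

theorem map_mem_exteriorPower {W : Type*} [AddCommGroup W] [Module ℂ W] (f : W →ₗ[ℂ] V)
    {x : ExteriorAlgebra ℂ W} (hx : x ∈ ⋀[ℂ]^k W) : ExteriorAlgebra.map f x ∈ ⋀[ℂ]^k V := by
  induction hx using Submodule.pow_induction_on_left' with
  | algebraMap r => rw [AlgHom.commutes]; exact Submodule.algebraMap_mem r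
  | add x y i hx hy ihx ihy => rw [map_add]; exact add_mem ihx ihy
  | mem_mul m hm i x hx ih =>
    obtain ⟨w, rfl⟩ := hm
    rw [map_mul, ExteriorAlgebra.map_apply_ι]
    exact ι_mul_mem _ ih

theorem mulLin_mem (t : tensor.obj (extPow i A, extPow j B)) :
    mulLin α σ i j t ∈ ⋀[ℂ]^(i + j) V := by
  refine tm₂_top ((⋀[ℂ]^(i + j) V).comap (mulLin α σ i j)) (fun v w => ?_) t
  rw [Submodule.mem_comap, mulLin_tm₂]
  change _ ∈ LinearMap.range (ExteriorAlgebra.ι ℂ) ^ (i + j)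
  rw [pow_add]
  exact Submodule.mul_mem_mul (map_mem_exteriorPower _ (extVal_mem v))
    (map_mem_exteriorPower _ (extVal_mem w))

theorem extAct_map (x : L) (y : ExteriorAlgebra ℂ A) :
    extAct V x (ExteriorAlgebra.map (toLin α).toLinearMap y) =
      ExteriorAlgebra.map (toLin α).toLinearMap (extAct A x y) := by
  induction y using ExteriorAlgebra.induction with
  | algebraMap r => rw [AlgHom.commutes, extDeriv_algebraMap, extDeriv_algebraMap, map_zero]
  | ι v =>
    rw [ExteriorAlgebra.map_apply_ι, extDeriv_ι, extDeriv_ι, ExteriorAlgebra.map_apply_ι]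
    exact congrArg _ ((toLin α).map_lie x v).symm
  | mul a b ha hb => rw [map_mul, extDeriv_mul, extDeriv_mul, map_add, map_mul, map_mul, ha, hb]
  | add a b ha hb => rw [map_add, map_add, map_add, map_add, ha, hb]

/-- Products of an element of the image of `A` and of elements of the image of `Λ B`. -/
def lowMul : ℕ → Submodule ℂ (ExteriorAlgebra ℂ V)
  | 0 => ⊥
  | j + 1 => Submodule.span ℂ {z | ∃ (v : A) (y : ExteriorAlgebra ℂ B), y ∈ ⋀[ℂ]^j B ∧
      z = ExteriorAlgebra.ι ℂ (toLin α v) * ExteriorAlgebra.map σ y}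

variable {α σ} {β : V ⟶ B}

/-- The section σ is only linear, but its failure xσ(b) - σ(xb) of equivariance is killed by β and
so comes from A. Applied to a product of elements of B, this trades one factor from B for one from
A, moved to the front by anticommutation. -/
theorem extAct_map_section (h : IsShortExact α β) (hσ : ∀ b, toLin β (σ b) = b) (x : L)
    {y : ExteriorAlgebra ℂ B} (hy : y ∈ ⋀[ℂ]^j B) :
    extAct V x (ExteriorAlgebra.map σ y) - ExteriorAlgebra.map σ (extAct B x y) ∈ lowMul α σ j := by
  induction hy using Submodule.pow_induction_on_left' with
  | algebraMap r =>
    rw [AlgHom.commutes, extDeriv_algebraMap, extDeriv_algebraMap, map_zero, sub_zero]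
    exact zero_mem _
  | add y z i hy hz ihy ihz =>
    simp only [map_add]
    rw [add_sub_add_comm]
    exact add_mem ihy ihz
  | mem_mul m hm i y hy ih =>
    obtain ⟨b, rfl⟩ := hm
    have hb : toLin β (⁅x, σ b⁆ - σ ⁅x, b⁆) = 0 := by
      rw [map_sub, LieModuleHom.map_lie, hσ, hσ, sub_self]
    obtain ⟨c, hc⟩ := (h.2.1 _).1 hb
    have e : extAct V x (ExteriorAlgebra.map σ (ExteriorAlgebra.ι ℂ b * y)) -
        ExteriorAlgebra.map σ (extAct B x (ExteriorAlgebra.ι ℂ b * y)) =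
        ExteriorAlgebra.ι ℂ (toLin α c) * ExteriorAlgebra.map σ y +
        ExteriorAlgebra.ι ℂ (σ b) * (extAct V x (ExteriorAlgebra.map σ y) -
          ExteriorAlgebra.map σ (extAct B x y)) := by
      rw [hc, map_mul, extDeriv_mul, extDeriv_mul, map_add, map_mul, map_mul,
        ExteriorAlgebra.map_apply_ι, extDeriv_ι, extDeriv_ι, ExteriorAlgebra.map_apply_ι, map_sub,
        LieModule.toEnd_apply_apply, LieModule.toEnd_apply_apply]
      noncomm_ring
    rw [e]
    refine add_mem (Submodule.subset_span ⟨c, y, hy, rfl⟩) ?_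
    generalize extAct V x (ExteriorAlgebra.map σ y) - ExteriorAlgebra.map σ (extAct B x y) = z at ih
    cases i with
    | zero => rw [(Submodule.mem_bot ℂ).1 ih, mul_zero]; exact zero_mem _
    | succ i =>
      refine Submodule.span_induction (p := fun z _ => ExteriorAlgebra.ι ℂ (σ b) * z ∈
        lowMul α σ (i + 1 + 1)) ?_ ?_ ?_ ?_ ih
      · rintro _ ⟨v, y, hy, rfl⟩
        have h1 := eq_neg_of_add_eq_zero_left
          (ExteriorAlgebra.ι_add_mul_swap (R := ℂ) (σ b) (toLin α v))
        rw [← mul_assoc, h1, neg_mul, mul_assoc, ← ExteriorAlgebra.map_apply_ι σ b, ← map_mul]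
        exact neg_mem (Submodule.subset_span ⟨v, _, ι_mul_mem b hy, rfl⟩)
      · rw [mul_zero]; exact zero_mem _
      · intro z z' _ _ hz hz'
        rw [mul_add]; exact add_mem hz hz'
      · intro c z _ hz
        rw [mul_smul_comm]; exact Submodule.smul_mem _ c hz

variable (α σ) in
/-- The products with fewer factors from `B`. -/
def lowRange (i : ℕ) : ℕ → Submodule ℂ (ExteriorAlgebra ℂ V)
  | 0 => ⊥
  | j + 1 => LinearMap.range (mulLin α σ (i + 1) j)

/-- Since α is equivariant, the defect of equivariance stems from the factor in Λ^j B alone; by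
`extAct_map_section` it involves one more factor from A and one fewer from B. -/
theorem extAct_mulLin (h : IsShortExact α β) (hσ : ∀ b, toLin β (σ b) = b) (x : L)
    (t : tensor.obj (extPow i A, extPow j B)) :
    extAct V x (mulLin α σ i j t) - mulLin α σ i j ⁅x, t⁆ ∈ lowRange α σ i j := by
  refine tm₂_top ((lowRange α σ i j).comap (extAct V x ∘ₗ mulLin α σ i j -
    mulLin α σ i j ∘ₗ LieModule.toEnd ℂ L (tensor.obj (extPow i A, extPow j B)) x))
    (fun v w => ?_) t
  rw [Submodule.mem_comap]
  change extAct V x (mulLin α σ i j (tm₂ _ _ v w)) - mulLin α σ i j ⁅x, tm₂ _ _ v w⁆ ∈ _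
  have e : extAct V x (mulLin α σ i j (tm₂ _ _ v w)) - mulLin α σ i j ⁅x, tm₂ _ _ v w⁆ =
      ExteriorAlgebra.map (toLin α).toLinearMap (extVal v) *
        (extAct V x (ExteriorAlgebra.map σ (extVal w)) -
          ExteriorAlgebra.map σ (extAct B x (extVal w))) := by
    rw [lie_tm₂, map_add, mulLin_tm₂, mulLin_tm₂, mulLin_tm₂, extDeriv_mul, extAct_map, extVal_lie,
      extVal_lie]
    noncomm_ring
  rw [e]
  have h1 := extAct_map_section h hσ x (extVal_mem w)
  generalize extAct V x (ExteriorAlgebra.map σ (extVal w)) -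
    ExteriorAlgebra.map σ (extAct B x (extVal w)) = z at h1
  cases j with
  | zero => rw [(Submodule.mem_bot ℂ).1 h1, mul_zero]; exact zero_mem _
  | succ j =>
    refine Submodule.span_induction (p := fun z _ =>
      ExteriorAlgebra.map (toLin α).toLinearMap (extVal v) * z ∈ lowRange α σ i (j + 1)) ?_ ?_ ?_ ?_ h1
    · rintro _ ⟨c, y, hy, rfl⟩
      have e2 : ExteriorAlgebra.ι ℂ (toLin α c) =
          ExteriorAlgebra.map (toLin α).toLinearMap (ExteriorAlgebra.ι ℂ c) :=
        (ExteriorAlgebra.map_apply_ι _ _).symm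
      rw [e2, ← mul_assoc, ← map_mul]
      exact mul_mem_range_mulLin α σ (mul_ι_mem c (extVal_mem v)) hy
    · rw [mul_zero]; exact zero_mem _
    · intro z z' _ _ hz hz'
      rw [mul_add]; exact add_mem hz hz'
    · intro c z _ hz
      rw [mul_smul_comm]; exact Submodule.smul_mem _ c hz

/-- Write v = α(c) + σ(β v) for each factor; a factor from A joins the left part directly, one from
B is moved past it at the cost of a sign. -/
theorem exteriorPower_le_iSup (h : IsShortExact α β) (hσ : ∀ b, toLin β (σ b) = b)
    {z : ExteriorAlgebra ℂ V} (hz : z ∈ ⋀[ℂ]^a V) :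
    z ∈ ⨆ k : Fin (a + 1), LinearMap.range (mulLin α σ (a - k) k) := by
  induction hz using Submodule.pow_induction_on_left' with
  | algebraMap r =>
    refine Submodule.mem_iSup_of_mem 0 ?_
    have h1 := mul_mem_range_mulLin α σ (i := 0) (j := 0) (x := algebraMap ℂ _ r) (y := 1)
      (Submodule.algebraMap_mem r) (Submodule.one_le.1 le_rfl)
    rwa [AlgHom.commutes, map_one, mul_one] at h1
  | add y z i hy hz ihy ihz => exact add_mem ihy ihz
  | mem_mul m hm i z hz ih =>
    obtain ⟨v, rfl⟩ := hm
    obtain ⟨c, hc⟩ : ∃ c, toLin α c = v - σ (toLin β v) := by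
      refine (h.2.1 _).1 ?_
      rw [map_sub, hσ, sub_self]
    have hv : v = toLin α c + σ (toLin β v) := by rw [hc]; abel
    refine Submodule.iSup_induction (fun k : Fin (i + 1) => LinearMap.range (mulLin α σ (i - k) k))
      (motive := fun z => ExteriorAlgebra.ι ℂ v * z ∈
        ⨆ k : Fin (i + 1 + 1), LinearMap.range (mulLin α σ (i + 1 - k) k)) ih ?_ ?_ ?_
    · rintro k _ ⟨t, rfl⟩
      refine tm₂_top (Submodule.comap (LinearMap.mulLeft ℂ (ExteriorAlgebra.ι ℂ v) ∘ₗ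
        mulLin α σ (i - k) k) (⨆ k : Fin (i + 1 + 1), LinearMap.range (mulLin α σ (i + 1 - k) k)))
        (fun x y => ?_) t
      rw [Submodule.mem_comap, LinearMap.comp_apply, LinearMap.mulLeft_apply, mulLin_tm₂]
      rw [show ExteriorAlgebra.ι ℂ v = ExteriorAlgebra.ι ℂ (toLin α c) +
        ExteriorAlgebra.ι ℂ (σ (toLin β v)) from by rw [← map_add, ← hv], add_mul]
      refine add_mem (Submodule.mem_iSup_of_mem k.castSucc ?_) (Submodule.mem_iSup_of_mem k.succ ?_)
      · have e2 : ExteriorAlgebra.ι ℂ (toLin α c) =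
            ExteriorAlgebra.map (toLin α).toLinearMap (ExteriorAlgebra.ι ℂ c) :=
          (ExteriorAlgebra.map_apply_ι _ _).symm
        have e3 : i + 1 - (k.castSucc : ℕ) = i - k + 1 := by
          have := k.2
          rw [Fin.val_castSucc]; omega
        rw [e2, ← mul_assoc, ← map_mul, e3]
        exact mul_mem_range_mulLin α σ (ι_mul_mem c (extVal_mem x)) (extVal_mem y)
      · have e3 : i + 1 - (k.succ : ℕ) = i - k := by rw [Fin.val_succ]; omega
        rw [← mul_assoc, ι_mul_eq _ (map_mem_exteriorPower _ (extVal_mem x)), smul_mul_assoc,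
          mul_assoc, ← ExteriorAlgebra.map_apply_ι σ, ← map_mul, e3]
        exact Submodule.smul_mem _ _
          (mul_mem_range_mulLin α σ (extVal_mem x) (ι_mul_mem _ (extVal_mem y)))
    · rw [mul_zero]; exact zero_mem _
    · intro z z' hz hz'
      rw [mul_add]; exact add_mem hz hz'

variable (a α σ) in
/-- The sum of the multiplication maps. -/
def sumMulLin : ((k : Fin (a + 1)) → tensor.obj (extPow (a - k) A, extPow k B)) →ₗ[ℂ] extPow a V :=
  LinearMap.codRestrict (⋀[ℂ]^a V) (∑ k : Fin (a + 1), mulLin α σ (a - k) k ∘ₗ LinearMap.proj k) fun t => by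
    rw [LinearMap.sum_apply]
    refine sum_mem fun k _ => ?_
    have := mulLin_mem α σ (t k)
    rwa [Nat.sub_add_cancel (Nat.le_of_lt_succ k.2)] at this

theorem extVal_sumMulLin (t : (k : Fin (a + 1)) → tensor.obj (extPow (a - k) A, extPow k B)) :
    extVal (sumMulLin a α σ t) = ∑ k : Fin (a + 1), mulLin α σ (a - k) k (t k) := by
  change (∑ k : Fin (a + 1), mulLin α σ (a - k) k ∘ₗ LinearMap.proj k) t = _
  rw [LinearMap.sum_apply]
  rfl

theorem extVal_sumMulLin_single (k : Fin (a + 1)) (s : tensor.obj (extPow (a - k) A, extPow k B)) :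
    extVal (sumMulLin a α σ (Pi.single k s)) = mulLin α σ (a - k) k s := by
  rw [extVal_sumMulLin, Finset.sum_eq_single k]
  · rw [Pi.single_eq_same]
  · intro l _ hl
    rw [Pi.single_eq_of_ne hl, map_zero]
  · simp

theorem sumMulLin_surjective (h : IsShortExact α β) (hσ : ∀ b, toLin β (σ b) = b) :
    Function.Surjective (sumMulLin a α σ) := by
  intro z
  have h1 : (⨆ k : Fin (a + 1), LinearMap.range (mulLin α σ (a - k) k)) ≤
      LinearMap.range (extVal ∘ₗ sumMulLin a α σ) := by
    refine iSup_le fun k => ?_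
    rintro _ ⟨s, rfl⟩
    exact ⟨Pi.single k s, extVal_sumMulLin_single k s⟩
  obtain ⟨t, ht⟩ := h1 (exteriorPower_le_iSup h hσ (extVal_mem z))
  exact ⟨t, extVal_injective ht⟩

/-- Surjectivity plus equality of dimensions, which is the Vandermonde identity for binomial
coefficients. -/
theorem sumMulLin_bijective [Module.Finite ℂ A] [Module.Finite ℂ B] [Module.Finite ℂ V]
    (h : IsShortExact α β) (hσ : ∀ b, toLin β (σ b) = b) :
    Function.Bijective (sumMulLin a α σ) := by
  have hdim : Module.finrank ℂ V = Module.finrank ℂ B + Module.finrank ℂ A := by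
    have h1 := LinearMap.finrank_range_add_finrank_ker (toLin β).toLinearMap
    have h2 : LinearMap.range (toLin β).toLinearMap = ⊤ := LinearMap.range_eq_top.2 h.2.2
    have h3 : LinearMap.ker (toLin β).toLinearMap = LinearMap.range (toLin α).toLinearMap :=
      LinearMap.exact_iff.1 h.2.1
    rw [h2, h3, finrank_top, LinearMap.finrank_range_of_inj h.1] at h1
    exact h1.symm
  have (k : Fin (a + 1)) : Module.Finite ℂ (tensor.obj (extPow (a - k) A, extPow k B)) :=
    Module.Finite.tensorProduct ℂ (extPow (a - k) A) (extPow k B)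
  have (k : Fin (a + 1)) : Module.finrank ℂ (tensor.obj (extPow (a - k) A, extPow k B)) =
      (Module.finrank ℂ A).choose (a - k) * (Module.finrank ℂ B).choose k := by
    refine (Module.finrank_tensorProduct (R := ℂ) (S := ℂ) (M := extPow (a - k) A)
      (M' := extPow k B)).trans ?_
    rw [finrank_extPow, finrank_extPow]
  have hfin : Module.finrank ℂ ((k : Fin (a + 1)) → tensor.obj (extPow (a - k) A, extPow k B)) =
      Module.finrank ℂ (extPow a V) := by
    rw [Module.finrank_pi_fintype, finrank_extPow, hdim, Nat.add_choose_eq,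
      Finset.Nat.sum_antidiagonal_eq_sum_range_succ
        (fun i j => (Module.finrank ℂ B).choose i * (Module.finrank ℂ A).choose j), Finset.sum_range]
    exact Finset.sum_congr rfl fun k _ => by rw [this, mul_comm]
  have hs := sumMulLin_surjective (a := a) h hσ
  exact ⟨(LinearMap.injective_iff_surjective_of_finrank_eq_finrank hfin).2 hs, hs⟩

theorem exists_extPow_filtration [Module.Finite ℂ A] [Module.Finite ℂ B] [Module.Finite ℂ V]
    (h : IsShortExact α β) (a : ℕ) :
    ∃ W : Fin (a + 2) → LieSubmodule ℂ L (extPow a V), W 0 = ⊥ ∧ W (Fin.last (a + 1)) = ⊤ ∧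
      ∀ k : Fin (a + 1), ∃ (hk : W k.castSucc ≤ W k.succ)
        (q : subObj (W k.succ) ⟶ tensor.obj (extPow (a - k) A, extPow k B)),
        IsShortExact (subIncl hk) q := by
  obtain ⟨σ, hσ'⟩ := (toLin β).toLinearMap.exists_rightInverse_of_surjective
    (LinearMap.range_eq_top.2 h.2.2)
  have hσ (b : B) : toLin β (σ b) = b := DFunLike.congr_fun hσ' b
  let Ψ := LinearEquiv.ofBijective (sumMulLin a α σ) (sumMulLin_bijective h hσ)
  -- Products with at most j - 1 factors from B have their only coordinate at index j - 1, hence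
  -- none at i ≥ j. For j = 0 there are no such products.
  have low (j : ℕ) (hj : j ≤ a) (z : extPow a V) (hz : extVal z ∈ lowRange α σ (a - j) j)
      (i : Fin (a + 1)) (hi : j ≤ i) : Ψ.symm z i = 0 := by
    cases j with
    | zero =>
      rw [extVal_injective (((Submodule.mem_bot ℂ).1 hz).trans (map_zero extVal).symm), map_zero,
        Pi.zero_apply]
    | succ j =>
      change _ ∈ LinearMap.range (mulLin α σ (a - (j + 1) + 1) j) at hz
      rw [show a - (j + 1) + 1 = a - j by omega] at hz
      obtain ⟨s, hs⟩ := hz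
      have e := extVal_sumMulLin_single (α := α) (σ := σ) (⟨j, by omega⟩ : Fin (a + 1)) s
      have e2 : z = Ψ (Pi.single (⟨j, by omega⟩ : Fin (a + 1)) s) :=
        extVal_injective (hs.symm.trans e.symm)
      rw [e2, LinearEquiv.symm_apply_apply, Pi.single_eq_of_ne]
      intro hij
      exact absurd (hi.trans_eq (congrArg Fin.val hij)) (Nat.not_succ_le_self j)
  refine exists_filtration_of_triangular Ψ fun x k s i hi =>
    low k (Nat.le_of_lt_succ k.2) _ ?_ i hi
  rw [map_sub, extVal_lie]
  change extAct V x (extVal (sumMulLin a α σ (Pi.single k s))) -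
    extVal (sumMulLin a α σ (Pi.single k ⁅x, s⁆)) ∈ _
  rw [extVal_sumMulLin_single, extVal_sumMulLin_single]
  exact extAct_mulLin h hσ x s

end ExtPow

end LieMod
end

noncomputable section

/-! ### Homomorphisms from equivariant bilinear maps -/

namespace LieMod

/-- The homomorphism on `V ⊗ M` given by an equivariant bilinear map. -/
def tensorLift {L : Type} [LieRing L] [LieAlgebra ℂ L] {V : LieMod.{0} L} {M N : LieMod.{u} L}
    (B : V →ₗ[ℂ] M →ₗ[ℂ] N) (h : ∀ (x : L) v w, B ⁅x, v⁆ w + B v ⁅x, w⁆ = ⁅x, B v w⁆) :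
    (tensorLeft V).obj M ⟶ N :=
  ⟨{ TensorProduct.lift B with
     map_lie' := fun {x t} => sub_eq_zero.1 (by
      let F : (tensorLeft V).obj M →ₗ[ℂ] N := TensorProduct.lift B
      let D : (tensorLeft V).obj M →ₗ[ℂ] N := F ∘ₗ
        LieModule.toEnd ℂ L ((tensorLeft V).obj M) x - LieModule.toEnd ℂ L N x ∘ₗ F
      refine tm_top (LinearMap.ker D) (fun v w => LinearMap.mem_ker.2 (sub_eq_zero.2 ?_)) t
      exact (congrArg F (lie_tm x v w)).trans ((map_add F _ _).trans (h x v w))) }⟩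

end LieMod

/-! ### Finite-dimensional modules with integral weights -/

namespace GLn

open LieMod

variable {n m : ℕ} {c c' : ℤ} {V W : LieMod.{0} (gl n)} {M : LieMod.{u} (gl n)}

/-- Finite-dimensional locally nilpotent modules with integral weights of degree `c`. -/
structure FinWt (c : ℤ) (V : LieMod.{0} (gl n)) : Prop where
  finite : Module.Finite ℂ V
  inO : InO (intWt 0 c) V

theorem FinWt.of_span {ι : Type} [Finite ι] (b : ι → V) (hb : Submodule.span ℂ (Set.range b) = ⊤)
    (hw : ∀ i, ∃ z : Fin n → ℤ, ∑ k, z k = c ∧ b i ∈ weightSpace V fun k => (z k : ℂ))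
    (hn : ∀ i, ∃ K, Nil K (b i)) : FinWt c V := by
  classical
  have := Fintype.ofFinite ι
  refine ⟨⟨⟨Finset.univ.image b, by simpa using hb⟩⟩,
    InO.of_generators (rootClosed_intWt 0 c) (Finset.univ.image b) ?_ ?_ ?_⟩
  · refine eq_top_iff.2 fun v _ => ?_
    have h : Submodule.span ℂ (Set.range b) ≤
      (LieSubmodule.lieSpan ℂ (gl n) ((Finset.univ.image b : Finset V) : Set V)).toSubmodule := by
      refine Submodule.span_le.2 ?_
      rintro _ ⟨i, rfl⟩
      exact LieSubmodule.subset_lieSpan (by simp)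
    exact h (hb ▸ Submodule.mem_top)
  · intro v hv
    obtain ⟨i, -, rfl⟩ := Finset.mem_image.1 hv
    obtain ⟨z, hz, h⟩ := hw i
    exact mem_wtSup (show (fun k => (z k : ℂ)) ∈ intWt 0 c from ⟨z, hz, fun k => by simp⟩) h
  · intro v hv
    obtain ⟨i, -, rfl⟩ := Finset.mem_image.1 hv
    exact hn i

theorem FinWt.tensor (hV : FinWt c V) (hM : InO (intWt (rho n) c') M) :
    InO (intWt (rho n) (c + c')) ((tensorLeft V).obj M) := by
  have := hV.finite
  refine InO.tensor (rootClosed_intWt _ _) (fun μ hμ ν hν => ?_) hV.inO hM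
  have := intWt_add hμ hν
  rwa [zero_add] at this

theorem FinWt.tensorLeft (hV : FinWt c V) (hW : FinWt c' W) :
    FinWt (c + c') ((tensorLeft V).obj W) := by
  have := hV.finite
  have := hW.finite
  refine ⟨Module.Finite.tensorProduct ℂ V W,
    InO.tensor (rootClosed_intWt _ _) (fun μ hμ ν hν => ?_) hV.inO hW.inO⟩
  have := intWt_add hμ hν
  rwa [zero_add] at this

theorem FinWt.of_surjective (hV : FinWt c V) (f : V ⟶ W) (hf : Function.Surjective (toLin f)) :
    FinWt c W := by
  have := hV.finite
  exact ⟨Module.Finite.of_surjective (toLin f).toLinearMap hf, hV.inO.of_surjective f hf⟩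

theorem lie_std_single (x : gl n) (b : Fin n) :
    ⁅x, (Pi.single b 1 : std n)⁆ = ((fun a => x a b : Fin n → ℂ) : std n) :=
  Matrix.mulVec_single_one x b

/-- Strictly upper triangular matrices lower the standard flag by one step. -/
theorem nil_std (K : ℕ) (v : std n) (h : ∀ a : Fin n, K ≤ a → (v : Fin n → ℂ) a = 0) :
    Nil K v := by
  induction K generalizing v with
  | zero => exact funext fun a => h a (Nat.zero_le _)
  | succ K ih =>
    refine fun x hx => ih _ fun a ha => ?_
    change ∑ b : Fin n, x a b * (v : Fin n → ℂ) b = 0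
    refine Finset.sum_eq_zero fun b _ => ?_
    rcases le_or_gt b a with hb | hb
    · rw [hx a b hb, zero_mul]
    · rw [h b (lt_of_le_of_lt ha hb), mul_zero]

theorem span_range_single (n : ℕ) :
    Submodule.span ℂ (Set.range fun b : Fin n => (Pi.single b 1 : Fin n → ℂ)) = ⊤ := by
  rw [← (Pi.basisFun ℂ (Fin n)).span_eq]
  congr 2
  funext b
  exact (Pi.basisFun_apply ℂ (Fin n) b).symm

theorem finWt_std (n : ℕ) : FinWt 1 (std n) := by
  refine FinWt.of_span (fun b : Fin n => (Pi.single b 1 : Fin n → ℂ)) ?_ (fun b => ?_) (fun b => ?_)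
  · exact span_range_single n
  · refine ⟨Pi.single b 1, by simp, fun d => ?_⟩
    refine (lie_std_single _ _).trans (funext fun (a : Fin n) => ?_)
    change (Matrix.diagonal d a b : ℂ) = (∑ k, d k * _) * (Pi.single b 1 : Fin n → ℂ) a
    by_cases hab : a = b
    · subst hab
      simp [Pi.single_apply]
    · simp [hab]
  · exact ⟨n, nil_std n _ fun a ha => absurd a.2 (not_lt.2 ha)⟩

theorem lie_dual_std (x : gl n) (f : Module.Dual ℂ (Fin n → ℂ)) (v : Fin n → ℂ) :
    (⁅x, (f : dual (std n))⁆ : Module.Dual ℂ (Fin n → ℂ)) v = -f (x.mulVec v) := rfl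

/-- The same for the dual flag: f vanishes on all but the last K basis vectors, and n₊ shortens this
range from the left. -/
theorem nil_dual_std (K : ℕ) (f : Module.Dual ℂ (Fin n → ℂ))
    (h : ∀ b : Fin n, b + K < n → f (Pi.single b 1) = 0) : Nil (M := dual (std n)) K f := by
  induction K generalizing f with
  | zero =>
    refine (Pi.basisFun ℂ (Fin n)).ext fun b => ?_
    rw [Pi.basisFun_apply]
    exact h b b.2
  | succ K ih =>
    refine fun x hx => ih _ fun b hb => ?_
    refine (lie_dual_std x f _).trans ?_
    rw [neg_eq_zero, Matrix.mulVec_single_one, LinearMap.pi_apply_eq_sum_univ f]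
    refine Finset.sum_eq_zero fun a _ => ?_
    rw [show (fun j => if a = j then (1 : ℂ) else 0) = Pi.single a 1 by
      ext j; simp [Pi.single_apply, eq_comm]]
    rcases le_or_gt b a with hab | hab
    · change x a b • _ = _
      rw [hx a b hab, zero_smul]
    · rw [h a (by have := Fin.lt_def.1 hab; omega), smul_zero]

theorem finWt_dual_std (n : ℕ) : FinWt (-1) (dual (std n)) := by
  refine FinWt.of_span (fun b : Fin n => (LinearMap.proj b : Module.Dual ℂ (Fin n → ℂ))) ?_
    (fun b => ?_) (fun b => ?_)
  · refine eq_top_iff.2 fun f _ => ?_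
    have : f = ∑ b : Fin n, (show Module.Dual ℂ (Fin n → ℂ) from f) (Pi.single b 1) •
        (LinearMap.proj b : Module.Dual ℂ (Fin n → ℂ)) := by
      refine (Pi.basisFun ℂ (Fin n)).ext fun b => ?_
      simp [Pi.single_apply]
    rw [this]
    exact sum_mem fun b _ => Submodule.smul_mem _ _ (Submodule.subset_span ⟨b, rfl⟩)
  · refine ⟨-Pi.single b 1, by simp, fun d => ?_⟩
    refine (Pi.basisFun ℂ (Fin n)).ext fun a => ?_
    refine (lie_dual_std _ _ _).trans ?_
    change _ = (∑ k, d k * _) * (Pi.basisFun ℂ (Fin n)) a b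
    by_cases hab : a = b
    · subst hab
      simp [Pi.single_apply]
    · simp [Ne.symm hab, Pi.single_apply]
  · exact ⟨n, nil_dual_std n _ fun a ha => absurd ha (by omega)⟩

/-- The multiplication `V ⊗ Λᵏ V → Λᵏ⁺¹ V`. -/
def extPowMul (k : ℕ) (V : LieMod.{0} (gl n)) :
    (LieMod.tensorLeft V).obj (extPow k V) ⟶ extPow (k + 1) V :=
  tensorLift (LinearMap.mk₂ ℂ (fun v x => extMk _ (ι_mul_mem v (extVal_mem x)))
      (fun v v' x => extVal_injective (by
        change ExteriorAlgebra.ι ℂ (v + v') * extVal x =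
          ExteriorAlgebra.ι ℂ v * extVal x + ExteriorAlgebra.ι ℂ v' * extVal x
        rw [map_add, add_mul]))
      (fun c v x => extVal_injective (by
        change ExteriorAlgebra.ι ℂ (c • v) * extVal x = c • (ExteriorAlgebra.ι ℂ v * extVal x)
        rw [map_smul, smul_mul_assoc]))
      (fun v x x' => extVal_injective (mul_add _ _ _))
      (fun c v x => extVal_injective (mul_smul_comm _ _ _)))
    fun x v w => extVal_injective (by
      change ExteriorAlgebra.ι ℂ ⁅x, v⁆ * extVal w + ExteriorAlgebra.ι ℂ v * extVal ⁅x, w⁆ =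
        extAct V x (ExteriorAlgebra.ι ℂ v * extVal w)
      rw [extDeriv_mul, extDeriv_ι, extVal_lie]
      rfl)

theorem extPowMul_surjective (k : ℕ) (V : LieMod.{0} (gl n)) :
    Function.Surjective (toLin (extPowMul k V)) := by
  have h : ∀ z ∈ ⋀[ℂ]^(k + 1) V, z ∈ LinearMap.range
      (extVal ∘ₗ (toLin (extPowMul k V)).toLinearMap) := by
    change LinearMap.range (ExteriorAlgebra.ι ℂ) ^ (k + 1) ≤ _
    rw [pow_succ', Submodule.mul_le]
    rintro _ ⟨v, rfl⟩ x hx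
    exact ⟨tm V _ v (extMk x hx), rfl⟩
  intro z
  obtain ⟨t, ht⟩ := h _ (extVal_mem z)
  exact ⟨t, extVal_injective ht⟩

theorem finWt_extPow_zero (V : LieMod.{0} (gl n)) : FinWt 0 (extPow 0 V) := by
  have h1 : (1 : ExteriorAlgebra ℂ V) ∈ ⋀[ℂ]^0 V := Submodule.one_le.1 le_rfl
  have h0 (x : gl n) : ⁅x, (extMk 1 h1 : extPow 0 V)⁆ = 0 := extVal_injective (by
    rw [extVal_lie, extVal_mk, ← map_one (algebraMap ℂ _), extDeriv_algebraMap, map_zero])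
  refine FinWt.of_span (fun _ : Unit => (extMk 1 h1 : extPow 0 V)) ?_ (fun b => ?_) (fun b => ?_)
  · refine eq_top_iff.2 fun x _ => ?_
    obtain ⟨r, hr⟩ := Submodule.mem_one.1 (show extVal x ∈ (1 : Submodule ℂ (ExteriorAlgebra ℂ V))
      from extVal_mem x)
    have : x = r • (extMk 1 h1 : extPow 0 V) := extVal_injective (by
      rw [map_smul, extVal_mk, ← hr, Algebra.algebraMap_eq_smul_one])
    rw [this]
    exact Submodule.smul_mem _ _ (Submodule.subset_span ⟨(), rfl⟩)
  · refine ⟨0, by simp, fun d => ?_⟩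
    rw [h0]
    simp
  · refine ⟨1, fun x _ => ?_⟩
    rw [h0]
    exact nil_zero 0

/-- Λ^{a+1} V is a quotient of V ⊗ Λ^a V, so weights and nilpotency follow from the tensor product
without a basis of the exterior power. -/
theorem FinWt.extPow (hV : FinWt c V) (a : ℕ) : FinWt (a * c) (extPow a V) := by
  induction a with
  | zero =>
    rw [Nat.cast_zero, zero_mul]
    exact finWt_extPow_zero V
  | succ a ih =>
    have := (hV.tensorLeft ih).of_surjective _ (extPowMul_surjective a V)
    rwa [show (((a + 1 : ℕ) : ℤ) * c) = c + a * c by push_cast; ring]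

theorem block_C {N : LieMod.{u} (gl m)} (hM : block n c M) (hN : block m c' N) :
    block (n + m) (c + c') ((C n m).obj (M, N)) := by
  obtain ⟨h1, k, hk⟩ := block_iff.1 hM
  obtain ⟨h2, k', hk'⟩ := block_iff.1 hN
  exact block_iff.2 ⟨h1.C (rootClosed_intWt _ _) (fun μ hμ ν hν => intWt_append hμ hν) h2,
    C_kills hM.1 hk hN.1 hk'⟩

theorem FinWt.block_proj (hV : FinWt c V) (hM : block n c' M) (d : ℤ) :
    block n d ((proj n d).obj ((LieMod.tensorLeft V).obj M)) :=
  GLn.block_proj (hV.tensor (block_iff.1 hM).1).catO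

end GLn
end

noncomputable section

/-! ### Induction from tensor products -/

namespace LieMod

variable {L : Type} [LieRing L] [LieAlgebra ℂ L]

/-- The isomorphism given by an equivariant linear equivalence. -/
def isoOfEquiv {A B : LieMod.{u} L} (e : A ≃ₗ[ℂ] B) (h : ∀ (x : L) a, e ⁅x, a⁆ = ⁅x, e a⁆) : A ≅ B where
  hom := ⟨{ e.toLinearMap with map_lie' := fun {x a} => h x a }⟩
  inv := ⟨{ e.symm.toLinearMap with
    map_lie' := fun {x b} => e.injective (by
      change e (e.symm ⁅x, b⁆) = e ⁅x, e.symm b⁆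
      rw [h, e.apply_symm_apply, e.apply_symm_apply]) }⟩
  hom_inv_id := hom_ext fun a => e.symm_apply_apply a
  inv_hom_id := hom_ext fun b => e.apply_symm_apply b

theorem inv_toLin {A B : LieMod.{u} L} (e : A ≅ B) (a : A) : toLin e.inv (toLin e.hom a) = a :=
  congrArg (fun f => toLin f a) e.hom_inv_id

theorem toLin_inv {A B : LieMod.{u} L} (e : A ≅ B) (b : B) : toLin e.hom (toLin e.inv b) = b :=
  congrArg (fun f => toLin f b) e.inv_hom_id

theorem IsShortExact.of_iso {A B D A' B' D' : LieMod.{u} L} {f : A ⟶ B} {g : B ⟶ D}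
    (h : IsShortExact f g) (a : A' ≅ A) (b : B ≅ B') (d : D ≅ D') :
    IsShortExact (a.hom ≫ f ≫ b.hom) (b.inv ≫ g ≫ d.hom) := by
  have inj {X Y : LieMod.{u} L} (e : X ≅ Y) : Function.Injective (toLin e.hom) := fun x y hxy => by
    rw [← inv_toLin e x, hxy, inv_toLin]
  refine ⟨(inj b).comp (h.1.comp (inj a)), fun x => ⟨fun hx => ?_, ?_⟩, fun x => ?_⟩
  · have h1 : toLin g (toLin b.inv x) = 0 := inj d (hx.trans (map_zero _).symm)
    obtain ⟨y, hy⟩ := (h.2.1 _).1 h1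
    refine ⟨toLin a.inv y, ?_⟩
    change toLin b.hom (toLin f (toLin a.hom (toLin a.inv y))) = x
    rw [toLin_inv, hy, toLin_inv]
  · rintro ⟨y, rfl⟩
    change toLin d.hom (toLin g (toLin b.inv (toLin b.hom (toLin f (toLin a.hom y))))) = 0
    rw [inv_toLin, h.2.1.apply_apply_eq_zero, map_zero]
  · obtain ⟨y, hy⟩ := h.2.2 (toLin d.inv x)
    refine ⟨toLin b.hom y, ?_⟩
    change toLin d.hom (toLin g (toLin b.inv (toLin b.hom y))) = x
    rw [inv_toLin, hy, toLin_inv]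

theorem IsShortExactFunctors.of_iso {X : Type*} [Category X] {A B D A' B' D' : X ⥤ LieMod.{u} L}
    {f : A ⟶ B} {g : B ⟶ D} (h : IsShortExactFunctors f g) (a : A' ≅ A) (b : B ≅ B') (d : D ≅ D') :
    IsShortExactFunctors (a.hom ≫ f ≫ b.hom) (b.inv ≫ g ≫ d.hom) := fun x =>
  (h x).of_iso (a.app x) (b.app x) (d.app x)

/-- Tensoring with `V` is functorial in `V`. -/
def tensorLeftMap {V W : LieMod.{0} L} (f : V ⟶ W) : tensorLeft.{u} V ⟶ tensorLeft.{u} W where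
  app M := ⟨TensorProduct.LieModule.map (toLin f) (LieModuleHom.id : M →ₗ⁅ℂ,L⁆ M)⟩
  naturality M N g := hom_ext fun t => LinearMap.congr_fun (TensorProduct.ext' fun _ _ => rfl :
    (toLin f).toLinearMap.rTensor N ∘ₗ (toLin g).toLinearMap.lTensor V =
      (toLin g).toLinearMap.lTensor W ∘ₗ (toLin f).toLinearMap.rTensor M) t

theorem tensorLeftMap_exact {A B D : LieMod.{0} L} {f : A ⟶ B} {g : B ⟶ D}
    (h : IsShortExact f g) :
    IsShortExactFunctors (tensorLeftMap.{u} f) (tensorLeftMap.{u} g) := fun V =>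
  ⟨Module.Flat.rTensor_preserves_injective_linearMap (M := V) (toLin f : A →ₗ[ℂ] B) h.1,
    rTensor_exact V (f := (toLin f : A →ₗ[ℂ] B)) (g := (toLin g : B →ₗ[ℂ] D)) h.2.1 h.2.2,
    LinearMap.rTensor_surjective V (g := (toLin g : B →ₗ[ℂ] D)) h.2.2⟩

/-- The symmetry of the tensor product. -/
def tensorSwap (A B : LieMod.{u} L) : tensor.obj (A, B) ≅ tensor.obj (B, A) :=
  isoOfEquiv (TensorProduct.comm ℂ A B) fun x t => by
    let F : tensor.obj (A, B) →ₗ[ℂ] tensor.obj (B, A) := (TensorProduct.comm ℂ A B).toLinearMap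
    let D : tensor.obj (A, B) →ₗ[ℂ] tensor.obj (B, A) := F ∘ₗ
      LieModule.toEnd ℂ L (tensor.obj (A, B)) x - LieModule.toEnd ℂ L (tensor.obj (B, A)) x ∘ₗ F
    refine sub_eq_zero.1 (tm₂_top (LinearMap.ker D) (fun v w =>
      LinearMap.mem_ker.2 ((LinearMap.sub_apply _ _ _).trans (sub_eq_zero.2 ?_))) t)
    refine (congrArg F (lie_tm₂ x v w)).trans ((map_add F _ _).trans ?_)
    exact (add_comm _ _).trans (lie_tm₂ x w v).symm

end LieMod

namespace GLn

open LieMod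

section

variable {n m : ℕ}

/-- `mkC₀` as a bilinear map. -/
def mkC₀Lin (M : LieMod.{u} (gl n)) (N : LieMod.{u} (gl m)) :
    M →ₗ[ℂ] N →ₗ[ℂ] (C₀ n m).obj (M, N) :=
  TensorProduct.curry (mkC₀Equiv M N).toLinearMap

theorem lie_mkC₀Lin {M : LieMod.{u} (gl n)} {N : LieMod.{u} (gl m)} (x : parabolic n m) (v : M)
    (w : N) : ⁅x, mkC₀Lin M N v w⁆ = shiftChar n m x • mkC₀Lin M N v w +
      mkC₀Lin M N ⁅blockFst n m x, v⁆ w + mkC₀Lin M N v ⁅blockSnd n m x, w⁆ := lie_mkC₀ x v w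

/-- The equivalence `W ⊗ (M ⊗ N) ≃ W ⊗ C₀ (M, N)`. -/
def tensorC₀Equiv (W : LieMod.{0} (parabolic n m)) (M : LieMod.{u} (gl n)) (N : LieMod.{u} (gl m)) :
    W ⊗[ℂ] (M ⊗[ℂ] N) ≃ₗ[ℂ] (tensorLeft W).obj ((C₀ n m).obj (M, N)) :=
  LinearEquiv.lTensor W (mkC₀Equiv M N)

theorem tensorC₀Equiv_symm {W : LieMod.{0} (parabolic n m)} {M : LieMod.{u} (gl n)}
    {N : LieMod.{u} (gl m)} (w : W) (x : M) (y : N) :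
    (tensorC₀Equiv W M N).symm (tm W _ w (mkC₀ x y)) = w ⊗ₜ (x ⊗ₜ y) :=
  (tensorC₀Equiv W M N).symm_apply_apply (w ⊗ₜ (x ⊗ₜ y))

section Iso

variable {W : LieMod.{0} (parabolic n m)} {ι : Type} {g : ι → W}

theorem tensor_C₀_ext (hg : ∀ T : Submodule ℂ W, (∀ i, g i ∈ T) → ∀ w, w ∈ T)
    {M : LieMod.{u} (gl n)} {N : LieMod.{u} (gl m)} {P : Type*} [AddCommGroup P] [Module ℂ P]
    {f f' : (tensorLeft W).obj ((C₀ n m).obj (M, N)) →ₗ[ℂ] P}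
    (h : ∀ i x y, f (tm W _ (g i) (mkC₀Lin M N x y)) = f' (tm W _ (g i) (mkC₀Lin M N x y))) :
    f = f' :=
  LinearMap.ext fun t => tm_top (LinearMap.eqLocus f f') (fun w s =>
    C₀_top ((LinearMap.eqLocus f f').comap (tm W _ w)) (fun x y =>
      hg ((LinearMap.eqLocus f f').comap ((tm W _).flip (mkC₀Lin M N x y)))
        (fun i => h i x y) w) s) t

variable {S : LieMod.{u} (gl n) × LieMod.{u} (gl m) ⥤ LieMod.{u} (gl n) × LieMod.{u} (gl m)}

/-- The natural isomorphism given by an equivariant natural linear equivalence, whose properties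
need only be known on a generating system of `W`. -/
def tensorC₀Iso (hg : ∀ T : Submodule ℂ W, (∀ i, g i ∈ T) → ∀ w, w ∈ T)
    (e : ∀ X : LieMod.{u} (gl n) × LieMod.{u} (gl m),
      W ⊗[ℂ] (X.1 ⊗[ℂ] X.2) ≃ₗ[ℂ] (S.obj X).1 ⊗[ℂ] (S.obj X).2)
    (hlie : ∀ (X : LieMod.{u} (gl n) × LieMod.{u} (gl m)) (a : parabolic n m) i (x : X.1) (y : X.2),
      mkC₀Equiv _ _ (e X (⁅a, g i⁆ ⊗ₜ (x ⊗ₜ y))) +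
        (shiftChar n m a • mkC₀Equiv _ _ (e X (g i ⊗ₜ (x ⊗ₜ y))) +
        mkC₀Equiv _ _ (e X (g i ⊗ₜ (⁅blockFst n m a, x⁆ ⊗ₜ y))) +
        mkC₀Equiv _ _ (e X (g i ⊗ₜ (x ⊗ₜ ⁅blockSnd n m a, y⁆)))) =
      ⁅a, mkC₀Equiv _ _ (e X (g i ⊗ₜ (x ⊗ₜ y)))⁆)
    (hnat : ∀ {X Y : LieMod.{u} (gl n) × LieMod.{u} (gl m)} (f : X ⟶ Y) i (x : X.1) (y : X.2),
      mkC₀Equiv _ _ (e Y (g i ⊗ₜ (toLin f.1 x ⊗ₜ toLin f.2 y))) =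
        toLin ((C₀ n m).map (S.map f)) (mkC₀Equiv _ _ (e X (g i ⊗ₜ (x ⊗ₜ y))))) :
    C₀ n m ⋙ tensorLeft W ≅ S ⋙ C₀ n m :=
  let E (X : LieMod.{u} (gl n) × LieMod.{u} (gl m)) :
      (tensorLeft W).obj ((C₀ n m).obj X) ≃ₗ[ℂ] (C₀ n m).obj (S.obj X) :=
    (tensorC₀Equiv W X.1 X.2).symm.trans ((e X).trans (mkC₀Equiv _ _))
  have hE (X : LieMod.{u} (gl n) × LieMod.{u} (gl m)) w (x : X.1) (y : X.2) :
      E X (tm W _ w (mkC₀Lin X.1 X.2 x y)) = mkC₀Equiv _ _ (e X (w ⊗ₜ (x ⊗ₜ y))) :=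
    congrArg (fun t => mkC₀Equiv _ _ (e X t)) (tensorC₀Equiv_symm w x y)
  NatIso.ofComponents (fun X => isoOfEquiv (E X) fun a t => LinearMap.congr_fun
    (tensor_C₀_ext hg (f := (E X).toLinearMap ∘ₗ LieModule.toEnd ℂ _ _ a)
      (f' := LieModule.toEnd ℂ _ _ a ∘ₗ (E X).toLinearMap) fun i x y => by
        change E X ⁅a, tm W _ (g i) (mkC₀Lin X.1 X.2 x y)⁆ =
          ⁅a, E X (tm W _ (g i) (mkC₀Lin X.1 X.2 x y))⁆
        rw [lie_tm, map_add, hE, hE]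
        refine Eq.trans ?_ (hlie X a i x y)
        refine congrArg (mkC₀Equiv _ _ (e X (⁅a, g i⁆ ⊗ₜ (x ⊗ₜ y))) + ·) ?_
        let T : (C₀ n m).obj X →ₗ[ℂ] (C₀ n m).obj (S.obj X) := (E X).toLinearMap ∘ₗ tm W _ (g i)
        refine (congrArg T (lie_mkC₀Lin a x y)).trans ?_
        rw [map_add, map_add, map_smul, ← hE, ← hE, ← hE]
        rfl) t)
    fun {X Y} f => hom_ext fun t => LinearMap.congr_fun
      (tensor_C₀_ext hg (f := (E Y).toLinearMap ∘ₗ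
        (toLin ((tensorLeft W).map ((C₀ n m).map f))).toLinearMap)
        (f' := (toLin ((C₀ n m).map (S.map f))).toLinearMap ∘ₗ (E X).toLinearMap) fun i x y =>
          (hE Y (g i) (toLin f.1 x) (toLin f.2 y)).trans ((hnat f i x y).trans
            (congrArg (toLin ((C₀ n m).map (S.map f))) (hE X (g i) x y).symm))) t

end Iso

variable (V : LieMod.{0} (gl n)) (V' : LieMod.{0} (gl m))

/-- Tensoring the first argument of `C₀`. -/
def C₀TensorFst : C₀ n m ⋙ tensorLeft ((res (blockFst n m)).obj V) ≅
    (tensorLeft.{u} V).prod (𝟭 (LieMod.{u} (gl m))) ⋙ C₀ n m :=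
  tensorC₀Iso (W := (res (blockFst n m)).obj V) (ι := V) (g := fun w => w) (fun _ h => h)
    (fun X => (TensorProduct.assoc ℂ V X.1 X.2).symm)
    (fun X a w x y => by
      change mkC₀Lin _ _ (tm V X.1 ⁅blockFst n m a, w⁆ x) y +
        (shiftChar n m a • mkC₀Lin _ _ (tm V X.1 w x) y +
          mkC₀Lin _ _ (tm V X.1 w ⁅blockFst n m a, x⁆) y +
          mkC₀Lin _ _ (tm V X.1 w x) ⁅blockSnd n m a, y⁆) = ⁅a, mkC₀Lin _ _ (tm V X.1 w x) y⁆
      rw [lie_mkC₀Lin, lie_tm, map_add, LinearMap.add_apply]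
      abel)
    (fun f w x y => rfl)

/-- Tensoring the second argument of `C₀`. -/
def C₀TensorSnd : C₀ n m ⋙ tensorLeft ((res (blockSnd n m)).obj V') ≅
    (𝟭 (LieMod.{u} (gl n))).prod (tensorLeft.{u} V') ⋙ C₀ n m :=
  tensorC₀Iso (W := (res (blockSnd n m)).obj V') (ι := V') (g := fun w => w) (fun _ h => h)
    (fun X => TensorProduct.leftComm ℂ V' X.1 X.2)
    (fun X a w x y => by
      change mkC₀Lin _ _ x (tm V' X.2 ⁅blockSnd n m a, w⁆ y) +
        (shiftChar n m a • mkC₀Lin _ _ x (tm V' X.2 w y) +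
          mkC₀Lin _ _ ⁅blockFst n m a, x⁆ (tm V' X.2 w y) +
          mkC₀Lin _ _ x (tm V' X.2 w ⁅blockSnd n m a, y⁆)) = ⁅a, mkC₀Lin _ _ x (tm V' X.2 w y)⁆
      rw [lie_mkC₀Lin, lie_tm, map_add]
      abel)
    (fun f w x y => rfl)

/-- The exterior tensor product of two modules over the diagonal blocks. -/
def outer : LieMod.{0} (parabolic n m) :=
  tensor.obj ((res (blockFst n m)).obj V, (res (blockSnd n m)).obj V')

/-- Tensoring both arguments of `C₀`. -/
def C₀TensorBoth : C₀ n m ⋙ tensorLeft (outer V V') ≅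
    (tensorLeft.{u} V).prod (tensorLeft.{u} V') ⋙ C₀ n m :=
  tensorC₀Iso (W := outer V V') (g := fun w : V × V' => tm₂ ((res (blockFst n m)).obj V)
      ((res (blockSnd n m)).obj V') w.1 w.2) (fun T h => tm₂_top T fun v w => h (v, w))
    (fun X => TensorProduct.tensorTensorTensorComm ℂ V V' X.1 X.2)
    (fun X a w x y => by
      let F : outer V V' →ₗ[ℂ] (C₀ n m).obj (((tensorLeft V).prod (tensorLeft V')).obj X) :=
        (mkC₀Equiv ((tensorLeft V).obj X.1) ((tensorLeft V').obj X.2)).toLinearMap ∘ₗ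
          (TensorProduct.tensorTensorTensorComm ℂ V V' X.1 X.2).toLinearMap ∘ₗ
          (TensorProduct.mk ℂ (V ⊗[ℂ] V') (X.1 ⊗[ℂ] X.2)).flip (x ⊗ₜ y)
      have h := (congrArg F (lie_tm₂ (A := (res (blockFst n m)).obj V)
        (B := (res (blockSnd n m)).obj V') a w.1 w.2)).trans (map_add F _ _)
      refine (congrArg (fun t : (C₀ n m).obj (((tensorLeft V).prod (tensorLeft V')).obj X) => t + _)
        h).trans ?_
      change (mkC₀Lin _ _ (tm V X.1 ⁅blockFst n m a, w.1⁆ x) (tm V' X.2 w.2 y) +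
          mkC₀Lin _ _ (tm V X.1 w.1 x) (tm V' X.2 ⁅blockSnd n m a, w.2⁆ y)) +
        (shiftChar n m a • mkC₀Lin _ _ (tm V X.1 w.1 x) (tm V' X.2 w.2 y) +
          mkC₀Lin _ _ (tm V X.1 w.1 ⁅blockFst n m a, x⁆) (tm V' X.2 w.2 y) +
          mkC₀Lin _ _ (tm V X.1 w.1 x) (tm V' X.2 w.2 ⁅blockSnd n m a, y⁆)) =
        ⁅a, mkC₀Lin _ _ (tm V X.1 w.1 x) (tm V' X.2 w.2 y)⁆
      rw [lie_mkC₀Lin, lie_tm, lie_tm, map_add, map_add, LinearMap.add_apply]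
      abel)
    (fun f w x y => rfl)

/-! ### Induction from twisted modules -/

/-- `(M, N) ↦ U(gl n+m) ⊗ (W ⊗ C₀ (M, N))`. -/
def twist (W : LieMod.{0} (parabolic n m)) :
    LieMod.{u} (gl n) × LieMod.{u} (gl m) ⥤ LieMod.{u} (gl (n + m)) :=
  C₀ n m ⋙ tensorLeft W ⋙ ind (parabolic n m)

/-- `twist` is functorial. -/
def twistMap {W W' : LieMod.{0} (parabolic n m)} (f : W ⟶ W') : twist.{u} W ⟶ twist.{u} W' :=
  Functor.whiskerLeft (C₀ n m) (Functor.whiskerRight (tensorLeftMap f) (ind (parabolic n m)))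

/-- This turns sequences of modules over the parabolic subalgebra into sequences of bifunctors:
tensoring over a field and induction are exact. -/
theorem twistMap_exact {A B D : LieMod.{0} (parabolic n m)} {f : A ⟶ B} {g : B ⟶ D}
    (h : IsShortExact f g) : IsShortExactFunctors (twistMap.{u} f) (twistMap.{u} g) := fun X =>
  (parabolicComplement n m).ind_exact (tensorLeftMap_exact h ((C₀ n m).obj X))

/-- `twist` of isomorphic modules. -/
def twistIso {W W' : LieMod.{0} (parabolic n m)} (e : W ≅ W') : twist.{u} W ≅ twist.{u} W' where
  hom := twistMap e.hom
  inv := twistMap e.inv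
  hom_inv_id := NatTrans.ext (funext fun X => ind_tensor_hom_ext fun v t =>
    congrArg (fun v => indMk (parabolic n m) _ 1 (tm W ((C₀ n m).obj X) v t)) (inv_toLin e v))
  inv_hom_id := NatTrans.ext (funext fun X => ind_tensor_hom_ext fun v t =>
    congrArg (fun v => indMk (parabolic n m) _ 1 (tm W' ((C₀ n m).obj X) v t)) (toLin_inv e v))

theorem twist_exact_left (W : LieMod.{0} (parabolic n m)) (N : LieMod.{u} (gl m))
    {A B D : LieMod.{u} (gl n)} {f : A ⟶ B} {g : B ⟶ D} (h : IsShortExact f g) :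
    IsShortExact ((twist W).map (Prod.mkHom f (𝟙 N))) ((twist W).map (Prod.mkHom g (𝟙 N))) :=
  (parabolicComplement n m).ind_exact (tensorLeft_exact W (tensorLeft_exact (shift n m)
    (tensor_exact_left ((res (blockSnd n m)).obj N) (f := (res (blockFst n m)).map f)
      (g := (res (blockFst n m)).map g) h)))

theorem twist_exact_right (W : LieMod.{0} (parabolic n m)) (M : LieMod.{u} (gl n))
    {A B D : LieMod.{u} (gl m)} {f : A ⟶ B} {g : B ⟶ D} (h : IsShortExact f g) :
    IsShortExact ((twist W).map (Prod.mkHom (𝟙 M) f)) ((twist W).map (Prod.mkHom (𝟙 M) g)) :=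
  (parabolicComplement n m).ind_exact (tensorLeft_exact W (tensorLeft_exact (shift n m)
    (tensor_exact_right ((res (blockFst n m)).obj M) (f := (res (blockSnd n m)).map f)
      (g := (res (blockSnd n m)).map g) h)))

theorem twist_zero {W : LieMod.{0} (parabolic n m)} (hW : ∀ w : W, w = 0)
    (X : LieMod.{u} (gl n) × LieMod.{u} (gl m)) (v : (twist W).obj X) : v = 0 := by
  refine (LieSubmodule.mem_bot v).1 (ind_top (N := (tensorLeft W).obj ((C₀ n m).obj X)) ⊥
    (fun t => ?_) v)
  refine (LieSubmodule.mem_bot _).2 ?_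
  have ht : t = 0 := tm_top ⊥ (fun w s => by
    rw [hW w, map_zero, LinearMap.zero_apply]; exact zero_mem _) t
  rw [ht]
  exact map_zero (indIn _)

/-- The tensor identity for `twist`. -/
def twistRes (V : LieMod.{0} (gl (n + m))) :
    twist.{u} (resSub (parabolic n m) V) ≅ C n m ⋙ tensorLeft V :=
  Functor.isoWhiskerLeft (C₀ n m) (tensorInd V)

/-- `twist` by a module over the first block. -/
def twistFst : twist.{u} ((res (blockFst n m)).obj V) ≅
    (tensorLeft.{u} V).prod (𝟭 (LieMod.{u} (gl m))) ⋙ C n m :=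
  Functor.isoWhiskerRight (C₀TensorFst V) (ind (parabolic n m))

/-- `twist` by a module over the second block. -/
def twistSnd : twist.{u} ((res (blockSnd n m)).obj V') ≅
    (𝟭 (LieMod.{u} (gl n))).prod (tensorLeft.{u} V') ⋙ C n m :=
  Functor.isoWhiskerRight (C₀TensorSnd V') (ind (parabolic n m))

/-- `twist` by an exterior tensor product. -/
def twistBoth : twist.{u} (outer V V') ≅
    (tensorLeft.{u} V).prod (tensorLeft.{u} V') ⋙ C n m :=
  Functor.isoWhiskerRight (C₀TensorBoth V V') (ind (parabolic n m))

section

variable {M : LieMod.{u} (gl n)} {N : LieMod.{u} (gl m)}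

/-- The element `1 ⊗ (w ⊗ (v ⊗ v'))`. -/
def mkTwist {W : LieMod.{0} (parabolic n m)} (w : W) (v : M) (v' : N) : (twist W).obj (M, N) :=
  indMk (parabolic n m) _ 1 (tm W ((C₀ n m).obj (M, N)) w (mkC₀ v v'))

theorem twistRes_mkTwist (V : LieMod.{0} (gl (n + m))) (u : V) (v : M) (v' : N) :
    toLin ((twistRes V).hom.app (M, N)) (mkTwist (W := resSub (parabolic n m) V) u v v') =
      tm V ((C n m).obj (M, N)) u (mkC n m v v') :=
  tensorIndHom_mk V ((C₀ n m).obj (M, N)) u (mkC₀ v v')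

theorem twistRes_inv_tm (V : LieMod.{0} (gl (n + m))) (u : V) (v : M) (v' : N) :
    toLin ((twistRes V).inv.app (M, N)) (tm V ((C n m).obj (M, N)) u (mkC n m v v')) =
      mkTwist (W := resSub (parabolic n m) V) u v v' :=
  tensorIndInv_mk V ((C₀ n m).obj (M, N)) u (mkC₀ v v')

theorem twistFst_mkTwist (u : V) (v : M) (v' : N) :
    toLin ((twistFst V).hom.app (M, N)) (mkTwist (W := (res (blockFst n m)).obj V) u v v') =
      mkC n m (tm V M u v) v' :=
  congrArg (fun t => indMk (parabolic n m) _ 1 (mkC₀Equiv ((tensorLeft V).obj M) N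
    ((TensorProduct.assoc ℂ V M N).symm t)))
    (tensorC₀Equiv_symm (W := (res (blockFst n m)).obj V) u v v')

theorem twistSnd_mkTwist (u : V') (v : M) (v' : N) :
    toLin ((twistSnd V').hom.app (M, N)) (mkTwist (W := (res (blockSnd n m)).obj V') u v v') =
      mkC n m v (tm V' N u v') :=
  congrArg (fun t => indMk (parabolic n m) _ 1 (mkC₀Equiv M ((tensorLeft V').obj N)
    (TensorProduct.leftComm ℂ V' M N t)))
    (tensorC₀Equiv_symm (W := (res (blockSnd n m)).obj V') u v v')

theorem twistFst_inv_mkC (u : V) (v : M) (v' : N) :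
    toLin ((twistFst V).inv.app (M, N)) (mkC n m (tm V M u v) v') =
      mkTwist (W := (res (blockFst n m)).obj V) u v v' := by
  rw [← twistFst_mkTwist]
  exact inv_toLin ((twistFst V).app (M, N)) _

theorem twistSnd_inv_mkC (u : V') (v : M) (v' : N) :
    toLin ((twistSnd V').inv.app (M, N)) (mkC n m v (tm V' N u v')) =
      mkTwist (W := (res (blockSnd n m)).obj V') u v v' := by
  rw [← twistSnd_mkTwist]
  exact inv_toLin ((twistSnd V').app (M, N)) _

end

end

end GLn
end

noncomputable section

/-! ### Duals of homomorphisms -/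

namespace LieMod

variable {L : Type} [LieRing L] [LieAlgebra ℂ L]

/-- The transpose of a homomorphism. -/
def dualMap {A B : LieMod.{0} L} (f : A ⟶ B) : dual B ⟶ dual A :=
  ⟨{ (toLin f).toLinearMap.dualMap with
     map_lie' := fun {x} {g : Module.Dual ℂ B} => LinearMap.ext fun v =>
      congrArg (fun w => -g w) ((toLin f).map_lie x v).symm }⟩

theorem IsShortExact.dual {A B D : LieMod.{0} L} {f : A ⟶ B} {g : B ⟶ D} (h : IsShortExact f g) :
    IsShortExact (dualMap g) (dualMap f) := by
  refine ⟨LinearMap.dualMap_injective_of_surjective (f := (toLin g).toLinearMap) h.2.2, ?_,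
    LinearMap.dualMap_surjective_of_injective (f := (toLin f).toLinearMap) h.1⟩
  have h1 : Function.Exact (toLin f).toLinearMap (toLin g).toLinearMap := h.2.1
  have h2 : Function.Exact (toLin g).toLinearMap.dualMap (toLin f).toLinearMap.dualMap := by
    rw [LinearMap.exact_iff, LinearMap.ker_dualMap_eq_dualAnnihilator_range,
      LinearMap.range_dualMap_eq_dualAnnihilator_ker, LinearMap.exact_iff.1 h1]
  exact h2

end LieMod

namespace GLn

open LieMod

/-! ### The standard representation and the parabolic subalgebra -/

section Standard

variable (n m : ℕ)

theorem mulVec_append_zero {x : gl (n + m)} (hx : x ∈ parabolic n m) (v : Fin n → ℂ) :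
    x.mulVec (Fin.append v 0) =
      Fin.append ((x.submatrix (Fin.castAdd m) (Fin.castAdd m)).mulVec v) (0 : Fin m → ℂ) := by
  ext k
  rw [Matrix.mulVec, dotProduct, Fin.sum_univ_add]
  refine Fin.addCases (fun a => ?_) (fun b => ?_) k
  · simp [Matrix.mulVec, dotProduct]
  · simp [hx b]

theorem append_zero_injective : Function.Injective fun v : Fin n → ℂ => Fin.append v (0 : Fin m → ℂ) :=
  fun v w h => funext fun a => by
    have h1 : Fin.append v (0 : Fin m → ℂ) (Fin.castAdd m a) = Fin.append w 0 (Fin.castAdd m a) :=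
      congrFun h (Fin.castAdd m a)
    rwa [Fin.append_left, Fin.append_left] at h1

/-- The inclusion of the standard representation of the first block. -/
def inclStd : (res (blockFst n m)).obj (std n) ⟶ resSub (parabolic n m) (std (n + m)) :=
  ⟨{ inclL n m with
     map_lie' := fun {x v} => by
      exact (mulVec_append_zero n m x.2 v).symm }⟩

/-- The projection to the standard representation of the second block. -/
def projStd : resSub (parabolic n m) (std (n + m)) ⟶ (res (blockSnd n m)).obj (std m) :=
  ⟨{ projL n m with
     map_lie' := fun {x v} => by
      change (fun b => x.1.mulVec (v : Fin (n + m) → ℂ) (Fin.natAdd n b)) =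
        (blockSnd n m x).mulVec fun b => (v : Fin (n + m) → ℂ) (Fin.natAdd n b)
      ext b
      change ∑ l, x.1 (Fin.natAdd n b) l * (v : Fin (n + m) → ℂ) l = _
      rw [Fin.sum_univ_add]
      simp only [x.2 b, zero_mul, Finset.sum_const_zero, zero_add]
      rfl }⟩

/-- The source of all exact sequences below: block upper triangular matrices preserve the span of
the first n basis vectors. -/
theorem std_exact : IsShortExact (inclStd n m) (projStd n m) := by
  refine ⟨append_zero_injective n m, fun v => ⟨fun h => ?_, ?_⟩, fun w => ?_⟩
  · refine ⟨(fun a => (v : Fin (n + m) → ℂ) (Fin.castAdd m a) : Fin n → ℂ), ?_⟩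
    change Fin.append (fun a => (v : Fin (n + m) → ℂ) (Fin.castAdd m a)) (0 : Fin m → ℂ) = v
    ext k
    refine Fin.addCases (fun a => ?_) (fun b => ?_) k
    · rw [Fin.append_left]
    · rw [Fin.append_right]
      exact (congrFun h b).symm
  · rintro ⟨w, rfl⟩
    exact funext fun b => Fin.append_right (w : Fin n → ℂ) 0 b
  · exact ⟨(Fin.append (0 : Fin n → ℂ) (w : Fin m → ℂ) : Fin (n + m) → ℂ),
      funext fun b => Fin.append_right (0 : Fin n → ℂ) (w : Fin m → ℂ) b⟩

end Standard

/-! ### Block components of the functors -/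

section Components

variable {n m : ℕ} {i j : ℤ}

/-- Only the annihilating ideal is inherited by A from B, and that is enough. It avoids showing that
the steps of a filtration, which are submodules, belong to category O. -/
theorem exists_isComp_proj_of_injective {A B : LieMod.{u} (gl n)} (f : A ⟶ B)
    (hf : Function.Injective (toLin f)) (h : catO n B) (d : ℤ) :
    ∃ r, IsComp d ((projIncl n d).app A) r := by
  obtain ⟨k, K, hK, hM⟩ := exists_split (c := d) h
  exact exists_isComp_proj hK (hM.of_injective f hf)

theorem FinWt.isComp {e d : ℤ} {V : LieMod.{0} (gl n)} (hV : FinWt e V) (hd : e + i = d)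
    (M : LieMod.{u} (gl n)) (hM : block n i M) :
    InO (intWt (rho n) d) ((LieMod.tensorLeft V).obj M) ∧
      ∃ r, IsComp d ((Functor.whiskerLeft (LieMod.tensorLeft V) (projIncl n d)).app M) r := by
  have h := hV.tensor (block_iff.1 hM).1
  rw [hd] at h
  exact ⟨h, exists_isComp_proj_of_catO d h.catO⟩

theorem isComp_id_of_block (M : LieMod.{u} (gl n)) (hM : block n i M) :
    InO (intWt (rho n) i) ((𝟭 (LieMod.{u} (gl n))).obj M) ∧
      ∃ r, IsComp i (NatTrans.app (𝟙 (𝟭 (LieMod.{u} (gl n)))) M) r := by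
  obtain ⟨h, k, hk⟩ := block_iff.1 hM
  exact ⟨h, 𝟙 M, isComp_id hk⟩

/-- Pointwise this is `IsComp.C`; the degrees c, c' of the unprojected values are what prevents
other pairs of blocks from contributing to d. -/
theorem isCompFunctor_beforeC {S S' : LieMod.{u} (gl n) ⥤ LieMod.{u} (gl n)}
    {T T' : LieMod.{u} (gl m) ⥤ LieMod.{u} (gl m)} (σ : S ⟶ S') (τ : T ⟶ T') {c c' d : ℤ}
    (hσ : ∀ M, block n i M → InO (intWt (rho n) c) (S'.obj M) ∧ ∃ r, IsComp c (σ.app M) r)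
    (hτ : ∀ M, block m j M → InO (intWt (rho m) c') (T'.obj M) ∧ ∃ r, IsComp c' (τ.app M) r)
    (hd : c + c' = d) :
    IsCompFunctor d (beforeCMap σ τ : (beforeC S T : Blocks.{u} n m i j ⥤ _) ⟶ _) := fun X => by
  obtain ⟨h1, r, hr⟩ := hσ X.1.obj X.1.property
  obtain ⟨h2, r', hr'⟩ := hτ X.2.obj X.2.property
  have := hr.C hr' h1 h2
  rw [hd] at this
  exact ⟨_, this⟩

theorem FinWt.catO_C {e : ℤ} {V : LieMod.{0} (gl (n + m))} (hV : FinWt e V)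
    (X : Blocks.{u} n m i j) :
    catO (n + m) ((LieMod.tensorLeft V).obj ((C n m).obj ((blocksIncl n m i j).obj X))) :=
  (hV.tensor (block_iff.1 (block_C X.1.property X.2.property)).1).catO

theorem FinWt.isCompFunctor_afterC {e : ℤ} {V : LieMod.{0} (gl (n + m))} (hV : FinWt e V) (d : ℤ) :
    IsCompFunctor d (afterCMap (Functor.whiskerLeft (LieMod.tensorLeft V) (projIncl (n + m) d)) :
      (afterC (LieMod.tensorLeft V ⋙ proj (n + m) d) : Blocks.{u} n m i j ⥤ _) ⟶ _) := fun X =>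
  exists_isComp_proj_of_catO d (hV.catO_C X)

/-- The block component of an exact functor is exact, because it is a natural direct summand. -/
theorem isExactBifunctor_proj {H : LieMod.{u} (gl n) × LieMod.{u} (gl m) ⥤ LieMod.{u} (gl (n + m))}
    {d : ℤ}
    (hl : ∀ (N : LieMod.{u} (gl m)) {A B D : LieMod.{u} (gl n)} {f : A ⟶ B} {g : B ⟶ D},
      IsShortExact f g → IsShortExact (H.map (Prod.mkHom f (𝟙 N))) (H.map (Prod.mkHom g (𝟙 N))))
    (hr : ∀ (M : LieMod.{u} (gl n)) {A B D : LieMod.{u} (gl m)} {f : A ⟶ B} {g : B ⟶ D},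
      IsShortExact f g → IsShortExact (H.map (Prod.mkHom (𝟙 M) f)) (H.map (Prod.mkHom (𝟙 M) g)))
    (hc : ∀ X : Blocks.{u} n m i j,
      ∃ r, IsComp d ((projIncl (n + m) d).app (H.obj ((blocksIncl n m i j).obj X))) r) :
    IsExactBifunctor (blocksIncl n m i j ⋙ H ⋙ proj (n + m) d) := by
  refine ⟨fun N M₁ M₂ M₃ f g h => ?_, fun M N₁ N₂ N₃ f g h => ?_⟩
  · obtain ⟨r₁, h₁⟩ := hc (M₁, N)
    obtain ⟨r₂, h₂⟩ := hc (M₂, N)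
    obtain ⟨r₃, h₃⟩ := hc (M₃, N)
    exact h₁.isShortExact h₂ h₃ (hl N.obj h) rfl rfl
  · obtain ⟨r₁, h₁⟩ := hc (M, N₁)
    obtain ⟨r₂, h₂⟩ := hc (M, N₂)
    obtain ⟨r₃, h₃⟩ := hc (M, N₃)
    exact h₁.isShortExact h₂ h₃ (hr M.obj h) rfl rfl

theorem FinWt.isExactBifunctor_afterC {e : ℤ} {V : LieMod.{0} (gl (n + m))} (hV : FinWt e V)
    (d : ℤ) : IsExactBifunctor
      (afterC (LieMod.tensorLeft V ⋙ proj (n + m) d) : Blocks.{u} n m i j ⥤ _) :=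
  isExactBifunctor_proj (H := C n m ⋙ LieMod.tensorLeft V)
    (fun N _ _ _ _ _ h => tensorLeft_exact V (C_exact_left N h))
    (fun M _ _ _ _ _ h => tensorLeft_exact V (C_exact_right M h))
    fun X => exists_isComp_proj_of_catO d (hV.catO_C X)

/-- A filtration of a representation by submodules over the parabolic subalgebra gives rise to a
filtration of functors. -/
theorem FinWt.hasExactFiltration {a : ℕ} {e d : ℤ} {V : LieMod.{0} (gl (n + m))} (hV : FinWt e V)
    (W : Fin (a + 2) → LieSubmodule ℂ (parabolic n m) (resSub (parabolic n m) V)) (h0 : W 0 = ⊥)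
    (h1 : W (Fin.last (a + 1)) = ⊤) {V' : Fin (a + 1) → LieMod.{0} (gl n)}
    {V'' : Fin (a + 1) → LieMod.{0} (gl m)} {e' e'' d' d'' : Fin (a + 1) → ℤ}
    (hV' : ∀ k, FinWt (e' k) (V' k)) (hV'' : ∀ k, FinWt (e'' k) (V'' k))
    (hd' : ∀ k, e' k + i = d' k) (hd'' : ∀ k, e'' k + j = d'' k) (hd : ∀ k, d' k + d'' k = d)
    (hW : ∀ k : Fin (a + 1), ∃ (hk : W k.castSucc ≤ W k.succ)
      (q : subObj (W k.succ) ⟶ outer (V' k) (V'' k)), IsShortExact (subIncl hk) q) :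
    HasExactFiltration a (afterC (LieMod.tensorLeft V ⋙ proj (n + m) d) : Blocks.{u} n m i j ⥤ _)
      fun k => beforeC (LieMod.tensorLeft (V' k) ⋙ proj n (d' k))
        (LieMod.tensorLeft (V'' k) ⋙ proj m (d'' k)) := by
  have hcomp (k : Fin (a + 2)) (X : Blocks.{u} n m i j) : ∃ r, IsComp d ((projIncl (n + m) d).app
      ((twist (subObj (W k))).obj ((blocksIncl n m i j).obj X))) r := by
    let f : subObj (W k) ⟶ resSub (parabolic n m) V := ⟨(W k).incl⟩
    have hf : IsShortExact f (⟨LieSubmodule.Quotient.mk' (W k)⟩ :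
        resSub (parabolic n m) V ⟶ ⟨resSub (parabolic n m) V ⧸ W k⟩) := by
      refine ⟨Subtype.val_injective, fun v => ⟨fun hv => ?_, ?_⟩, fun v => ?_⟩
      · exact ⟨⟨v, (LieSubmodule.Quotient.mk_eq_zero (W k)).1 hv⟩, rfl⟩
      · rintro ⟨w, rfl⟩
        exact (LieSubmodule.Quotient.mk_eq_zero (W k)).2 w.2
      · exact LieSubmodule.Quotient.surjective_mk' (W k) v
    -- By exactness and the tensor identity, `twist` of the submodule W_k embeds into V ⊗ C(M, N),
    -- which does lie in category O.
    exact exists_isComp_proj_of_injective _ ((twistMap_exact.{u} hf).of_iso (Iso.refl _) (twistRes V)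
      (Iso.refl _) ((blocksIncl n m i j).obj X)).1 (hV.catO_C X) d
  refine ⟨fun k => blocksIncl n m i j ⋙ twist (subObj (W k)) ⋙ proj (n + m) d, fun k => ?_,
    fun X v => ?_, ⟨?_⟩, fun k => ?_⟩
  · exact isExactBifunctor_proj (H := twist (subObj (W k)))
      (fun N _ _ _ _ _ h => twist_exact_left _ N h) (fun M _ _ _ _ _ h => twist_exact_right _ M h)
      (hcomp k)
  · refine Subtype.ext (twist_zero (W := subObj (W 0)) (fun w => Subtype.ext ?_) _ v.1)
    exact (LieSubmodule.mem_bot _).1 (h0.le w.2)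
  · let e : subObj (W (Fin.last (a + 1))) ≅ resSub (parabolic n m) V :=
      isoOfEquiv (LinearEquiv.ofBijective (W (Fin.last (a + 1))).incl.toLinearMap
        ⟨Subtype.val_injective, fun v => ⟨⟨v, h1 ▸ LieSubmodule.mem_top v⟩, rfl⟩⟩) fun x w => rfl
    exact Functor.isoWhiskerLeft (blocksIncl n m i j)
      (Functor.isoWhiskerRight (twistIso e ≪≫ twistRes V) (proj (n + m) d))
  · obtain ⟨hk, q, hq⟩ := hW k
    have hs : IsShortExactFunctors (Functor.whiskerLeft (blocksIncl.{u} n m i j)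
        (twistMap (subIncl hk))) (Functor.whiskerLeft (blocksIncl n m i j)
          (twistMap q ≫ (twistBoth (V' k) (V'' k)).hom)) := fun X =>
      ((twistMap_exact hq).of_iso (Iso.refl _) (Iso.refl _) (twistBoth (V' k) (V'' k)))
        ((blocksIncl n m i j).obj X)
    -- Projecting to the block d turns the quotient C(V' ⊗ M, V'' ⊗ N) into C of the projections to
    -- the blocks d' and d''.
    obtain ⟨α', β', h, -⟩ := IsCompFunctor.exists_summand (c := d)
      (s₁ := Functor.whiskerLeft (blocksIncl n m i j)
        (Functor.whiskerLeft (twist (subObj (W k.castSucc))) (projIncl (n + m) d)))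
      (s₂ := Functor.whiskerLeft (blocksIncl n m i j)
        (Functor.whiskerLeft (twist (subObj (W k.succ))) (projIncl (n + m) d)))
      (s₃ := beforeCMap (Functor.whiskerLeft (LieMod.tensorLeft (V' k)) (projIncl n (d' k)))
        (Functor.whiskerLeft (LieMod.tensorLeft (V'' k)) (projIncl m (d'' k))))
      (hcomp k.castSucc) (hcomp k.succ)
      (isCompFunctor_beforeC _ _ ((hV' k).isComp (hd' k)) ((hV'' k).isComp (hd'' k)) (hd k)) hs
    exact ⟨α', β', h⟩

end Components

end GLn
end

noncomputable section

namespace GLn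

open LieMod

/-! ### The exact sequences and filtrations -/

section Main

variable (n m : ℕ) (i j : ℤ)

/-- `std_exact` is twisted and its three terms are identified by `twistFst`, `twistRes` and
`twistSnd`. Tensoring raises degrees by one, so all three embeddings are block components for the
index i + j + 1. -/
theorem exists_exact_E :
    ∃ (α : (beforeC (LieMod.tensorLeft (std n)) (𝟭 _) : Blocks.{u} n m i j ⥤ _) ⟶
          afterC (LieMod.tensorLeft (std (n + m))))
        (β : (afterC (LieMod.tensorLeft (std (n + m))) : Blocks.{u} n m i j ⥤ _) ⟶
          beforeC (𝟭 _) (LieMod.tensorLeft (std m))),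
      (∀ (X : Blocks.{u} n m i j) (v : std n) (x : X.1.obj) (y : X.2.obj),
        toLin (α.app X) (mkC n m (v ⊗ₜ[ℂ] x) y) = (inclL n m v : std (n + m)) ⊗ₜ[ℂ] mkC n m x y) ∧
      (∀ (X : Blocks.{u} n m i j) (w : std (n + m)) (x : X.1.obj) (y : X.2.obj),
        toLin (β.app X) (w ⊗ₜ[ℂ] mkC n m x y) = mkC n m x ((projL n m w : std m) ⊗ₜ[ℂ] y)) ∧
      IsShortExactFunctors α β ∧
      ∃ (α' : (beforeC (E n i) (𝟭 _) : Blocks.{u} n m i j ⥤ _) ⟶ afterC (E (n + m) (i + j)))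
          (β' : (afterC (E (n + m) (i + j)) : Blocks.{u} n m i j ⥤ _) ⟶ beforeC (𝟭 _) (E m j)),
        IsShortExactFunctors α' β' ∧
        IsDirectSummand α' β' α β (beforeCMap (inclE n i) (𝟙 _))
          (afterCMap (inclE (n + m) (i + j))) (beforeCMap (𝟙 _) (inclE m j)) := by
  let α := (twistFst.{u} (std n)).inv ≫ twistMap (inclStd n m) ≫ (twistRes (std (n + m))).hom
  let β := (twistRes.{u} (std (n + m))).inv ≫ twistMap (projStd n m) ≫ (twistSnd (std m)).hom
  have hs : IsShortExactFunctors (Functor.whiskerLeft (blocksIncl n m i j) α)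
      (Functor.whiskerLeft (blocksIncl n m i j) β) := fun X =>
    (twistMap_exact (std_exact n m)).of_iso (twistFst (std n)).symm (twistRes (std (n + m)))
      (twistSnd (std m)) ((blocksIncl n m i j).obj X)
  refine ⟨Functor.whiskerLeft (blocksIncl n m i j) α, Functor.whiskerLeft (blocksIncl n m i j) β,
    fun X v x y => ?_, fun X w x y => ?_, hs, IsCompFunctor.exists_summand
      (isCompFunctor_beforeC _ _ ((finWt_std n).isComp (add_comm 1 i)) isComp_id_of_block
        (show i + 1 + j = i + j + 1 by ring))
      ((finWt_std (n + m)).isCompFunctor_afterC (i + j + 1))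
      (isCompFunctor_beforeC _ _ isComp_id_of_block ((finWt_std m).isComp (add_comm 1 j))
        (add_assoc i j 1).symm) hs⟩
  · exact (congrArg (fun t => toLin ((twistRes (std (n + m))).hom.app _)
      (toLin ((twistMap (inclStd n m)).app _) t)) (twistFst_inv_mkC (std n) v x y)).trans
      (twistRes_mkTwist (std (n + m)) (inclL n m v) x y)
  · exact (congrArg (fun t => toLin ((twistSnd (std m)).hom.app _)
      (toLin ((twistMap (projStd n m)).app _) t)) (twistRes_inv_tm (std (n + m)) w x y)).trans
      (twistSnd_mkTwist (std m) (projL n m w) x y)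

/-- Dualizing `std_exact` exchanges sub and quotient, which is why the second argument of C now
appears in the subfunctor. -/
theorem exists_exact_F :
    ∃ (α : (beforeC (𝟭 _) (LieMod.tensorLeft (dual (std m))) : Blocks.{u} n m i j ⥤ _) ⟶
          afterC (LieMod.tensorLeft (dual (std (n + m)))))
        (β : (afterC (LieMod.tensorLeft (dual (std (n + m)))) : Blocks.{u} n m i j ⥤ _) ⟶
          beforeC (LieMod.tensorLeft (dual (std n))) (𝟭 _)),
      (∀ (X : Blocks.{u} n m i j) (ξ : Module.Dual ℂ (Fin m → ℂ)) (x : X.1.obj) (y : X.2.obj),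
        toLin (α.app X) (mkC n m x ((ξ : dual (std m)) ⊗ₜ[ℂ] y)) =
          (ξ ∘ₗ projL n m : dual (std (n + m))) ⊗ₜ[ℂ] mkC n m x y) ∧
      (∀ (X : Blocks.{u} n m i j) (η : Module.Dual ℂ (Fin (n + m) → ℂ)) (x : X.1.obj) (y : X.2.obj),
        toLin (β.app X) ((η : dual (std (n + m))) ⊗ₜ[ℂ] mkC n m x y) =
          mkC n m ((η ∘ₗ inclL n m : dual (std n)) ⊗ₜ[ℂ] x) y) ∧
      IsShortExactFunctors α β ∧
      ∃ (α' : (beforeC (𝟭 _) (F m j) : Blocks.{u} n m i j ⥤ _) ⟶ afterC (F (n + m) (i + j)))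
          (β' : (afterC (F (n + m) (i + j)) : Blocks.{u} n m i j ⥤ _) ⟶ beforeC (F n i) (𝟭 _)),
        IsShortExactFunctors α' β' ∧
        IsDirectSummand α' β' α β (beforeCMap (𝟙 _) (inclF m j))
          (afterCMap (inclF (n + m) (i + j))) (beforeCMap (inclF n i) (𝟙 _)) := by
  let f : (res (blockSnd n m)).obj (dual (std m)) ⟶ resSub (parabolic n m) (dual (std (n + m))) :=
    dualMap (projStd n m)
  let g : resSub (parabolic n m) (dual (std (n + m))) ⟶ (res (blockFst n m)).obj (dual (std n)) :=
    dualMap (inclStd n m)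
  have hfg : IsShortExact f g := (std_exact n m).dual
  let α := (twistSnd.{u} (dual (std m))).inv ≫ twistMap f ≫ (twistRes (dual (std (n + m)))).hom
  let β := (twistRes.{u} (dual (std (n + m)))).inv ≫ twistMap g ≫ (twistFst (dual (std n))).hom
  have hs : IsShortExactFunctors (Functor.whiskerLeft (blocksIncl n m i j) α)
      (Functor.whiskerLeft (blocksIncl n m i j) β) := fun X =>
    (twistMap_exact hfg).of_iso (twistSnd (dual (std m))).symm (twistRes (dual (std (n + m))))
      (twistFst (dual (std n))) ((blocksIncl n m i j).obj X)
  refine ⟨Functor.whiskerLeft (blocksIncl n m i j) α, Functor.whiskerLeft (blocksIncl n m i j) β,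
    fun X v x y => ?_, fun X w x y => ?_, hs, IsCompFunctor.exists_summand
      (isCompFunctor_beforeC _ _ isComp_id_of_block
        ((finWt_dual_std m).isComp (show -1 + j = j - 1 by ring))
        (show i + (j - 1) = i + j - 1 by ring))
      ((finWt_dual_std (n + m)).isCompFunctor_afterC (i + j - 1))
      (isCompFunctor_beforeC _ _ ((finWt_dual_std n).isComp (show -1 + i = i - 1 by ring))
        isComp_id_of_block (show i - 1 + j = i + j - 1 by ring)) hs⟩
  · exact (congrArg (fun t => toLin ((twistRes (dual (std (n + m)))).hom.app _)
      (toLin ((twistMap f).app _) t)) (twistSnd_inv_mkC (dual (std m)) v x y)).trans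
      (twistRes_mkTwist (dual (std (n + m))) (v ∘ₗ projL n m) x y)
  · exact (congrArg (fun t => toLin ((twistFst (dual (std n))).hom.app _)
      (toLin ((twistMap g).app _) t)) (twistRes_inv_tm (dual (std (n + m))) w x y)).trans
      (twistFst_mkTwist (dual (std n)) (w ∘ₗ inclL n m) x y)

theorem hasExactFiltration_Ediv (a : ℕ) :
    HasExactFiltration a (afterC (Ediv a (n + m) (i + j)) : Blocks.{u} n m i j ⥤ _)
      (fun k => beforeC (Ediv (a - k) n i) (Ediv k m j)) := by
  have := (finWt_std n).finite
  have := (finWt_std m).finite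
  have := (finWt_std (n + m)).finite
  have hA : Module.Finite ℂ ((res (blockFst n m)).obj (std n)) := (finWt_std n).finite
  have hB : Module.Finite ℂ ((res (blockSnd n m)).obj (std m)) := (finWt_std m).finite
  have hV : Module.Finite ℂ (resSub (parabolic n m) (std (n + m))) := (finWt_std (n + m)).finite
  obtain ⟨W, h0, h1, hW⟩ := exists_extPow_filtration (std_exact n m) a
  -- Exterior powers of restricted modules are by definition restrictions of exterior powers, so the
  -- filtration `hW` applies as it stands.
  refine ((finWt_std (n + m)).extPow a).hasExactFiltration W h0 h1
    (V' := fun k => extPow (a - k) (std n)) (V'' := fun k => extPow k (std m))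
    (d' := fun k => i + (a - k : ℕ)) (d'' := fun k => j + (k : ℕ))
    (fun k => (finWt_std n).extPow (a - k)) (fun k => (finWt_std m).extPow k)
    (fun k => by ring) (fun k => by ring) (fun k => ?_) hW
  have := k.2
  omega

theorem hasExactFiltration_Fdiv (a : ℕ) :
    HasExactFiltration a (afterC (Fdiv a (n + m) (i + j)) : Blocks.{u} n m i j ⥤ _)
      (fun k => beforeC (Fdiv k n i) (Fdiv (a - k) m j)) := by
  let A : LieMod.{0} (parabolic n m) := (res (blockSnd n m)).obj (dual (std m))
  let B : LieMod.{0} (parabolic n m) := (res (blockFst n m)).obj (dual (std n))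
  let V : LieMod.{0} (parabolic n m) := resSub (parabolic n m) (dual (std (n + m)))
  let f : A ⟶ V := dualMap (projStd n m)
  let g : V ⟶ B := dualMap (inclStd n m)
  have hfg : IsShortExact f g := (std_exact n m).dual
  have hA : Module.Finite ℂ A := (finWt_dual_std m).finite
  have hB : Module.Finite ℂ B := (finWt_dual_std n).finite
  have hV : Module.Finite ℂ V := (finWt_dual_std (n + m)).finite
  obtain ⟨W, h0, h1, hW⟩ := exists_extPow_filtration hfg a
  refine ((finWt_dual_std (n + m)).extPow a).hasExactFiltration W h0 h1
    (V' := fun k => extPow k (dual (std n))) (V'' := fun k => extPow (a - k) (dual (std m)))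
    (d' := fun k => i - (k : ℕ)) (d'' := fun k => j - (a - k : ℕ))
    (fun k => (finWt_dual_std n).extPow k) (fun k => (finWt_dual_std m).extPow (a - k))
    (fun k => by ring) (fun k => by ring) (fun k => ?_) fun k => ?_
  · have := k.2
    omega
  · obtain ⟨hk, q, hq⟩ := hW k
    -- In the dual sequence the submodule comes from gl_m and the quotient from gl_n, so the tensor
    -- factors are exchanged to match `outer`.
    exact ⟨hk, _, hq.of_iso (Iso.refl _) (Iso.refl _) (tensorSwap (extPow (a - k) A) (extPow k B))⟩

end Main

end GLn
end

theorem mainTheorem10 (n m : ℕ) (hn : 0 < n) (hm : 0 < m) (i j : ℤ) :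
    -- the functors are defined between the stated blocks
    (∀ (M : LieMod.{u} (GLn.gl n)) (N : LieMod.{u} (GLn.gl m)), GLn.block n i M → GLn.block m j N →
      GLn.block (n + m) (i + j) ((GLn.C n m).obj (M, N))) ∧
    (∀ (r : ℕ) (l : ℤ) (M : LieMod.{u} (GLn.gl r)), GLn.block r l M →
      GLn.block r (l + 1) ((GLn.E r l).obj M) ∧ GLn.block r (l - 1) ((GLn.F r l).obj M) ∧
      ∀ a : ℕ, GLn.block r (l + a) ((GLn.Ediv a r l).obj M) ∧
        GLn.block r (l - a) ((GLn.Fdiv a r l).obj M)) ∧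
    -- the exact sequence for `E`, a direct summand of the one for tensoring with `L`
    (∃ (α : (GLn.beforeC (LieMod.tensorLeft (GLn.std n)) (𝟭 _) : GLn.Blocks.{u} n m i j ⥤ _) ⟶
          GLn.afterC (LieMod.tensorLeft (GLn.std (n + m))))
        (β : (GLn.afterC (LieMod.tensorLeft (GLn.std (n + m))) : GLn.Blocks.{u} n m i j ⥤ _) ⟶
          GLn.beforeC (𝟭 _) (LieMod.tensorLeft (GLn.std m))),
      (∀ (X : GLn.Blocks.{u} n m i j) (v : GLn.std n) (x : X.1.obj) (y : X.2.obj),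
        LieMod.toLin (α.app X) (GLn.mkC n m (v ⊗ₜ[ℂ] x) y) =
          (GLn.inclL n m v : GLn.std (n + m)) ⊗ₜ[ℂ] GLn.mkC n m x y) ∧
      (∀ (X : GLn.Blocks.{u} n m i j) (w : GLn.std (n + m)) (x : X.1.obj) (y : X.2.obj),
        LieMod.toLin (β.app X) (w ⊗ₜ[ℂ] GLn.mkC n m x y) =
          GLn.mkC n m x ((GLn.projL n m w : GLn.std m) ⊗ₜ[ℂ] y)) ∧
      LieMod.IsShortExactFunctors α β ∧
      ∃ (α' : (GLn.beforeC (GLn.E n i) (𝟭 _) : GLn.Blocks.{u} n m i j ⥤ _) ⟶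
            GLn.afterC (GLn.E (n + m) (i + j)))
          (β' : (GLn.afterC (GLn.E (n + m) (i + j)) : GLn.Blocks.{u} n m i j ⥤ _) ⟶
            GLn.beforeC (𝟭 _) (GLn.E m j)),
        LieMod.IsShortExactFunctors α' β' ∧
        LieMod.IsDirectSummand α' β' α β (GLn.beforeCMap (GLn.inclE n i) (𝟙 _))
          (GLn.afterCMap (GLn.inclE (n + m) (i + j))) (GLn.beforeCMap (𝟙 _) (GLn.inclE m j))) ∧
    -- the exact sequence for `F`, a direct summand of the one for tensoring with `L*`
    (∃ (α : (GLn.beforeC (𝟭 _) (LieMod.tensorLeft (LieMod.dual (GLn.std m))) :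
            GLn.Blocks.{u} n m i j ⥤ _) ⟶
          GLn.afterC (LieMod.tensorLeft (LieMod.dual (GLn.std (n + m)))))
        (β : (GLn.afterC (LieMod.tensorLeft (LieMod.dual (GLn.std (n + m)))) :
            GLn.Blocks.{u} n m i j ⥤ _) ⟶
          GLn.beforeC (LieMod.tensorLeft (LieMod.dual (GLn.std n))) (𝟭 _)),
      (∀ (X : GLn.Blocks.{u} n m i j) (ξ : Module.Dual ℂ (Fin m → ℂ)) (x : X.1.obj) (y : X.2.obj),
        LieMod.toLin (α.app X) (GLn.mkC n m x ((ξ : LieMod.dual (GLn.std m)) ⊗ₜ[ℂ] y)) =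
          (ξ ∘ₗ GLn.projL n m : LieMod.dual (GLn.std (n + m))) ⊗ₜ[ℂ] GLn.mkC n m x y) ∧
      (∀ (X : GLn.Blocks.{u} n m i j) (η : Module.Dual ℂ (Fin (n + m) → ℂ))
          (x : X.1.obj) (y : X.2.obj),
        LieMod.toLin (β.app X) ((η : LieMod.dual (GLn.std (n + m))) ⊗ₜ[ℂ] GLn.mkC n m x y) =
          GLn.mkC n m ((η ∘ₗ GLn.inclL n m : LieMod.dual (GLn.std n)) ⊗ₜ[ℂ] x) y) ∧
      LieMod.IsShortExactFunctors α β ∧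
      ∃ (α' : (GLn.beforeC (𝟭 _) (GLn.F m j) : GLn.Blocks.{u} n m i j ⥤ _) ⟶
            GLn.afterC (GLn.F (n + m) (i + j)))
          (β' : (GLn.afterC (GLn.F (n + m) (i + j)) : GLn.Blocks.{u} n m i j ⥤ _) ⟶
            GLn.beforeC (GLn.F n i) (𝟭 _)),
        LieMod.IsShortExactFunctors α' β' ∧
        LieMod.IsDirectSummand α' β' α β (GLn.beforeCMap (𝟙 _) (GLn.inclF m j))
          (GLn.afterCMap (GLn.inclF (n + m) (i + j))) (GLn.beforeCMap (GLn.inclF n i) (𝟙 _))) ∧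
    -- the filtrations for the divided powers
    ∀ a : ℕ,
      (GLn.IsExactBifunctor
          (GLn.afterC (GLn.Ediv a (n + m) (i + j)) : GLn.Blocks.{u} n m i j ⥤ _) ∧
        GLn.HasExactFiltration a
          (GLn.afterC (GLn.Ediv a (n + m) (i + j)) : GLn.Blocks.{u} n m i j ⥤ _)
          (fun k => GLn.beforeC (GLn.Ediv (a - k) n i) (GLn.Ediv k m j))) ∧
      (GLn.IsExactBifunctor
          (GLn.afterC (GLn.Fdiv a (n + m) (i + j)) : GLn.Blocks.{u} n m i j ⥤ _) ∧
        GLn.HasExactFiltration a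
          (GLn.afterC (GLn.Fdiv a (n + m) (i + j)) : GLn.Blocks.{u} n m i j ⥤ _)
          (fun k => GLn.beforeC (GLn.Fdiv k n i) (GLn.Fdiv (a - k) m j))) := by
  refine ⟨fun M N hM hN => GLn.block_C hM hN, fun r l M hM =>
    ⟨(GLn.finWt_std r).block_proj hM _, (GLn.finWt_dual_std r).block_proj hM _, fun a =>
      ⟨((GLn.finWt_std r).extPow a).block_proj hM _,
        ((GLn.finWt_dual_std r).extPow a).block_proj hM _⟩⟩,
    GLn.exists_exact_E n m i j, GLn.exists_exact_F n m i j, fun a =>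
    ⟨⟨((GLn.finWt_std (n + m)).extPow a).isExactBifunctor_afterC _,
      GLn.hasExactFiltration_Ediv n m i j a⟩,
     ⟨((GLn.finWt_dual_std (n + m)).extPow a).isExactBifunctor_afterC _,
      GLn.hasExactFiltration_Fdiv n m i j a⟩⟩⟩
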